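/- Let $k$ be an algebraically closed field of characteristic $0$, let $Y$ be a nonsingular variety over $k$ with a Poisson structure $\Lambda_0\in H^0(Y,\wedge^2T_Y)$, $[\Lambda_0,\Lambda_0]=0$, and let $i:X\hookrightarrow Y$ be a regular closed embedding of Poisson schemes, that is, $X$ is defined by a Poisson ideal sheaf $\mathcal I$ ($\{\mathcal I,\mathcal O_Y\}\subseteq\mathcal I$) which is locally generated by a regular sequence; let $\mathcal N_{X/Y}=\mathscr Hom_{\mathcal O_X}(\mathcal I/\mathcal I^2,\mathcal O_X)$. The complex of sheaves $(\wedge^2T_Y\oplus i_*\mathcal N_{X/Y})^\bullet$ on $Y$ has the term $\wedge^{p+2}T_Y\oplus i_*(\mathcal N_{X/Y}\otimes\wedge^pT_Y|_X)$ in degree $p\ge 0$. On an affine open set where $\mathcal I$ is generated by a regular sequence $f_1,\dots,f_N$, write $[\Lambda_0,f_\alpha]=\{f_\alpha,-\}=\sum_\beta f_\beta T_\alpha^\beta$ with vector fields $T_\alpha^\beta$ and $\mathcal N_{X/Y}\otimes\wedge^pT_Y|_X\cong\bigoplus^N\wedge^pT_Y|_X$; the differential is $$(\Pi,(g^\alpha)_\alpha)\mapsto\Bigl(-[\Pi,\Lambda_0],\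 \bigl([\Pi,f_\alpha]|_X-[g^\alpha,\Lambda_0]|_X+(-1)^p\sum_\beta g^\beta\wedge T_\alpha^\beta|_X\bigr)_\alpha\Bigr),$$ where $[\cdot,\cdot]$ is the Schouten bracket, normalized by $[\Pi,f]=\Pi(df,-,\dots,-)$ and $[\Pi,v]=-\mathcal L_v\Pi$ for functions $f$ and vector fields $v$. Denote its hypercohomology by $\mathbb H^\bullet$. For a local artinian $k$-algebra $A$ with residue field $k$, an infinitesimal simultaneous deformation of $X$ in $(Y,\Lambda_0)$ over $A$ is a pair $(\Lambda,\mathcal X)$, where $\Lambda$ is a Poisson structure on $Y\times\operatorname{Spec}A$ over $A$ that induces $\Lambda_0$ on $Y$, and $\mathcal X\subseteq(Y\times\operatorname{Spec}A,\Lambda)$ is a Poisson closed subscheme, flat over $A$, whose fibre over the closed point is $X\subseteq Y$. Let $EH(A)$ be the set of these. Then: (1) There is a natural identification $EH(k[\epsilon])\cong\mathbb H^0(Y,(\wedge^2T_Y\oplus i_*\mathcal N_{X/Y})^\bullet)$, namely the bijection $(\Lambda_0+\epsilon\Lambda',\mathcal X)\mapsto(-\Lambda',\varphi)$, where $\varphi(f)=g|_X$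 whenever $f\in\mathcal I$ and $f+\epsilon g$ lies in the ideal of $\mathcal X$. (2) Let $\eta=(\Lambda,\mathcal X)\in EH(A)$ and let $e:0\to(t)\to\tilde A\to A\to0$ be a small extension of local artinian $k$-algebras with residue field $k$ ($t\ne0$, $\mathfrak m_{\tilde A}t=0$). There is an associated element $o_\eta(e)\in\mathbb H^1(Y,(\wedge^2T_Y\oplus i_*\mathcal N_{X/Y})^\bullet)$, which is zero if and only if there is a lifting of $\eta$ to $\tilde A$. Explicitly, choose an affine open cover $\{U_j\}$ of $Y$, regular sequences $(f_j^\alpha)_\alpha$ that generate $\mathcal I|_{U_j}$, functions $\tilde F_j^\alpha$ on $U_j\times\operatorname{Spec}\tilde A$ that reduce to $f_j^\alpha$ and whose images over $A$ generate the ideal of $\mathcal X$, and bivector fields $\tilde\Lambda_j$ on $U_j\times\operatorname{Spec}\tilde A$ that lift $\Lambda$. Write $[\tilde\Lambda_j,\tilde\Lambda_j]=t\,\Pi_j$, $\tilde\Lambda_j-\tilde\Lambda_l=t\,\Lambda'_{jl}$, $[\tilde\Lambda_j,\tilde F_j^\alpha]=\sum_\beta\tilde F_j^\beta\tilde T_{j\alpha}^\beta+t\,G_j^\alpha$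 with vector fields $\tilde T_{j\alpha}^\beta$, and $\tilde F_j^\alpha=\sum_\beta\tilde R_{jl\beta}^\alpha\tilde F_l^\beta+t\,h_{jl}^\alpha$. Such choices exist, $\bigl(\{(\tfrac12\Pi_j,(-G_j^\alpha|_X)_\alpha)\},\{(-\Lambda'_{jl},(h_{jl}^\alpha|_X)_\alpha)\}\bigr)$ is a Čech $1$-cocycle of the complex, and $o_\eta(e)$ is its class, which does not depend on the choices. -/

import Mathlib

open CategoryTheory AlgebraicGeometry

universe u

noncomputable section

namespace PoissonDef

/-! ### Polyderivations and the Chevalley-Eilenberg formula -/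

section Algebra

variable {R A B : Type*} [CommRing R] [CommRing A] [CommRing B]

/-- `D` is an alternating map of `p` variables from the `R`-algebra `A` (structure map `c`) to the
`A`-algebra `B` (structure map `φ`) that is an `R`-linear derivation in each variable
(`R`-linearity follows from additivity, the Leibniz rule and vanishing on constants).
Equivalently, `D` is an `A`-linear map from the `p`-th exterior power of `Ω_{A/R}` to `B`. -/
structure IsPolyderivation (c : R →+* A) (φ : A →+* B) {p : ℕ} (D : (Fin p → A) → B) :
    Prop where
  map_add : ∀ (v : Fin p → A) (l : Fin p) (a b : A),
    D (Function.update v l (a + b)) = D (Function.update v l a) + D (Function.update v l b)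
  leibniz : ∀ (v : Fin p → A) (l : Fin p) (a b : A),
    D (Function.update v l (a * b)) =
      φ a * D (Function.update v l b) + φ b * D (Function.update v l a)
  map_const : ∀ (v : Fin p → A) (l : Fin p) (r : R), D (Function.update v l (c r)) = 0
  alternating : ∀ (v : Fin p → A) (l m : Fin p), l ≠ m → v l = v m → D v = 0

theorem IsPolyderivation.zero (c : R →+* A) (φ : A →+* B) (p : ℕ) :
    IsPolyderivation c φ (0 : (Fin p → A) → B) :=
  ⟨by simp, by simp, by simp, by simp⟩

theorem IsPolyderivation.add {c : R →+* A} {φ : A →+* B} {p : ℕ} {D E : (Fin p → A) → B}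
    (hD : IsPolyderivation c φ D) (hE : IsPolyderivation c φ E) :
    IsPolyderivation c φ (D + E) where
  map_add v l a b := by simp only [Pi.add_apply, hD.map_add, hE.map_add]; ring
  leibniz v l a b := by simp only [Pi.add_apply, hD.leibniz, hE.leibniz]; ring
  map_const v l r := by simp only [Pi.add_apply, hD.map_const, hE.map_const, add_zero]
  alternating v l m h h' := by
    simp only [Pi.add_apply, hD.alternating v l m h h', hE.alternating v l m h h', add_zero]

theorem IsPolyderivation.neg {c : R →+* A} {φ : A →+* B} {p : ℕ} {D : (Fin p → A) → B}
    (hD : IsPolyderivation c φ D) : IsPolyderivation c φ (-D) where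
  map_add v l a b := by simp only [Pi.neg_apply, hD.map_add]; ring
  leibniz v l a b := by simp only [Pi.neg_apply, hD.leibniz]; ring
  map_const v l r := by simp only [Pi.neg_apply, hD.map_const, neg_zero]
  alternating v l m h h' := by simp only [Pi.neg_apply, hD.alternating v l m h h', neg_zero]

/-- The Chevalley-Eilenberg (Lichnerowicz-Poisson) formula
`(dD)(h_0, …, h_p) = ∑_j (-1)^j h_j · D(h_0, …, ĥ_j, …, h_p)
  + ∑_{j<l} (-1)^{j+l} D({h_j, h_l}, h_0, …, ĥ_j, …, ĥ_l, …, h_p)`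
for alternating `D`; in the second sum the entry `{h_j, h_l}` is written in the place of `h_l`
instead of the first place, which turns the sign into `-(-1)^j`. -/
def ceDiff {A M : Type*} [AddCommGroup M] (br : A → A → A) (act : A → M → M) {p : ℕ}
    (D : (Fin p → A) → M) (h : Fin (p + 1) → A) : M :=
  ∑ j : Fin (p + 1), (-1 : ℤ) ^ (j : ℕ) •
    (act (h j) (D fun l => h (j.succAbove l)) -
      ∑ l : Fin p with j < j.succAbove l,
        D (Function.update (fun m => h (j.succAbove m)) l (br (h j) (h (j.succAbove l)))))

/-- The cyclic sum in the Jacobi identity. -/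
def jacobiSum {A : Type*} [Add A] (br : A → A → A) (a b c : A) : A :=
  br a (br b c) + br b (br c a) + br c (br a b)

theorem ceDiff_add {A M : Type*} [AddCommGroup M] (br : A → A → A) (act : A → M → M)
    (hact : ∀ a x y, act a (x + y) = act a x + act a y) {p : ℕ} (D E : (Fin p → A) → M)
    (h : Fin (p + 1) → A) :
    ceDiff br act (D + E) h = ceDiff br act D h + ceDiff br act E h := by
  simp only [ceDiff, Pi.add_apply, hact, Finset.sum_add_distrib]
  rw [← Finset.sum_add_distrib]
  refine Finset.sum_congr rfl fun j _ => ?_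
  rw [← smul_add]
  congr 1
  abel

end Algebra

/-! ### Poisson schemes -/

section Poisson

/-- Restriction of sections of the structure sheaf. -/
abbrev res {Z : Scheme.{u}} {V W : Z.Opens} (h : W ≤ V) : Γ(Z, V) →+* Γ(Z, W) :=
  (Z.presheaf.map (homOfLE h).op).hom

variable {R : Type u} [CommRing R] {Z : Scheme.{u}}

/-- The constants `R → Γ(Z, V)` of a scheme over `Spec R`. -/
def const (π : Z ⟶ Spec (.of R)) (V : Z.Opens) : R →+* Γ(Z, V) :=
  ((Scheme.ΓSpecIso (.of R)).inv ≫ π.appTop ≫ Z.presheaf.map (homOfLE le_top).op).hom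

/-- A Poisson structure on `Z` relative to `Spec R`: an `R`-bilinear Lie bracket on the structure
sheaf that is a derivation in each variable. Such a bracket is the same as a section `Λ` of
`ℋom(∧² Ω_{Z/R}, 𝒪_Z)` with `[Λ, Λ] = 0`, through `{a, b} = Λ(da ∧ db)`. -/
structure PoissonStructure (π : Z ⟶ Spec (.of R)) where
  bracket : ∀ V : Z.Opens, Γ(Z, V) → Γ(Z, V) → Γ(Z, V)
  add_right : ∀ V a b c, bracket V a (b + c) = bracket V a b + bracket V a c
  leibniz : ∀ V a b c, bracket V a (b * c) = b * bracket V a c + c * bracket V a b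
  const_right : ∀ V a r, bracket V a (const π V r) = 0
  self : ∀ V a, bracket V a a = 0
  skew : ∀ V a b, bracket V b a = -bracket V a b
  jacobi : ∀ V a b c, jacobiSum (bracket V) a b c = 0
  restrict : ∀ (V W : Z.Opens) (h : W ≤ V) (a b : Γ(Z, V)),
    res h (bracket V a b) = bracket W (res h a) (res h b)

/-- `f : Z' ⟶ Z` is compatible with the brackets (the base rings may be different). -/
def IsPoissonHom {R' : Type u} [CommRing R'] {Z' : Scheme.{u}} (f : Z' ⟶ Z)
    {π' : Z' ⟶ Spec (.of R')} {π : Z ⟶ Spec (.of R)}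
    (Λ' : PoissonStructure π') (Λ : PoissonStructure π) : Prop :=
  ∀ (V : Z.Opens) (a b : Γ(Z, V)),
    (f.app V).hom (Λ.bracket V a b) = Λ'.bracket (f ⁻¹ᵁ V) ((f.app V).hom a) ((f.app V).hom b)

/-- The closed subscheme `ι : T ⟶ Z` is a Poisson subscheme: its ideal sheaf `ℐ` satisfies
`{ℐ, 𝒪_Z} ⊆ ℐ`. -/
def IsPoissonSubscheme {π : Z ⟶ Spec (.of R)} (Λ : PoissonStructure π) {T : Scheme.{u}}
    (ι : T ⟶ Z) : Prop :=
  ∀ (V : Z.Opens) (a b : Γ(Z, V)), (ι.app V).hom a = 0 → (ι.app V).hom (Λ.bracket V a b) = 0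

/-- Families of functions of `q` variables on the sections of `𝒪_Z` over the opens `V ⊆ U`. -/
abbrev PolyFamily (Z : Scheme.{u}) (U : Z.Opens) (q : ℕ) : Type u :=
  ∀ V : Set.Iic U, (Fin q → Γ(Z, V.1)) → Γ(Z, V.1)

/-- The family `P` is a section over `U` of the sheaf `ℋom(∧^q Ω_{Z/R}, 𝒪_Z)` of alternating
`q`-derivations of `𝒪_Z`; for `Z` smooth over `R` this is the sheaf `∧^q T_{Z/R}` (the bivector
`X ∧ Y` being `(a, b) ↦ X a * Y b - Y a * X b`). -/
structure IsPolyvector (π : Z ⟶ Spec (.of R)) (U : Z.Opens) {q : ℕ} (P : PolyFamily Z U q) :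
    Prop where
  polyderivation : ∀ (V : Z.Opens) (hV : V ≤ U),
    IsPolyderivation (const π V) (RingHom.id Γ(Z, V)) (P ⟨V, hV⟩)
  restrict : ∀ (V W : Z.Opens) (hV : V ≤ U) (h : W ≤ V) (v : Fin q → Γ(Z, V)),
    res h (P ⟨V, hV⟩ v) = P ⟨W, h.trans hV⟩ fun l => res h (v l)

/-- The closed embedding `i : X ⟶ Y` is regular: locally on `Y`, the ideal of `X` is generated by
a regular sequence. (The sequence is weakly regular, which allows the unit ideal away
from `X`; where the affine open meets `X`, it is a regular sequence.) -/
def IsRegularEmbedding {X Y : Scheme.{u}} (i : X ⟶ Y) : Prop :=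
  ∀ y : Y, ∃ U : Y.Opens, y ∈ U ∧ IsAffineOpen U ∧ ∃ (n : ℕ) (f : Fin n → Γ(Y, U)),
    RingTheory.Sequence.IsWeaklyRegular Γ(Y, U) (List.ofFn f) ∧
      Ideal.span (Set.range f) = RingHom.ker (i.app U).hom

end Poisson

/-! ### The complex `(∧² T_Y ⊕ i_* N_{X/Y})^•` -/

section Complex

variable {k : Type u} [Field k] {Y X : Scheme.{u}} {π : Y ⟶ Spec (.of k)} {i : X ⟶ Y}
  {Λ₀ : PoissonStructure π} {ΛX : PoissonStructure (i ≫ π)}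

theorem PoissonStructure.bracket_zero {R : Type u} [CommRing R] {Z : Scheme.{u}}
    {ρ : Z ⟶ Spec (.of R)} (Λ : PoissonStructure ρ) (V : Z.Opens) (a : Γ(Z, V)) :
    Λ.bracket V a 0 = 0 := by
  simpa using Λ.add_right V a 0 0

theorem bracket_mem_ker (hi : IsPoissonHom i ΛX Λ₀) (V : Y.Opens) (h a : Γ(Y, V))
    (ha : a ∈ RingHom.ker (i.app V).hom) : Λ₀.bracket V h a ∈ RingHom.ker (i.app V).hom := by
  rw [RingHom.mem_ker] at ha ⊢
  rw [hi V h a, ha, ΛX.bracket_zero]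

/-- Families of functions, on the opens `V ⊆ U`, of one element of the ideal of `X` and of `p`
functions on `Y`, with values in the functions on `X`. -/
abbrev NormalFamily (i : X ⟶ Y) (U : Y.Opens) (p : ℕ) : Type u :=
  ∀ V : Set.Iic U, RingHom.ker (i.app V.1).hom → (Fin p → Γ(Y, V.1)) → Γ(X, i ⁻¹ᵁ V.1)

/-- The family `Φ` is a section over `U` of the sheaf
`i_* (N_{X/Y} ⊗ ∧^p T_Y|_X) = ℋom_{𝒪_Y}(ℐ, ℋom_{𝒪_Y}(Ω^p_Y, i_* 𝒪_X))`,
where `ℐ` is the ideal sheaf of `X`; here `Y` is smooth, `ℐ / ℐ²` is locally free over `𝒪_X`, and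
`N_{X/Y} = ℋom(ℐ / ℐ², 𝒪_X)`. If `f₁, …, f_N` is a regular sequence that generates `ℐ`, then `Φ`
corresponds to the sections `g^α = Φ(f_α, -)` of `∧^p T_Y|_X`. -/
structure IsNormalSection (π : Y ⟶ Spec (.of k)) (i : X ⟶ Y) (U : Y.Opens) {p : ℕ}
    (Φ : NormalFamily i U p) : Prop where
  polyderivation : ∀ (V : Y.Opens) (hV : V ≤ U) (f : RingHom.ker (i.app V).hom),
    IsPolyderivation (const π V) (i.app V).hom (Φ ⟨V, hV⟩ f)
  map_add : ∀ (V : Y.Opens) (hV : V ≤ U) (f g : RingHom.ker (i.app V).hom)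
    (v : Fin p → Γ(Y, V)), Φ ⟨V, hV⟩ (f + g) v = Φ ⟨V, hV⟩ f v + Φ ⟨V, hV⟩ g v
  map_smul : ∀ (V : Y.Opens) (hV : V ≤ U) (a : Γ(Y, V)) (f : RingHom.ker (i.app V).hom)
    (v : Fin p → Γ(Y, V)), Φ ⟨V, hV⟩ (a • f) v = (i.app V).hom a * Φ ⟨V, hV⟩ f v
  restrict : ∀ (V W : Y.Opens) (hV : V ≤ U) (h : W ≤ V) (f : RingHom.ker (i.app V).hom)
    (f' : RingHom.ker (i.app W).hom), (f' : Γ(Y, W)) = res h f → ∀ v : Fin p → Γ(Y, V),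
      res (i.preimage_mono h) (Φ ⟨V, hV⟩ f v) = Φ ⟨W, h.trans hV⟩ f' fun l => res h (v l)

/-- Pairs of families; the sections over `U` of the `p`-th term of the complex are the pairs
in `complexSections`. -/
abbrev PairFamily (i : X ⟶ Y) (U : Y.Opens) (p : ℕ) : Type u :=
  PolyFamily Y U (p + 2) × NormalFamily i U p

/-- The group of sections over `U` of `∧^{p+2} T_Y ⊕ i_* (N_{X/Y} ⊗ ∧^p T_Y|_X)`. -/
def complexSections (π : Y ⟶ Spec (.of k)) (i : X ⟶ Y) (U : Y.Opens) (p : ℕ) :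
    AddSubgroup (PairFamily i U p) where
  carrier := {s | IsPolyvector π U s.1 ∧ IsNormalSection π i U s.2}
  zero_mem' := by
    refine ⟨⟨fun V hV => .zero _ _ _, fun V W hV h v => ?_⟩,
      ⟨fun V hV f => .zero _ _ _, fun V hV f g v => ?_, fun V hV a f v => ?_,
        fun V W hV h f f' _ v => ?_⟩⟩ <;> simp
  add_mem' := by
    rintro s t ⟨hs, hs'⟩ ⟨ht, ht'⟩
    refine ⟨⟨fun V hV => (hs.polyderivation V hV).add (ht.polyderivation V hV),
      fun V W hV h v => ?_⟩,
      ⟨fun V hV f => (hs'.polyderivation V hV f).add (ht'.polyderivation V hV f),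
        fun V hV f g v => ?_, fun V hV a f v => ?_, fun V W hV h f f' hf v => ?_⟩⟩
    · simp [hs.restrict V W hV h, ht.restrict V W hV h]
    · simp only [Prod.snd_add, Pi.add_apply, hs'.map_add, ht'.map_add]; abel
    · simp only [Prod.snd_add, Pi.add_apply, hs'.map_smul, ht'.map_smul]; ring
    · simp [hs'.restrict V W hV h f f' hf, ht'.restrict V W hV h f f' hf]
  neg_mem' := by
    rintro s ⟨hs, hs'⟩
    refine ⟨⟨fun V hV => (hs.polyderivation V hV).neg, fun V W hV h v => ?_⟩,
      ⟨fun V hV f => (hs'.polyderivation V hV f).neg,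
        fun V hV f g v => ?_, fun V hV a f v => ?_, fun V W hV h f f' hf v => ?_⟩⟩
    · simp [hs.restrict V W hV h]
    · simp only [Prod.snd_neg, Pi.neg_apply, hs'.map_add]; abel
    · simp only [Prod.snd_neg, Pi.neg_apply, hs'.map_smul]; ring
    · simp [hs'.restrict V W hV h f f' hf]

/-- Restriction of pairs of families to a smaller open. -/
def restrictPair (i : X ⟶ Y) (p : ℕ) {U U' : Y.Opens} (h : U' ≤ U) :
    PairFamily i U p →+ PairFamily i U' p where
  toFun s := (fun V => s.1 ⟨V.1, V.2.trans h⟩, fun V => s.2 ⟨V.1, V.2.trans h⟩)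
  map_zero' := rfl
  map_add' _ _ := rfl

theorem restrictPair_mem {p : ℕ} {U U' : Y.Opens} (h : U' ≤ U) {s : PairFamily i U p}
    (hs : s ∈ complexSections π i U p) : restrictPair i p h s ∈ complexSections π i U' p :=
  ⟨⟨fun V hV => hs.1.polyderivation V (hV.trans h),
    fun V W hV h' => hs.1.restrict V W (hV.trans h) h'⟩,
   ⟨fun V hV => hs.2.polyderivation V (hV.trans h), fun V hV => hs.2.map_add V (hV.trans h),
    fun V hV => hs.2.map_smul V (hV.trans h),
    fun V W hV h' => hs.2.restrict V W (hV.trans h) h'⟩⟩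

/-- The differential of the complex. Its first component is
`-[Π, Λ₀] (h_0, …, h_{p+2}) = ∑_j (-1)^j {h_j, Π(…, ĥ_j, …)} + ∑_{j<l} (-1)^{j+l} Π({h_j, h_l}, …)`.
Its second component sends an element `f` of the ideal of `X` to
`Π(f, h_0, …, h_p)|_X + (d Φ(f, -))(h_0, …, h_p) - ∑_j (-1)^j Φ({h_j, f}, …, ĥ_j, …)`.
If `f_1, …, f_N` is a regular sequence that generates the ideal of `X`, if
`[Λ₀, f_α] = {f_α, -} = ∑_β f_β T_α^β` with vector fields `T_α^β`, and `g^α = Φ(f_α, -)`, then the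
three terms at `f = f_α` are the restrictions to `X` of `[Π, f_α]`, of `-[g^α, Λ₀]`, and
`(-1)^p ∑_β g^β ∧ T_α^β`. -/
def differential (hi : IsPoissonHom i ΛX Λ₀) (U : Y.Opens) (p : ℕ) :
    PairFamily i U p →+ PairFamily i U (p + 1) :=
  AddMonoidHom.mk'
    (fun s =>
      (fun V h => ceDiff (Λ₀.bracket V.1) (Λ₀.bracket V.1) (s.1 V) h,
       fun V f h =>
        (i.app V.1).hom (s.1 V (Fin.cons (f : Γ(Y, V.1)) h)) +
        ceDiff (Λ₀.bracket V.1) (fun a x => ΛX.bracket (i ⁻¹ᵁ V.1) ((i.app V.1).hom a) x)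
          (s.2 V f) h -
        ∑ j : Fin (p + 1), (-1 : ℤ) ^ (j : ℕ) •
          s.2 V ⟨Λ₀.bracket V.1 (h j) f, bracket_mem_ker hi V.1 (h j) f f.2⟩
            fun l => h (j.succAbove l)))
    (by
      intro s t
      refine Prod.ext ?_ ?_
      · funext V h
        exact ceDiff_add _ _ (Λ₀.add_right V.1) _ _ _
      · funext V f h
        simp only [Prod.snd_add, Prod.fst_add, Pi.add_apply, map_add, smul_add,
          Finset.sum_add_distrib]
        rw [ceDiff_add _ _ (fun a x y => ΛX.add_right _ _ x y)]
        abel)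

/-- `ℍ⁰(Y, (∧² T_Y ⊕ i_* N_{X/Y})^•)`: the complex starts in degree `0`, so this is the group of
global sections of its first term that are annihilated by the differential. -/
def H0 (hi : IsPoissonHom i ΛX Λ₀) : AddSubgroup (PairFamily i (⊤ : Y.Opens) 0) :=
  complexSections π i ⊤ 0 ⊓ (differential hi ⊤ 0).ker

/-! ### Čech hypercohomology in degree one -/

/-- Open covers of `Y` indexed by the points of `Y`. -/
@[ext]
structure PointCover (Y : Scheme.{u}) where
  U : Y → Y.Opens
  mem : ∀ y, y ∈ U y

/-- `𝒰 ≤ 𝒱` means that the cover `𝒱` is finer than `𝒰`. -/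
instance : PartialOrder (PointCover Y) where
  le 𝒰 𝒱 := ∀ y, 𝒱.U y ≤ 𝒰.U y
  le_refl _ _ := le_rfl
  le_trans _ _ _ h h' y := (h' y).trans (h y)
  le_antisymm _ _ h h' := PointCover.ext (funext fun y => le_antisymm (h' y) (h y))

/-- Families that contain the Čech cochains of total degree one, `C⁰(𝒰, K¹) ⊕ C¹(𝒰, K⁰)`. -/
abbrev CechFamily (i : X ⟶ Y) (𝒰 : PointCover Y) : Type u :=
  (∀ y : Y, PairFamily i (𝒰.U y) 1) × (∀ y z : Y, PairFamily i (𝒰.U y ⊓ 𝒰.U z) 0)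

/-- The Čech one-cocycles `(c, h)` of the complex `K^•` with differential `d`: they satisfy
`d c = 0`, `δ c + d h = 0` and `δ h = 0`. -/
def cocycles (hi : IsPoissonHom i ΛX Λ₀) (𝒰 : PointCover Y) : AddSubgroup (CechFamily i 𝒰) where
  carrier := {s |
    (∀ y, s.1 y ∈ complexSections π i (𝒰.U y) 1) ∧
    (∀ y z, s.2 y z ∈ complexSections π i (𝒰.U y ⊓ 𝒰.U z) 0) ∧
    (∀ y, differential hi (𝒰.U y) 1 (s.1 y) = 0) ∧
    (∀ y z, restrictPair i 1 inf_le_right (s.1 z) - restrictPair i 1 inf_le_left (s.1 y) +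
      differential hi (𝒰.U y ⊓ 𝒰.U z) 0 (s.2 y z) = 0) ∧
    (∀ y z w,
      restrictPair i 0
          (le_inf (inf_le_left.trans inf_le_right) inf_le_right :
            𝒰.U y ⊓ 𝒰.U z ⊓ 𝒰.U w ≤ 𝒰.U z ⊓ 𝒰.U w) (s.2 z w) -
        restrictPair i 0
          (le_inf (inf_le_left.trans inf_le_left) inf_le_right :
            𝒰.U y ⊓ 𝒰.U z ⊓ 𝒰.U w ≤ 𝒰.U y ⊓ 𝒰.U w) (s.2 y w) +
        restrictPair i 0
          (inf_le_left : 𝒰.U y ⊓ 𝒰.U z ⊓ 𝒰.U w ≤ 𝒰.U y ⊓ 𝒰.U z) (s.2 y z) = 0)}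
  zero_mem' := by
    refine ⟨fun y => zero_mem _, fun y z => zero_mem _, fun y => ?_, fun y z => ?_,
      fun y z w => ?_⟩ <;> simp
  add_mem' := by
    rintro s t ⟨h1, h2, h3, h4, h5⟩ ⟨k1, k2, k3, k4, k5⟩
    refine ⟨fun y => add_mem (h1 y) (k1 y), fun y z => add_mem (h2 y z) (k2 y z), fun y => ?_,
      fun y z => ?_, fun y z w => ?_⟩
    · simp [h3 y, k3 y]
    · have := congrArg₂ (· + ·) (h4 y z) (k4 y z)
      simp only [Prod.fst_add, Prod.snd_add, Pi.add_apply, map_add, add_zero] at this ⊢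
      rw [← this]; abel
    · have := congrArg₂ (· + ·) (h5 y z w) (k5 y z w)
      simp only [Prod.snd_add, Pi.add_apply, map_add, add_zero] at this ⊢
      rw [← this]; abel
  neg_mem' := by
    rintro s ⟨h1, h2, h3, h4, h5⟩
    refine ⟨fun y => neg_mem (h1 y), fun y z => neg_mem (h2 y z), fun y => ?_,
      fun y z => ?_, fun y z w => ?_⟩
    · simp [h3 y]
    · have := congrArg Neg.neg (h4 y z)
      simp only [Prod.fst_neg, Prod.snd_neg, Pi.neg_apply, map_neg, neg_zero] at this ⊢
      rw [← this]; abel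
    · have := congrArg Neg.neg (h5 y z w)
      simp only [Prod.snd_neg, Pi.neg_apply, map_neg, neg_zero] at this ⊢
      rw [← this]; abel

/-- The Čech coboundary `a ↦ (d a, -δ a)` on `C⁰(𝒰, K⁰)`. -/
def coboundary (hi : IsPoissonHom i ΛX Λ₀) (𝒰 : PointCover Y) :
    (∀ y : Y, PairFamily i (𝒰.U y) 0) →+ CechFamily i 𝒰 :=
  AddMonoidHom.mk'
    (fun a => (fun y => differential hi (𝒰.U y) 0 (a y),
      fun y z => -(restrictPair i 0 inf_le_right (a z) - restrictPair i 0 inf_le_left (a y))))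
    (by
      intro a b
      refine Prod.ext ?_ ?_
      · funext y; simp
      · funext y z
        simp only [Pi.add_apply, map_add, Prod.snd_add]
        abel)

/-- The Čech one-coboundaries: the images of the cochains in `C⁰(𝒰, K⁰)`. -/
def coboundaries (hi : IsPoissonHom i ΛX Λ₀) (𝒰 : PointCover Y) :
    AddSubgroup (CechFamily i 𝒰) :=
  (AddSubgroup.pi Set.univ fun y => complexSections π i (𝒰.U y) 0).map (coboundary hi 𝒰)

/-- The first Čech hypercohomology group of the complex with respect to the cover `𝒰`. -/
abbrev CechH1 (hi : IsPoissonHom i ΛX Λ₀) (𝒰 : PointCover Y) : Type u :=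
  cocycles hi 𝒰 ⧸ (coboundaries hi 𝒰).addSubgroupOf (cocycles hi 𝒰)

/-- Restriction of Čech cochains to a finer cover. -/
def refine (i : X ⟶ Y) {𝒰 𝒱 : PointCover Y} (h : 𝒰 ≤ 𝒱) : CechFamily i 𝒰 →+ CechFamily i 𝒱 where
  toFun s := (fun y => restrictPair i 1 (h y) (s.1 y),
    fun y z => restrictPair i 0 (inf_le_inf (h y) (h z)) (s.2 y z))
  map_zero' := rfl
  map_add' _ _ := rfl

theorem refine_mem (hi : IsPoissonHom i ΛX Λ₀) {𝒰 𝒱 : PointCover Y} (h : 𝒰 ≤ 𝒱)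
    {s : CechFamily i 𝒰} (hs : s ∈ cocycles hi 𝒰) : refine i h s ∈ cocycles hi 𝒱 := by
  obtain ⟨h1, h2, h3, h4, h5⟩ := hs
  exact ⟨fun y => restrictPair_mem _ (h1 y), fun y z => restrictPair_mem _ (h2 y z),
    fun y => congrArg (restrictPair i 2 (h y)) (h3 y),
    fun y z => congrArg (restrictPair i 1 (inf_le_inf (h y) (h z))) (h4 y z),
    fun y z w => congrArg
      (restrictPair i 0 (inf_le_inf (inf_le_inf (h y) (h z)) (h w))) (h5 y z w)⟩

/-- The map on cocycles induced by a refinement. -/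
def refineCocycles (hi : IsPoissonHom i ΛX Λ₀) {𝒰 𝒱 : PointCover Y} (h : 𝒰 ≤ 𝒱) :
    cocycles hi 𝒰 →+ cocycles hi 𝒱 :=
  ((refine i h).comp (cocycles hi 𝒰).subtype).codRestrict _ fun s => refine_mem hi h s.2

/-- The map on Čech hypercohomology induced by a refinement. -/
def refineH1 (hi : IsPoissonHom i ΛX Λ₀) (𝒰 𝒱 : PointCover Y) (h : 𝒰 ≤ 𝒱) :
    CechH1 hi 𝒰 →+ CechH1 hi 𝒱 :=
  QuotientAddGroup.map _ _ (refineCocycles hi h) (by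
    rintro s ⟨a, ha, has⟩
    refine ⟨fun y => restrictPair i 0 (h y) (a y), fun y _ => restrictPair_mem _ (ha y trivial), ?_⟩
    exact congrArg (refine i h) has)

open Classical in
/-- `ℍ¹(Y, (∧² T_Y ⊕ i_* N_{X/Y})^•)` as Čech hypercohomology: the direct limit, over all open
covers of `Y`, of the first cohomology groups of the total Čech complexes. (In degree one this is
canonically the derived functor hypercohomology, on every topological space.) -/
def H1 (hi : IsPoissonHom i ΛX Λ₀) : Type u :=
  AddCommGroup.DirectLimit (CechH1 hi) (refineH1 hi)

open Classical in
instance (hi : IsPoissonHom i ΛX Λ₀) : AddCommGroup (H1 hi) :=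
  inferInstanceAs (AddCommGroup (AddCommGroup.DirectLimit (CechH1 hi) (refineH1 hi)))

open Classical in
/-- The class in `ℍ¹` of a Čech one-cocycle. -/
def H1.mk (hi : IsPoissonHom i ΛX Λ₀) {𝒰 : PointCover Y} (s : cocycles hi 𝒰) : H1 hi :=
  AddCommGroup.DirectLimit.of (CechH1 hi) (refineH1 hi) 𝒰 (QuotientAddGroup.mk s)

end Complex

/-! ### Infinitesimal simultaneous deformations -/

section Deformations

variable {k : Type u} [Field k] {Y : Scheme.{u}}

/-- The morphism of spectra induced by a homomorphism of `k`-algebras. -/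
abbrev specMap {A B : Type u} [CommRing A] [Algebra k A] [CommRing B] [Algebra k B]
    (φ : B →ₐ[k] A) : Spec (.of A) ⟶ Spec (.of B) :=
  Spec.map (CommRingCat.ofHom φ.toRingHom)

/-- The structure morphism `Spec A ⟶ Spec k`. -/
abbrev specStr (k : Type u) [Field k] (A : Type u) [CommRing A] [Algebra k A] :
    Spec (.of A) ⟶ Spec (.of k) :=
  Spec.map (CommRingCat.ofHom (algebraMap k A))

theorem specMap_str {A B : Type u} [CommRing A] [Algebra k A] [CommRing B] [Algebra k B]
    (φ : B →ₐ[k] A) : specMap φ ≫ specStr k B = specStr k A := by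
  rw [← Spec.map_comp, ← CommRingCat.ofHom_comp]
  congr 2
  exact φ.comp_algebraMap

theorem specMap_aug {A : Type u} [CommRing A] [Algebra k A] (ε : A →ₐ[k] k) :
    specMap ε ≫ specStr k A = 𝟙 _ := by
  rw [specMap_str, specStr, Algebra.algebraMap_self, CommRingCat.ofHom_id, Spec.map_id]

variable (π : Y ⟶ Spec (.of k)) (A : Type u) [CommRing A] [Algebra k A]

/-- The product `Y × Spec A` over `k`. -/
abbrev Thick : Scheme.{u} := Limits.pullback π (specStr k A)

/-- The projection `Y × Spec A ⟶ Y`. -/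
abbrev Thick.proj : Thick π A ⟶ Y := Limits.pullback.fst π (specStr k A)

/-- The projection `Y × Spec A ⟶ Spec A`. -/
abbrev Thick.str : Thick π A ⟶ Spec (.of A) := Limits.pullback.snd π (specStr k A)

variable {A}

/-- The closed fibre `Y ⟶ Y × Spec A` over the point `Spec k ⟶ Spec A`. -/
def Thick.fibre (ε : A →ₐ[k] k) : Y ⟶ Thick π A :=
  Limits.pullback.lift (𝟙 Y) (π ≫ specMap ε)
    (by rw [Category.assoc, specMap_aug, Category.comp_id, Category.id_comp])

/-- The morphism `Y × Spec A ⟶ Y × Spec B` induced by a homomorphism `B → A`. -/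
def Thick.map {B : Type u} [CommRing B] [Algebra k B] (φ : B →ₐ[k] A) :
    Thick π A ⟶ Thick π B :=
  Limits.pullback.lift (Thick.proj π A) (Thick.str π A ≫ specMap φ)
    (by rw [Category.assoc, specMap_str]; exact Limits.pullback.condition)

/-- `T' ⊆ Z'` (over `S'`) is the base change of the subscheme `T ⊆ Z` (over `S`): there is a
morphism `T' ⟶ T` that is compatible with the embeddings and makes the square
`T' ⟶ T`, `S' ⟶ S` cartesian. -/
def InducesSubscheme {T Z S T' Z' S' : Scheme.{u}} (ι : T ⟶ Z) (ρ : Z ⟶ S) (ι' : T' ⟶ Z')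
    (ρ' : Z' ⟶ S') (s : Z' ⟶ Z) (b : S' ⟶ S) : Prop :=
  ∃ j : T' ⟶ T, j ≫ ι = ι' ≫ s ∧ IsPullback j (ι' ≫ ρ') (ι ≫ ρ) b

variable {π} {X : Scheme.{u}}

/-- An infinitesimal simultaneous deformation of `X` in `(Y, Λ₀)` over `A`, where `ε : A → k` is the
augmentation: a Poisson structure `Λ` on `Y × Spec A` over `A` that induces `Λ₀` on the closed
fibre, with a Poisson closed subscheme `𝒳` of `(Y × Spec A, Λ)`, flat over `A`, such that `X` is the
fibre of `𝒳` over the closed point. -/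
@[ext]
structure Deformation (i : X ⟶ Y) (Λ₀ : PoissonStructure π) (ε : A →ₐ[k] k) where
  Λ : PoissonStructure (Thick.str π A)
  /-- the ideal sheaf of `𝒳` -/
  ideal : (Thick π A).IdealSheafData
  flat : Flat (ideal.subschemeι ≫ Thick.str π A)
  isPoisson : IsPoissonSubscheme Λ ideal.subschemeι
  induces_poisson : IsPoissonHom (Thick.fibre π ε) Λ₀ Λ
  induces_subscheme : InducesSubscheme ideal.subschemeι (Thick.str π A) i π (Thick.fibre π ε)
    (specMap ε)

/-- The deformation `η'` over `A'` is a lifting of `η` over `A`: it induces `η` along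
`φ : A' → A`. -/
def Deformation.Lifts {i : X ⟶ Y} {Λ₀ : PoissonStructure π} {ε : A →ₐ[k] k}
    {A' : Type u} [CommRing A'] [Algebra k A'] {φ : A' →ₐ[k] A}
    (η' : Deformation i Λ₀ (ε.comp φ)) (η : Deformation i Λ₀ ε) : Prop :=
  IsPoissonHom (Thick.map π φ) η.Λ η'.Λ ∧
    InducesSubscheme η'.ideal.subschemeι (Thick.str π A') η.ideal.subschemeι (Thick.str π A)
      (Thick.map π φ) (specMap φ)

/-! ### The obstruction cochain -/

/-- Local liftings of the deformation `η` along `φ : A' → A`: an affine open cover, on each member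
`U` of it a regular sequence `f` that generates the ideal of `X`, functions `F` on `U × Spec A'` that
reduce to `f` and whose images over `A` generate the ideal of `𝒳`, and a bivector field `Λ` on
`U × Spec A'` that lifts the Poisson structure of `η`. -/
structure LocalLiftings {i : X ⟶ Y} {Λ₀ : PoissonStructure π} {ε : A →ₐ[k] k}
    (η : Deformation i Λ₀ ε) {A' : Type u} [CommRing A'] [Algebra k A'] (φ : A' →ₐ[k] A) where
  cover : PointCover Y
  affine : ∀ y, IsAffineOpen (cover.U y)
  n : Y → ℕ
  f : ∀ y, Fin (n y) → Γ(Y, cover.U y)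
  regular : ∀ y, RingTheory.Sequence.IsWeaklyRegular Γ(Y, cover.U y) (List.ofFn (f y))
  span_f : ∀ y, Ideal.span (Set.range (f y)) = RingHom.ker (i.app (cover.U y)).hom
  F : ∀ y, Fin (n y) → Γ(Thick π A', Thick.proj π A' ⁻¹ᵁ cover.U y)
  F_reduces : ∀ y α, ((Thick.fibre π (ε.comp φ)).app _).hom (F y α) =
    ((Thick.fibre π (ε.comp φ)).app _).hom (((Thick.proj π A').app (cover.U y)).hom (f y α))
  span_F : ∀ y, Ideal.span (Set.range fun α => ((Thick.map π φ).app _).hom (F y α)) =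
    RingHom.ker (η.ideal.subschemeι.app
      (Thick.map π φ ⁻¹ᵁ Thick.proj π A' ⁻¹ᵁ cover.U y)).hom
  Λ : ∀ y, PolyFamily (Thick π A') (Thick.proj π A' ⁻¹ᵁ cover.U y) 2
  isPolyvector : ∀ y, IsPolyvector (Thick.str π A') (Thick.proj π A' ⁻¹ᵁ cover.U y) (Λ y)
  Λ_lifts : ∀ (y : Y) (V : (Thick π A').Opens) (hV : V ≤ Thick.proj π A' ⁻¹ᵁ cover.U y)
    (a b : Γ(Thick π A', V)), ((Thick.map π φ).app V).hom (Λ y ⟨V, hV⟩ ![a, b]) =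
      η.Λ.bracket (Thick.map π φ ⁻¹ᵁ V)
        (((Thick.map π φ).app V).hom a) (((Thick.map π φ).app V).hom b)

/-- The pull-back of functions from `V ⊆ Y` to `V × Spec A`. -/
abbrev pull (π : Y ⟶ Spec (.of k)) (A : Type u) [CommRing A] [Algebra k A] (V : Y.Opens) :
    Γ(Y, V) →+* Γ(Thick π A, Thick.proj π A ⁻¹ᵁ V) :=
  ((Thick.proj π A).app V).hom

/-- The function `t * a` on `V × Spec A`, for `t` in `A` and a function `a` on `V ⊆ Y`. -/
abbrev tmul (π : Y ⟶ Spec (.of k)) {A : Type u} [CommRing A] [Algebra k A] (t : A) {V : Y.Opens}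
    (a : Γ(Y, V)) : Γ(Thick π A, Thick.proj π A ⁻¹ᵁ V) :=
  const (Thick.str π A) (Thick.proj π A ⁻¹ᵁ V) t * pull π A V a

/-- The cochain `(c, h)` of `C⁰(K¹) ⊕ C¹(K⁰)` is the one defined by the local liftings `D` and the
generator `t` of the kernel of `A' → A`, that is, with sums over repeated indices:
* `c_y = (½ Π_y, -G_y)` with `[Λ_y, Λ_y] = t Π_y` and `[Λ_y, F_y^α] = F_y^β T_{yα}^β + t G_y^α`
  for vector fields `T_{yα}^β`,
* `h_{yz} = (-Λ'_{yz}, h'_{yz})` with `Λ_y - Λ_z = t Λ'_{yz}` and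
  `F_y^α = R_{yzβ}^α F_z^β + t h'_{yz}^α`.
Here `½ [Λ, Λ]` is minus the cyclic sum `Λ(a, Λ(b, c)) + Λ(b, Λ(c, a)) + Λ(c, Λ(a, b))`, in
accordance with `-[Λ₀, Λ₀] = dΛ₀` for the differential `d` above. -/
structure IsObstructionCochain {i : X ⟶ Y} {Λ₀ : PoissonStructure π} {ε : A →ₐ[k] k}
    {η : Deformation i Λ₀ ε} {A' : Type u} [CommRing A'] [Algebra k A'] {φ : A' →ₐ[k] A}
    (D : LocalLiftings η φ) (t : A') (s : CechFamily i D.cover) : Prop where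
  mem₁ : ∀ y, s.1 y ∈ complexSections π i (D.cover.U y) 1
  mem₀ : ∀ y z, s.2 y z ∈ complexSections π i (D.cover.U y ⊓ D.cover.U z) 0
  jacobiator : ∀ (y : Y) (V : Y.Opens) (hV : V ≤ D.cover.U y) (a b c : Γ(Y, V)),
    -jacobiSum
        (fun a b => D.Λ y ⟨Thick.proj π A' ⁻¹ᵁ V, (Thick.proj π A').preimage_mono hV⟩ ![a, b])
        (pull π A' V a) (pull π A' V b) (pull π A' V c) =
      tmul π t ((s.1 y).1 ⟨V, hV⟩ ![a, b, c])
  hamiltonian : ∀ (y : Y) (V : Y.Opens) (hV : V ≤ D.cover.U y) (α : Fin (D.n y))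
    (f : RingHom.ker (i.app V).hom), (f : Γ(Y, V)) = res hV (D.f y α) → ∀ x g : Γ(Y, V),
    D.Λ y ⟨Thick.proj π A' ⁻¹ᵁ V, (Thick.proj π A').preimage_mono hV⟩
        ![res ((Thick.proj π A').preimage_mono hV) (D.F y α), pull π A' V x] - tmul π t g ∈
      Ideal.span (Set.range fun β => res ((Thick.proj π A').preimage_mono hV) (D.F y β)) →
    (s.1 y).2 ⟨V, hV⟩ f ![x] = -(i.app V).hom g
  bivector : ∀ (y z : Y) (V : Y.Opens) (hV : V ≤ D.cover.U y ⊓ D.cover.U z) (a b : Γ(Y, V)),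
    D.Λ y ⟨Thick.proj π A' ⁻¹ᵁ V, (Thick.proj π A').preimage_mono (hV.trans inf_le_left)⟩
        ![pull π A' V a, pull π A' V b] -
      D.Λ z ⟨Thick.proj π A' ⁻¹ᵁ V, (Thick.proj π A').preimage_mono (hV.trans inf_le_right)⟩
        ![pull π A' V a, pull π A' V b] =
      -tmul π t ((s.2 y z).1 ⟨V, hV⟩ ![a, b])
  normal : ∀ (y z : Y) (V : Y.Opens) (hV : V ≤ D.cover.U y ⊓ D.cover.U z) (α : Fin (D.n y))
    (f : RingHom.ker (i.app V).hom),
    (f : Γ(Y, V)) = res (hV.trans inf_le_left) (D.f y α) → ∀ g : Γ(Y, V),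
    res ((Thick.proj π A').preimage_mono (hV.trans inf_le_left)) (D.F y α) - tmul π t g ∈
      Ideal.span (Set.range fun β =>
        res ((Thick.proj π A').preimage_mono (hV.trans inf_le_right)) (D.F z β)) →
    (s.2 y z).2 ⟨V, hV⟩ f ![] = (i.app V).hom g

end Deformations

end PoissonDef

end

/-!
Let `A' → A` be a small extension with kernel `(t)`. The functions on `W × Spec A'`, for `W` an
affine open of `Y`, are `A' ⊗ Γ(Y, W)`; multiplication by `t` kills the functions that vanish on
the closed fibre and is injective on `Γ(Y, W)` (`IsThickening`). Everything below is done with the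
functions on affine opens.

A *lift* over an open `U` of `Y` (`IsLift`) is a biderivation of the functions on `U × Spec A'`
with a flat ideal `J` that reduces to the ideal of `X`, which are a Poisson bracket and a Poisson
ideal modulo `t`. Its defect is an *obstruction* (`IsObs`): the Jacobiator is `-t` times a
trivector field on `Y`, and the Hamiltonian fields of the functions in `J` lie in `J + t O`, which
gives a section of `𝒩 ⊗ T_Y|_X`; here flatness, in the form `J ∩ m O = m J` and `J ∩ t O = t J`,
makes the section well defined. In the same way two lifts that agree modulo `t` have a *difference*
(`IsDiff`), which is a section of the term of degree zero of the complex. Three facts carry the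
whole proof:

* the obstruction is closed (`IsObs.differential_eq_zero`); for the first component this is the
  Bianchi identity, for the second the Jacobi identity modulo `J`;
* obstructions of two lifts differ by the differential of their difference
  (`IsDiff.differential_eq`), and differences are additive (`IsDiff.add`);
* every section of degree zero is the difference of a given lift and another one, its *twist*
  (`IsLift.exists_twist`), and lifts with difference zero are equal (`IsDiff.eq_of_zero`).

Lifts without obstruction that agree on overlaps glue to a deformation (`exists_deformation`): the
brackets by the sheaf property, the ideals because a flat ideal is determined on smaller affine
opens by `J ∩ m O = m J` and Nakayama's lemma (`IsLift.map_J`), so that they form an ideal sheaf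
(`exists_ideal_of_forall_map`).

First-order deformations: over the dual numbers all lifts agree modulo `ε`. So a deformation is
determined by its difference from the trivial one, the difference is closed because both have
obstruction zero, and conversely twisting the trivial deformation by a closed section yields a lift
without obstruction, that is, a deformation (`exists_deformation_equiv`).

Obstructions: liftings of a regular sequence generate an ideal with `J ∩ m O = m J`
(`mem_ker_mul_span_of_regular`), and the bracket lifts with the help of a `k`-linear section of `A'
→ A` (`Deformation.exists_bracket_lift`). So a deformation `η` over `A` has lifts on the members of
a cover, and their obstructions and differences are the cochain of the theorem
(`IsObstructionCochain.isObs_isDiff`). By the first two facts it is a cocycle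
(`IsDatum.mem_cocycles`), and another choice of lifts changes it by the coboundary of the
differences of the lifts (`IsDatum.mk_eq`). If `η` lifts to `A'`, then the restrictions of a
lifting are lifts with cochain zero. If the class is zero, then after refinement the cochain is the
coboundary of some sections, and twisting by these yields lifts without obstruction that agree on
overlaps (`IsDatum.exists_zero_of_mk_eq_zero`), which glue to a lifting of `η`.

Flatness enters through its local form: for nilpotent `m` with `A / m = k`, the quotient `O / J` is
flat over `A` if and only if `J ∩ m O = m J` (`mem_map_mul_of_flat`, `IsTensor.flat_quotient`). In
the second direction, an `A`-linear automorphism of `O = A ⊗ B` carries `A ⊗ I` to `J`, where `I`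
is the ideal of `X` (`IsTensor.exists_quotient_equiv`).
-/

noncomputable section

namespace PoissonDef

/-! ### Brackets and flat ideals on infinitesimal thickenings of rings -/

section Thickening

variable {R A B C O : Type*} [CommRing R] [CommRing A] [CommRing B] [CommRing C] [CommRing O]

/-- The situation of functions on `W × Spec A` over functions on `W`: `c` are the constants, `p` is
the pull-back and `r` the restriction to the closed fibre. The ideal `m` of `A` is the maximal ideal,
and `t` spans the kernel of a small extension. -/
structure IsThickening (c : A →+* O) (p : B →+* O) (r : O →+* B) (m : Ideal A) (t : A) : Prop where
  r_p : ∀ b, r (p b) = b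
  t_mem : t ∈ m
  r_const : ∀ a ∈ m, r (c a) = 0
  mem_map : ∀ x, r x = 0 → x ∈ m.map c
  mul_t : ∀ a ∈ m, a * t = 0
  t_inj : ∀ b, c t * p b = 0 → b = 0

/-- An alternating `A`-bilinear biderivation (an almost Poisson bracket). -/
structure IsBiderivation (c : A →+* O) (br : O → O → O) : Prop where
  add_right : ∀ u v w, br u (v + w) = br u v + br u w
  leibniz : ∀ u v w, br u (v * w) = v * br u w + w * br u v
  const_right : ∀ u a, br u (c a) = 0
  self : ∀ u, br u u = 0
  skew : ∀ u v, br v u = -br u v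

theorem jacobiSum_rotate (br : O → O → O) (u v w : O) :
    jacobiSum br u v w = jacobiSum br v w u := by
  simp only [jacobiSum]; ring

namespace IsBiderivation

variable {c : A →+* O} {br : O → O → O} (h : IsBiderivation c br)
include h

theorem zero_right (u : O) : br u 0 = 0 := by simpa using h.add_right u 0 0

theorem neg_right (u v : O) : br u (-v) = -br u v := by
  rw [eq_neg_iff_add_eq_zero, ← h.add_right, neg_add_cancel, h.zero_right]

theorem sub_right (u v w : O) : br u (v - w) = br u v - br u w := by
  rw [sub_eq_add_neg, h.add_right, h.neg_right, sub_eq_add_neg]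

theorem const_mul_right (u v : O) (a : A) : br u (c a * v) = c a * br u v := by
  rw [h.leibniz, h.const_right, mul_zero, add_zero]

theorem add_left (u v w : O) : br (u + v) w = br u w + br v w := by
  rw [h.skew, h.add_right, h.skew u, h.skew v]; ring

theorem zero_left (u : O) : br 0 u = 0 := by rw [h.skew, h.zero_right, neg_zero]

theorem neg_left (u v : O) : br (-u) v = -br u v := by
  rw [h.skew v (-u), h.neg_right, h.skew u v, neg_neg]

theorem sub_left (u v w : O) : br (u - v) w = br u w - br v w := by
  rw [sub_eq_add_neg, h.add_left, h.neg_left, sub_eq_add_neg]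

theorem const_left (u : O) (a : A) : br (c a) u = 0 := by rw [h.skew, h.const_right, neg_zero]

theorem leibniz_left (u v w : O) : br (u * v) w = u * br v w + v * br u w := by
  rw [h.skew, h.leibniz, h.skew u w, h.skew v w]; ring

theorem const_mul_left (u v : O) (a : A) : br (c a * u) v = c a * br u v := by
  rw [h.leibniz_left, h.const_left, mul_zero, add_zero]

theorem jacobi_add (u u' v w : O) :
    jacobiSum br (u + u') v w = jacobiSum br u v w + jacobiSum br u' v w := by
  simp only [jacobiSum, h.add_left, h.add_right]; ring

theorem jacobi_const_mul (u v w : O) (a : A) :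
    jacobiSum br (c a * u) v w = c a * jacobiSum br u v w := by
  simp only [jacobiSum, h.const_mul_left, h.const_mul_right]; ring

theorem jacobi_leibniz (u u' v w : O) :
    jacobiSum br (u * u') v w = u * jacobiSum br u' v w + u' * jacobiSum br u v w := by
  simp only [jacobiSum, h.leibniz_left, h.leibniz, h.add_right]
  linear_combination br w u' * h.skew u v + br w u * h.skew u' v

theorem jacobi_const (v w : O) (a : A) : jacobiSum br (c a) v w = 0 := by
  simp only [jacobiSum, h.const_left, h.const_right, h.zero_right, add_zero]

theorem jacobi_self (u w : O) : jacobiSum br u u w = 0 := by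
  simp only [jacobiSum, h.self, h.zero_right, add_zero]
  rw [h.skew u w, h.neg_right, add_neg_cancel]

/-- The Chevalley-Eilenberg differential of the Jacobiator vanishes for every alternating
bracket. -/
theorem jacobi_bianchi (a b d e : O) :
    (br a (jacobiSum br b d e) - br b (jacobiSum br a d e) + br d (jacobiSum br a b e)
        - br e (jacobiSum br a b d)) - jacobiSum br (br a b) d e - jacobiSum br b (br a d) e
        - jacobiSum br b d (br a e) + jacobiSum br a (br b d) e + jacobiSum br a d (br b e)
        - jacobiSum br a b (br d e) = 0 := by
  simp only [jacobiSum, h.add_right, h.skew (br a b) (br d e), h.skew (br a d) (br b e),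
    h.skew (br a e) (br b d), h.skew a e, h.skew a d, h.skew b e, h.neg_right, h.skew e (br b d),
    h.skew e (br a d), h.skew d (br a b), h.skew b (br a e), h.skew a (br b e), h.skew a (br d e)]
  ring

end IsBiderivation

section Lift

variable {c : A →+* O} {p : B →+* O} {r : O →+* B} {m : Ideal A} {t : A}

namespace IsThickening

variable (hT : IsThickening c p r m t)
include hT

theorem r_t (u : O) : r (c t * u) = 0 := by rw [map_mul, hT.r_const t hT.t_mem, zero_mul]

theorem t_mul_of_mem_map {x : O} (hx : x ∈ m.map c) : c t * x = 0 := by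
  refine Submodule.span_induction (p := fun x _ => c t * x = 0) ?_ (mul_zero _) ?_ ?_ hx
  · rintro _ ⟨a, ha, rfl⟩
    rw [← map_mul, mul_comm, hT.mul_t a ha, map_zero]
  · intro x y _ _ hx hy
    rw [mul_add, hx, hy, add_zero]
  · intro a x _ hx
    rw [smul_eq_mul, mul_left_comm, hx, mul_zero]

/-- Multiplication by `t` depends on the restriction to the closed fibre only, since `m t = 0`. -/
theorem t_mul (x : O) : c t * x = c t * p (r x) := by
  have : c t * (x - p (r x)) = 0 :=
    hT.t_mul_of_mem_map (hT.mem_map _ (by rw [map_sub, hT.r_p, sub_self]))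
  rwa [mul_sub, sub_eq_zero] at this

theorem t_cancel {a b : B} (h : c t * p a = c t * p b) : a = b := by
  rw [← sub_eq_zero]
  exact hT.t_inj _ (by rw [map_sub, mul_sub, h, sub_self])

end IsThickening

/-- An ideal `J` of `O` whose quotient is flat over the base and whose closed fibre is the kernel of
`ρ : B → C`. The field `tor` says that `Tor₁(O / J, A / m)` vanishes, which by nilpotence of `m`
is equivalent to flatness; `t_mul_mem` is the consequence that the kernel of the small extension
meets `J` in `t J`. -/
structure IsFlatIdeal (c : A →+* O) (p : B →+* O) (r : O →+* B) (m : Ideal A) (t : A) (ρ : B →+* C)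
    (J : Ideal O) : Prop where
  ρ_r : ∀ x ∈ J, ρ (r x) = 0
  exists_lift : ∀ f, ρ f = 0 → ∃ x ∈ J, r x = f
  tor : ∀ x ∈ J, r x = 0 → x ∈ m.map c * J
  t_mul_mem : ∀ g, c t * p g ∈ J → ρ g = 0

/-- A bracket `br` and an ideal `J` on a thickening that are a Poisson bracket and a flat Poisson
ideal modulo `t`. -/
structure IsPoissonModT (c : A →+* O) (p : B →+* O) (r : O →+* B) (m : Ideal A) (t : A)
    (ρ : B →+* C) (br₀ : B → B → B) (br : O → O → O) (J : Ideal O) : Prop where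
  biderivation : IsBiderivation c br
  r_br : ∀ u v, r (br u v) = br₀ (r u) (r v)
  flat : IsFlatIdeal c p r m t ρ J
  jacobi : ∀ u v w, ∃ g, jacobiSum br u v w = c t * p g
  poisson : ∀ x ∈ J, ∀ u, ∃ g, br x u - c t * p g ∈ J

variable {ρ : B →+* C} {br₀ : B → B → B} {br : O → O → O} {J : Ideal O}

theorem IsFlatIdeal.t_mul_mem_iff (hT : IsThickening c p r m t) (hJ : IsFlatIdeal c p r m t ρ J)
    {g : B} : c t * p g ∈ J ↔ ρ g = 0 := by
  refine ⟨hJ.t_mul_mem g, fun hg => ?_⟩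
  obtain ⟨x, hx, rfl⟩ := hJ.exists_lift g hg
  rw [← hT.t_mul]
  exact Ideal.mul_mem_left _ _ hx

theorem IsFlatIdeal.ρ_eq (hJ : IsFlatIdeal c p r m t ρ J)
    {x : O} {g g' : B} (h : x - c t * p g ∈ J) (h' : x - c t * p g' ∈ J) : ρ g = ρ g' := by
  rw [← sub_eq_zero, ← map_sub]
  refine hJ.t_mul_mem _ ?_
  have := J.sub_mem h' h
  rwa [sub_sub_sub_cancel_left, ← mul_sub, ← map_sub] at this

namespace IsPoissonModT

variable (hT : IsThickening c p r m t) (h : IsPoissonModT c p r m t ρ br₀ br J)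
include hT h

/-- The bracket maps `J` into `J + t O` only, but `m J` into `J`, since `m t = 0`. -/
theorem mem_of_br_mem_map {x : O} (hx : x ∈ m.map c * J) (u : O) : br x u ∈ J := by
  refine Submodule.mul_induction_on hx (fun a ha y hy => ?_) fun a b ha hb => ?_
  · refine Submodule.span_induction (p := fun a _ => br (a * y) u ∈ J) ?_ ?_ ?_ ?_ ha
    · rintro _ ⟨a, ha, rfl⟩
      obtain ⟨g, hg⟩ := h.poisson y hy u
      rw [h.biderivation.const_mul_left]
      have := J.mul_mem_left (c a) hg
      rwa [mul_sub, ← mul_assoc, ← map_mul, hT.mul_t a ha, map_zero, zero_mul, sub_zero] at this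
    · rw [zero_mul, h.biderivation.zero_left]; exact J.zero_mem
    · intro a b _ _ ha hb
      rw [add_mul, h.biderivation.add_left]; exact J.add_mem ha hb
    · intro a b hb' hb
      rw [smul_eq_mul, mul_assoc, h.biderivation.leibniz_left]
      exact J.add_mem (J.mul_mem_left _ hb) (J.mul_mem_right _ (J.mul_mem_left _ hy))
  · rw [h.biderivation.add_left]; exact J.add_mem ha hb

theorem br_mem_of_left {x : O} (hx : x ∈ J) (hx' : r x = 0) (u : O) : br x u ∈ J :=
  h.mem_of_br_mem_map hT (h.flat.tor x hx hx') u

theorem br_mem_of_right {x : O} (hx : x ∈ J) {u : O} (hu : r u = 0) : br x u ∈ J := by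
  refine Submodule.span_induction (p := fun u _ => br x u ∈ J) ?_ ?_ ?_ ?_ (hT.mem_map u hu)
  · rintro _ ⟨a, ha, rfl⟩
    rw [h.biderivation.const_right]; exact J.zero_mem
  · rw [h.biderivation.zero_right]; exact J.zero_mem
  · intro a b _ _ ha hb
    rw [h.biderivation.add_right]; exact J.add_mem ha hb
  · intro a b hb' hb
    rw [smul_eq_mul, h.biderivation.leibniz]
    refine J.add_mem (J.mul_mem_left _ hb) ?_
    -- `b` lies in `m O`, so it kills the `t`-part of `br x a`
    obtain ⟨g, hg⟩ := h.poisson x hx a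
    have := J.mul_mem_left b hg
    rwa [mul_sub, ← mul_assoc, mul_comm b (c t), hT.t_mul_of_mem_map hb', zero_mul, sub_zero] at this

theorem br_sub_mem {x : O} (hx : x ∈ J) {u v : O} (huv : r u = r v) {w : O}
    (hw : br x u - w ∈ J) : br x v - w ∈ J := by
  have := J.sub_mem hw (h.br_mem_of_right hT hx (u := u - v) (by rw [map_sub, huv, sub_self]))
  rwa [h.biderivation.sub_right, show br x u - w - (br x u - br x v) = br x v - w by ring] at this

/-- The restriction of `g` in `{x, u} ∈ t g + J` depends on the restrictions of `x` and `u` to the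
closed fibre only. -/
theorem ρ_unique {x x' : O} (hx : x ∈ J) (hx' : x' ∈ J) (hr : r x = r x') {u v : O}
    (huv : r u = r v) {g g' : B} (hg : br x u - c t * p g ∈ J)
    (hg' : br x' v - c t * p g' ∈ J) : ρ g = ρ g' := by
  refine h.flat.ρ_eq (h.br_sub_mem hT hx huv hg) ?_
  have := h.br_mem_of_left hT (J.sub_mem hx hx') (by rw [map_sub, hr, sub_self]) v
  rw [h.biderivation.sub_left] at this
  have := J.add_mem this hg'
  rwa [show br x v - br x' v + (br x' v - c t * p g') = br x v - c t * p g' by ring] at this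

/-- Modulo `t` the Jacobiator vanishes, hence it vanishes on `m O`. -/
theorem jacobi_congr {u u' : O} (hu : r u = r u') (v w : O) :
    jacobiSum br u v w = jacobiSum br u' v w := by
  rw [← sub_eq_zero]
  have key : ∀ x ∈ m.map c, jacobiSum br x v w = 0 := by
    intro x hx
    refine Submodule.span_induction (p := fun x _ => jacobiSum br x v w = 0) ?_ ?_ ?_ ?_ hx
    · rintro _ ⟨a, ha, rfl⟩
      exact h.biderivation.jacobi_const v w a
    · simpa using h.biderivation.jacobi_const v w 0
    · intro a b _ _ ha hb
      rw [h.biderivation.jacobi_add, ha, hb, add_zero]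
    · intro a b hb' hb
      rw [smul_eq_mul, h.biderivation.jacobi_leibniz, hb, mul_zero, zero_add]
      obtain ⟨g, hg⟩ := h.jacobi a v w
      rw [hg, ← mul_assoc, mul_comm b, hT.t_mul_of_mem_map hb', zero_mul]
  have := key (u - u') (hT.mem_map _ (by rw [map_sub, hu, sub_self]))
  have e := h.biderivation.jacobi_add (u - u') u' v w
  rw [sub_add_cancel, this, zero_add] at e
  rw [e, sub_self]

theorem jacobi_congr₃ {u u' v v' w w' : O} (hu : r u = r u') (hv : r v = r v') (hw : r w = r w') :
    jacobiSum br u v w = jacobiSum br u' v' w' := by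
  rw [h.jacobi_congr hT hu, jacobiSum_rotate, h.jacobi_congr hT hv, jacobiSum_rotate,
    h.jacobi_congr hT hw, jacobiSum_rotate]

end IsPoissonModT

end Lift

end Thickening

/-! ### Polyderivations and the Chevalley–Eilenberg differential in low degrees -/

section Polyderivation

variable {R A B : Type*} [CommRing R] [CommRing A] [CommRing B] {c : R →+* A} {φ : A →+* B}

theorem isPolyderivation_zero (D : (Fin 0 → A) → B) : IsPolyderivation c φ D :=
  ⟨fun _ l => l.elim0, fun _ l => l.elim0, fun _ l => l.elim0, fun _ l => l.elim0⟩

theorem isPolyderivation_one {D : (Fin 1 → A) → B}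
    (hadd : ∀ a b, D ![a + b] = D ![a] + D ![b])
    (hmul : ∀ a b, D ![a * b] = φ a * D ![b] + φ b * D ![a])
    (hconst : ∀ x, D ![c x] = 0) : IsPolyderivation c φ D := by
  have e : ∀ (v : Fin 1 → A) (l : Fin 1) (a : A), Function.update v l a = ![a] := by
    intro v l a; ext j; fin_cases l; fin_cases j; simp
  refine ⟨fun v l a b => ?_, fun v l a b => ?_, fun v l x => ?_, fun v l m hlm => ?_⟩
  · simp only [e, hadd]
  · simp only [e, hmul]
  · simp only [e, hconst]
  · exact absurd (Subsingleton.elim l m) hlm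

theorem update_two_zero {A : Type*} (v : Fin 2 → A) (a : A) : Function.update v 0 a = ![a, v 1] := by
  ext j; fin_cases j <;> simp

theorem update_two_one {A : Type*} (v : Fin 2 → A) (a : A) : Function.update v 1 a = ![v 0, a] := by
  ext j; fin_cases j <;> simp

theorem isPolyderivation_two {D : (Fin 2 → A) → B}
    (hadd : ∀ u a b, D ![u, a + b] = D ![u, a] + D ![u, b])
    (hmul : ∀ u a b, D ![u, a * b] = φ a * D ![u, b] + φ b * D ![u, a])
    (hconst : ∀ u x, D ![u, c x] = 0) (hself : ∀ u, D ![u, u] = 0)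
    (hskew : ∀ u v, D ![v, u] = -D ![u, v]) : IsPolyderivation c φ D := by
  have e : ∀ v : Fin 2 → A, v = ![v 0, v 1] := fun v => by ext j; fin_cases j <;> rfl
  refine ⟨fun v l a b => ?_, fun v l a b => ?_, fun v l x => ?_, fun v l m hlm h => ?_⟩
  · fin_cases l
    · simp only [Fin.zero_eta, update_two_zero]
      rw [hskew (v 1), hadd, hskew (v 1) a, hskew (v 1) b]; ring
    · simp only [Fin.mk_one, update_two_one, hadd]
  · fin_cases l
    · simp only [Fin.zero_eta, update_two_zero]
      rw [hskew (v 1), hmul, hskew (v 1) a, hskew (v 1) b]; ring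
    · simp only [Fin.mk_one, update_two_one, hmul]
  · fin_cases l
    · simp only [Fin.zero_eta, update_two_zero]
      rw [hskew, hconst, neg_zero]
    · simp only [Fin.mk_one, update_two_one, hconst]
  · have h01 : v 0 = v 1 := by
      fin_cases l <;> fin_cases m <;> first | exact absurd rfl hlm | exact h | exact h.symm
    rw [e v, h01, hself]

theorem isPolyderivation_three {D : (Fin 3 → A) → B}
    (hadd : ∀ a b v w, D ![a + b, v, w] = D ![a, v, w] + D ![b, v, w])
    (hmul : ∀ a b v w, D ![a * b, v, w] = φ a * D ![b, v, w] + φ b * D ![a, v, w])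
    (hconst : ∀ x v w, D ![c x, v, w] = 0) (hself : ∀ v w, D ![v, v, w] = 0)
    (hrot : ∀ u v w, D ![u, v, w] = D ![v, w, u]) : IsPolyderivation c φ D := by
  have e : ∀ v : Fin 3 → A, v = ![v 0, v 1, v 2] := fun v => by ext j; fin_cases j <;> rfl
  have e0 : ∀ (v : Fin 3 → A) a, D (Function.update v 0 a) = D ![a, v 1, v 2] :=
    fun v a => congrArg D (by ext j; fin_cases j <;> simp)
  have e1 : ∀ (v : Fin 3 → A) a, D (Function.update v 1 a) = D ![a, v 2, v 0] := fun v a => by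
    rw [← hrot]; exact congrArg D (by ext j; fin_cases j <;> simp)
  have e2 : ∀ (v : Fin 3 → A) a, D (Function.update v 2 a) = D ![a, v 0, v 1] := fun v a => by
    rw [hrot, hrot]
    refine Eq.trans (congrArg D ?_) (hrot _ _ _)
    ext j; fin_cases j <;> simp
  refine ⟨fun v l a b => ?_, fun v l a b => ?_, fun v l x => ?_, fun v l m hlm h => ?_⟩
  · fin_cases l
    · exact (e0 v _).trans ((hadd ..).trans (congrArg₂ _ (e0 v a).symm (e0 v b).symm))
    · exact (e1 v _).trans ((hadd ..).trans (congrArg₂ _ (e1 v a).symm (e1 v b).symm))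
    · exact (e2 v _).trans ((hadd ..).trans (congrArg₂ _ (e2 v a).symm (e2 v b).symm))
  · fin_cases l
    · simp only [Fin.zero_eta, e0, hmul]
    · simp only [Fin.mk_one, e1, hmul]
    · simp only [Fin.reduceFinMk, e2, hmul]
  · fin_cases l
    · exact (e0 v _).trans (hconst ..)
    · exact (e1 v _).trans (hconst ..)
    · exact (e2 v _).trans (hconst ..)
  · have h' : v 0 = v 1 ∨ v 1 = v 2 ∨ v 2 = v 0 := by
      fin_cases l <;> fin_cases m <;>
        first
        | exact absurd rfl hlm | exact .inl h | exact .inl h.symm | exact .inr (.inl h)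
        | exact .inr (.inl h.symm) | exact .inr (.inr h) | exact .inr (.inr h.symm)
    rw [e v]
    rcases h' with h' | h' | h'
    · rw [h', hself]
    · rw [hrot, h', hself]
    · rw [← hrot, h', hself]

namespace IsPolyderivation

theorem two_add {D : (Fin 2 → A) → B} (h : IsPolyderivation c φ D) (u a b : A) :
    D ![u, a + b] = D ![u, a] + D ![u, b] := by
  simpa [update_two_one] using h.map_add ![u, 0] 1 a b

theorem two_mul {D : (Fin 2 → A) → B} (h : IsPolyderivation c φ D) (u a b : A) :
    D ![u, a * b] = φ a * D ![u, b] + φ b * D ![u, a] := by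
  simpa [update_two_one] using h.leibniz ![u, 0] 1 a b

theorem two_const {D : (Fin 2 → A) → B} (h : IsPolyderivation c φ D) (u : A) (x : R) :
    D ![u, c x] = 0 := by
  simpa [update_two_one] using h.map_const ![u, 0] 1 x

theorem two_self {D : (Fin 2 → A) → B} (h : IsPolyderivation c φ D) (u : A) : D ![u, u] = 0 :=
  h.alternating ![u, u] 0 1 (by simp) rfl

theorem two_add_left {D : (Fin 2 → A) → B} (h : IsPolyderivation c φ D) (u a b : A) :
    D ![a + b, u] = D ![a, u] + D ![b, u] := by
  simpa [update_two_zero] using h.map_add ![0, u] 0 a b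

theorem two_skew {D : (Fin 2 → A) → B} (h : IsPolyderivation c φ D) (u v : A) :
    D ![v, u] = -D ![u, v] := by
  have := h.two_self (u + v)
  rw [h.two_add, h.two_add_left, h.two_add_left, h.two_self, h.two_self, zero_add, add_zero] at this
  exact eq_neg_of_add_eq_zero_left this

theorem isBiderivation {A : Type*} [CommRing A] {c : R →+* A} {D : (Fin 2 → A) → A}
    (h : IsPolyderivation c (RingHom.id A) D) : IsBiderivation c fun u v => D ![u, v] :=
  ⟨h.two_add, h.two_mul, h.two_const, h.two_self, h.two_skew⟩

end IsPolyderivation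

theorem IsBiderivation.isPolyderivation {A : Type*} [CommRing A] {c : R →+* A}
    {br : A → A → A} (h : IsBiderivation c br) :
    IsPolyderivation c (RingHom.id A) fun v : Fin 2 → A => br (v 0) (v 1) :=
  isPolyderivation_two h.add_right h.leibniz h.const_right h.self h.skew

end Polyderivation

section CeDiff

variable {A M : Type*} [AddCommGroup M] (br : A → A → A) (act : A → M → M)

theorem ceDiff_zero (D : (Fin 0 → A) → M) (a : A) :
    ceDiff br act D ![a] = act a (D ![]) := by
  unfold ceDiff
  refine (Fin.sum_univ_one _).trans ?_
  rw [Subsingleton.elim (fun l : Fin 0 => ![a] ((0 : Fin 1).succAbove l)) ![]]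
  simp

theorem ceDiff_one (D : (Fin 1 → A) → M) (a b : A) :
    ceDiff br act D ![a, b] = act a (D ![b]) - D ![br a b] - act b (D ![a]) := by
  have e0 : (fun l : Fin 1 => ![a, b] ((0 : Fin 2).succAbove l)) = ![b] := by
    ext l; fin_cases l; rfl
  have e1 : (fun l : Fin 1 => ![a, b] ((1 : Fin 2).succAbove l)) = ![a] := by
    ext l; fin_cases l; rfl
  have u0 : ∀ x y : A, Function.update ![x] 0 y = ![y] := fun x y => by
    ext l; fin_cases l; rfl
  unfold ceDiff
  refine (Fin.sum_univ_two _).trans ?_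
  simp only [e0, e1, Finset.sum_filter, Fin.sum_univ_one, u0]
  simp [sub_eq_add_neg]

theorem ceDiff_two (D : (Fin 2 → A) → M) (a b d : A) :
    ceDiff br act D ![a, b, d] = act a (D ![b, d]) - act b (D ![a, d]) + act d (D ![a, b]) -
      D ![br a b, d] - D ![b, br a d] + D ![a, br b d] := by
  have e0 : (fun l : Fin 2 => ![a, b, d] ((0 : Fin 3).succAbove l)) = ![b, d] := by
    ext l; fin_cases l <;> rfl
  have e1 : (fun l : Fin 2 => ![a, b, d] ((1 : Fin 3).succAbove l)) = ![a, d] := by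
    ext l; fin_cases l <;> rfl
  have e2 : (fun l : Fin 2 => ![a, b, d] ((2 : Fin 3).succAbove l)) = ![a, b] := by
    ext l; fin_cases l <;> rfl
  have u0 : ∀ x y z : A, Function.update ![x, y] 0 z = ![z, y] := fun x y z => by
    ext l; fin_cases l <;> rfl
  have u1 : ∀ x y z : A, Function.update ![x, y] 1 z = ![x, z] := fun x y z => by
    ext l; fin_cases l <;> rfl
  unfold ceDiff
  refine (Fin.sum_univ_three _).trans ?_
  simp only [e0, e1, e2, Finset.sum_filter, Fin.sum_univ_two, u0, u1]
  simp [Fin.succAbove, Fin.lt_def]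
  abel

theorem ceDiff_three (D : (Fin 3 → A) → M) (a b d e : A) :
    ceDiff br act D ![a, b, d, e] =
      (act a (D ![b, d, e]) - act b (D ![a, d, e]) + act d (D ![a, b, e]) - act e (D ![a, b, d])) -
      D ![br a b, d, e] - D ![b, br a d, e] - D ![b, d, br a e] + D ![a, br b d, e]
        + D ![a, d, br b e] - D ![a, b, br d e] := by
  have e0 : (fun l : Fin 3 => ![a, b, d, e] ((0 : Fin 4).succAbove l)) = ![b, d, e] := by
    ext l; fin_cases l <;> rfl
  have e1 : (fun l : Fin 3 => ![a, b, d, e] ((1 : Fin 4).succAbove l)) = ![a, d, e] := by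
    ext l; fin_cases l <;> rfl
  have e2 : (fun l : Fin 3 => ![a, b, d, e] ((2 : Fin 4).succAbove l)) = ![a, b, e] := by
    ext l; fin_cases l <;> rfl
  have e3 : (fun l : Fin 3 => ![a, b, d, e] ((3 : Fin 4).succAbove l)) = ![a, b, d] := by
    ext l; fin_cases l <;> rfl
  have u0 : ∀ x y z w : A, Function.update ![x, y, z] 0 w = ![w, y, z] := fun x y z w => by
    ext l; fin_cases l <;> rfl
  have u1 : ∀ x y z w : A, Function.update ![x, y, z] 1 w = ![x, w, z] := fun x y z w => by
    ext l; fin_cases l <;> rfl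
  have u2 : ∀ x y z w : A, Function.update ![x, y, z] 2 w = ![x, y, w] := fun x y z w => by
    ext l; fin_cases l <;> rfl
  unfold ceDiff
  refine (Fin.sum_univ_four _).trans ?_
  simp only [e0, e1, e2, e3, Finset.sum_filter, Fin.sum_univ_three, u0, u1, u2]
  simp [Fin.succAbove, Fin.lt_def]
  abel

end CeDiff

/-! ### The obstruction of a lifting -/

section Obstruction

variable {R A B C O : Type*} [CommRing R] [CommRing A] [CommRing B] [CommRing C] [CommRing O]
  (c : A →+* O) (p : B →+* O) (r : O →+* B) (m : Ideal A) (t : A) (ρ : B →+* C)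

/-- `(T, Φ)` is the obstruction to `br` being a Poisson bracket with Poisson ideal `J`: the
Jacobiator of `br` is `-t T`, that is `½ [br, br] = t T`, and for `x` in `J` the function
`{x, b} - t g` lies in `J` for some `g` that restricts to `-Φ(r x, b)`. The condition `ham` is stated
for all such `g`; existence is the field `poisson` of `IsPoissonModT`. -/
structure IsObstructionAt (br : O → O → O) (J : Ideal O) (T : (Fin 3 → B) → B)
    (Φ : RingHom.ker ρ → (Fin 1 → B) → C) : Prop where
  jacobi : ∀ a b d, -jacobiSum br (p a) (p b) (p d) = c t * p (T ![a, b, d])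
  ham : ∀ x ∈ J, ∀ f : RingHom.ker ρ, (f : B) = r x → ∀ b g, br x (p b) - c t * p g ∈ J →
    Φ f ![b] = -ρ g

/-- `(T, Φ)` is the difference of the liftings `(br, J)` and `(br', J')`: `br' = br + t T`, and for
`x` in `J` the function `x - t g` lies in `J'` for some `g` that restricts to `Φ(r x)`. The condition
`normal` is stated for all such `g`; existence is the field `ideal` of `IsCongruentAt`. -/
structure IsDifferenceAt (br : O → O → O) (J : Ideal O) (br' : O → O → O) (J' : Ideal O)
    (T : (Fin 2 → B) → B) (Φ : RingHom.ker ρ → (Fin 0 → B) → C) : Prop where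
  bivector : ∀ a b, br (p a) (p b) - br' (p a) (p b) = -(c t * p (T ![a, b]))
  normal : ∀ x ∈ J, ∀ f : RingHom.ker ρ, (f : B) = r x → ∀ g, x - c t * p g ∈ J' →
    Φ f ![] = ρ g

/-- The pairs `(br, J)` and `(br', J')` are congruent modulo `t`, except that for the ideals only the
inclusion of `J` in `J' + t O` is demanded. -/
structure IsCongruentAt (br : O → O → O) (J : Ideal O) (br' : O → O → O) (J' : Ideal O) :
    Prop where
  bracket : ∀ u v, ∃ g, br u v - br' u v = c t * p g
  ideal : ∀ x ∈ J, ∃ g, x - c t * p g ∈ J'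

/-- The properties of the second component of a section of the complex on one open. -/
structure IsNormalAt (k₀ : R →+* B) {q : ℕ} (Φ : RingHom.ker ρ → (Fin q → B) → C) : Prop where
  polyderivation : ∀ f, IsPolyderivation k₀ ρ (Φ f)
  map_add : ∀ f g v, Φ (f + g) v = Φ f v + Φ g v
  map_smul : ∀ (a : B) f v, Φ (a • f) v = ρ a * Φ f v

variable {c p r m t ρ} {br₀ : B → B → B} {br br' br'' : O → O → O} {J J' J'' : Ideal O}

section Existence

variable (hT : IsThickening c p r m t) (h : IsPoissonModT c p r m t ρ br₀ br J)
  {k₀ : R →+* B}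
include hT h

theorem IsPoissonModT.exists_obstructionAt :
    ∃ T Φ, IsObstructionAt c p r t ρ br J T Φ := by
  choose F hF hrF using fun f : RingHom.ker ρ => h.flat.exists_lift f f.2
  choose G hG using h.poisson
  choose K hK using h.jacobi
  refine ⟨fun v => -K (p (v 0)) (p (v 1)) (p (v 2)),
    fun f v => -ρ (G (F f) (hF f) (p (v 0))), fun a b d => ?_, fun x hx f hf b g hg => ?_⟩
  · simp only [Matrix.cons_val]
    rw [map_neg, mul_neg, ← hK]
  · rw [neg_inj]
    exact h.ρ_unique hT (hF f) hx (by rw [hrF, hf]) rfl (hG _ _ _) hg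

variable (hk : ∀ x, ∃ a, p (k₀ x) = c a)
include hk

theorem IsObstructionAt.isPolyderivation {T : (Fin 3 → B) → B}
    {Φ : RingHom.ker ρ → (Fin 1 → B) → C} (ho : IsObstructionAt c p r t ρ br J T Φ) :
    IsPolyderivation k₀ (RingHom.id B) T := by
  refine isPolyderivation_three (fun a b v w => ?_) (fun a b v w => ?_) (fun x v w => ?_)
    (fun v w => ?_) fun u v w => ?_ <;> refine hT.t_cancel ?_
  · rw [map_add, mul_add, ← ho.jacobi, ← ho.jacobi, ← ho.jacobi, map_add,
      h.biderivation.jacobi_add, neg_add]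
  · rw [map_add, mul_add, map_mul, map_mul, mul_left_comm, mul_left_comm (c t), RingHom.id_apply,
      RingHom.id_apply, ← ho.jacobi, ← ho.jacobi, ← ho.jacobi, map_mul,
      h.biderivation.jacobi_leibniz]
    ring
  · obtain ⟨a, ha⟩ := hk x
    rw [← ho.jacobi, ha, h.biderivation.jacobi_const, map_zero, mul_zero, neg_zero]
  · rw [← ho.jacobi, h.biderivation.jacobi_self, map_zero, mul_zero, neg_zero]
  · rw [← ho.jacobi, ← ho.jacobi, jacobiSum_rotate]

theorem IsObstructionAt.isNormalAt {T : (Fin 3 → B) → B}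
    {Φ : RingHom.ker ρ → (Fin 1 → B) → C} (ho : IsObstructionAt c p r t ρ br J T Φ) :
    IsNormalAt ρ k₀ Φ := by
  have key : ∀ (f : RingHom.ker ρ) (b : B), ∃ x ∈ J, (f : B) = r x ∧
      ∃ g, br x (p b) - c t * p g ∈ J := fun f b => by
    obtain ⟨x, hx, e⟩ := h.flat.exists_lift f f.2
    exact ⟨x, hx, e.symm, h.poisson x hx _⟩
  have e1 : ∀ v : Fin 1 → B, v = ![v 0] := fun v => by ext j; fin_cases j; rfl
  refine ⟨fun f => isPolyderivation_one (fun a b => ?_) (fun a b => ?_) fun x => ?_,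
    fun f g v => ?_, fun a f v => ?_⟩
  · obtain ⟨x, hx, e, g, hg⟩ := key f a
    obtain ⟨g', hg'⟩ := h.poisson x hx (p b)
    rw [ho.ham x hx f e a g hg, ho.ham x hx f e b g' hg', ho.ham x hx f e (a + b) (g + g')]
    · rw [map_add, neg_add]
    · have := J.add_mem hg hg'
      rwa [sub_add_sub_comm, ← h.biderivation.add_right, ← mul_add, ← map_add, ← map_add] at this
  · obtain ⟨x, hx, e, g, hg⟩ := key f a
    obtain ⟨g', hg'⟩ := h.poisson x hx (p b)
    rw [ho.ham x hx f e a g hg, ho.ham x hx f e b g' hg',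
      ho.ham x hx f e (a * b) (a * g' + b * g)]
    · simp only [map_add, map_mul]; ring
    · have := J.add_mem (J.mul_mem_left (p a) hg') (J.mul_mem_left (p b) hg)
      rw [map_mul, h.biderivation.leibniz]
      convert this using 1
      simp only [map_add, map_mul]; ring
  · obtain ⟨y, hy, e, -⟩ := key f 0
    obtain ⟨a, ha⟩ := hk x
    rw [ho.ham y hy f e _ 0, map_zero, neg_zero]
    rw [ha, h.biderivation.const_right, map_zero, mul_zero, sub_zero]
    exact J.zero_mem
  · rw [e1 v]
    obtain ⟨x, hx, e, a, ha⟩ := key f (v 0)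
    obtain ⟨y, hy, e', b, hb⟩ := key g (v 0)
    rw [ho.ham x hx f e _ a ha, ho.ham y hy g e' _ b hb,
      ho.ham (x + y) (J.add_mem hx hy) (f + g) (by simp [e, e']) _ (a + b)]
    · rw [map_add, neg_add]
    · have := J.add_mem ha hb
      rwa [sub_add_sub_comm, ← h.biderivation.add_left, ← mul_add, ← map_add] at this
  · rw [e1 v]
    obtain ⟨x, hx, e, b, hb⟩ := key f (v 0)
    rw [ho.ham x hx f e _ b hb,
      ho.ham (p a * x) (J.mul_mem_left _ hx) (a • f) (by simp [e, hT.r_p]) _ (a * b)]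
    · rw [map_mul, mul_neg]
    · have := J.add_mem (J.mul_mem_left (p a) hb) (J.mul_mem_right (br (p a) (p (v 0))) hx)
      rw [h.biderivation.leibniz_left]
      convert this using 1
      rw [map_mul]; ring

end Existence

/-! ### Differences of liftings -/

/-- If `x ∈ J` restricts to zero on the closed fibre then `x ∈ J'`: the ideal `m J` does not see the
difference of `J` and `J'`. -/
theorem IsCongruentAt.mem_of_r_eq_zero (hT : IsThickening c p r m t)
    (h : IsPoissonModT c p r m t ρ br₀ br J) (hc : IsCongruentAt c p t br J br' J')
    {x : O} (hx : x ∈ J) (hr : r x = 0) : x ∈ J' := by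
  refine Submodule.mul_induction_on (h.flat.tor x hx hr) (fun a ha y hy => ?_)
    fun a b ha hb => J'.add_mem ha hb
  obtain ⟨g, hg⟩ := hc.ideal y hy
  have := J'.mul_mem_left a hg
  rwa [mul_sub, ← mul_assoc, mul_comm a (c t), hT.t_mul_of_mem_map ha, zero_mul, sub_zero] at this

theorem IsDifferenceAt.isPolyderivation (hT : IsThickening c p r m t)
    (h : IsPoissonModT c p r m t ρ br₀ br J) (h' : IsPoissonModT c p r m t ρ br₀ br' J')
    {k₀ : R →+* B} (hk : ∀ x, ∃ a, p (k₀ x) = c a)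
    {T : (Fin 2 → B) → B} {Φ : RingHom.ker ρ → (Fin 0 → B) → C}
    (hd : IsDifferenceAt c p r t ρ br J br' J' T Φ) : IsPolyderivation k₀ (RingHom.id B) T := by
  have e : ∀ a b, c t * p (T ![a, b]) = br' (p a) (p b) - br (p a) (p b) := fun a b => by
    linear_combination hd.bivector a b
  refine isPolyderivation_two (fun u a b => ?_) (fun u a b => ?_) (fun u x => ?_)
    (fun u => ?_) fun u v => ?_ <;> refine hT.t_cancel ?_
  · rw [map_add, mul_add, e, e, e, map_add, h.biderivation.add_right, h'.biderivation.add_right]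
    ring
  · rw [map_add, mul_add, map_mul, map_mul, mul_left_comm, mul_left_comm (c t), RingHom.id_apply,
      RingHom.id_apply, e, e, e, map_mul, h.biderivation.leibniz, h'.biderivation.leibniz]
    ring
  · obtain ⟨a, ha⟩ := hk x
    rw [e, ha, h.biderivation.const_right, h'.biderivation.const_right, map_zero, mul_zero,
      sub_zero]
  · rw [e, h.biderivation.self, h'.biderivation.self, map_zero, mul_zero, sub_zero]
  · rw [map_neg, mul_neg, e, e, h.biderivation.skew, h'.biderivation.skew]
    ring

theorem IsDifferenceAt.isNormalAt (hT : IsThickening c p r m t)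
    (h : IsPoissonModT c p r m t ρ br₀ br J) (hc : IsCongruentAt c p t br J br' J')
    {k₀ : R →+* B} {T : (Fin 2 → B) → B}
    {Φ : RingHom.ker ρ → (Fin 0 → B) → C}
    (hd : IsDifferenceAt c p r t ρ br J br' J' T Φ) : IsNormalAt ρ k₀ Φ := by
  have key : ∀ f : RingHom.ker ρ, ∃ x ∈ J, (f : B) = r x ∧ ∃ g, x - c t * p g ∈ J' := fun f => by
    obtain ⟨x, hx, e⟩ := h.flat.exists_lift f f.2
    exact ⟨x, hx, e.symm, hc.ideal x hx⟩
  refine ⟨fun f => isPolyderivation_zero _, fun f g v => ?_, fun a f v => ?_⟩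
  · rw [Subsingleton.elim v ![]]
    obtain ⟨x, hx, e, a, ha⟩ := key f
    obtain ⟨y, hy, e', b, hb⟩ := key g
    rw [hd.normal x hx f e a ha, hd.normal y hy g e' b hb,
      hd.normal (x + y) (J.add_mem hx hy) (f + g) (by simp [e, e']) (a + b), map_add]
    have := J'.add_mem ha hb
    rwa [sub_add_sub_comm, ← mul_add, ← map_add] at this
  · rw [Subsingleton.elim v ![]]
    obtain ⟨x, hx, e, b, hb⟩ := key f
    rw [hd.normal x hx f e b hb,
      hd.normal (p a * x) (J.mul_mem_left _ hx) (a • f) (by simp [e, hT.r_p]) (a * b), map_mul]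
    have := J'.mul_mem_left (p a) hb
    rwa [mul_sub, mul_left_comm, ← map_mul] at this

section Difference

variable (hT : IsThickening c p r m t) (h : IsPoissonModT c p r m t ρ br₀ br J)
  (h' : IsPoissonModT c p r m t ρ br₀ br' J') (hc : IsCongruentAt c p t br J br' J')
include hT h h' hc

theorem IsCongruentAt.ρ_unique {x y : O} (hx : x ∈ J) (hy : y ∈ J) (hr : r x = r y) {g g' : B}
    (hg : x - c t * p g ∈ J') (hg' : y - c t * p g' ∈ J') : ρ g = ρ g' := by
  refine h'.flat.ρ_eq hg ?_
  have := J'.add_mem hg' (hc.mem_of_r_eq_zero hT h (J.sub_mem hx hy)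
    (by rw [map_sub, hr, sub_self]))
  rwa [show y - c t * p g' + (x - y) = x - c t * p g' by ring] at this

/-- The difference of two brackets that are congruent modulo `t` is a biderivation on the closed
fibre. -/
theorem IsCongruentAt.bracket_congr {u v u' v' : O} (hu : r u = r u') (hv : r v = r v') :
    br u v - br' u v = br u' v' - br' u' v' := by
  have key : ∀ x ∈ m.map c, ∀ w, br w x = br' w x := by
    intro x hx w
    refine Submodule.span_induction (p := fun x _ => br w x = br' w x) ?_ ?_ ?_ ?_ hx
    · rintro _ ⟨a, ha, rfl⟩
      rw [h.biderivation.const_right, h'.biderivation.const_right]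
    · rw [h.biderivation.zero_right, h'.biderivation.zero_right]
    · intro a b _ _ ha hb
      rw [h.biderivation.add_right, h'.biderivation.add_right, ha, hb]
    · intro a b hb' hb
      rw [smul_eq_mul, h.biderivation.leibniz, h'.biderivation.leibniz, hb, add_right_inj,
        ← sub_eq_zero, ← mul_sub]
      obtain ⟨g, hg⟩ := hc.bracket w a
      rw [hg, ← mul_assoc, mul_comm b, hT.t_mul_of_mem_map hb', zero_mul]
  have e : ∀ w x y, r x = r y → br w x - br' w x = br w y - br' w y := fun w x y hxy => by
    have := key (x - y) (hT.mem_map _ (by rw [map_sub, hxy, sub_self])) w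
    rw [h.biderivation.sub_right, h'.biderivation.sub_right] at this
    linear_combination this
  rw [e u v v' hv]
  have := e v' u u' hu
  linear_combination -this + h.biderivation.skew u v' - h'.biderivation.skew u v' -
    h.biderivation.skew u' v' + h'.biderivation.skew u' v'

theorem IsDifferenceAt.bracket_eq {T : (Fin 2 → B) → B} {Φ : RingHom.ker ρ → (Fin 0 → B) → C}
    (hd : IsDifferenceAt c p r t ρ br J br' J' T Φ) {u v : O} {a b : B} (ha : r u = a)
    (hb : r v = b) : br' u v = br u v + c t * p (T ![a, b]) := by
  have := hc.bracket_congr hT h h' (u := u) (v := v) (u' := p a) (v' := p b)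
    (by rw [ha, hT.r_p]) (by rw [hb, hT.r_p])
  rw [hd.bivector] at this
  linear_combination -this

theorem IsPoissonModT.exists_differenceAt : ∃ T Φ, IsDifferenceAt c p r t ρ br J br' J' T Φ := by
  choose F hF hrF using fun f : RingHom.ker ρ => h.flat.exists_lift f f.2
  choose G hG using hc.ideal
  choose K hK using hc.bracket
  refine ⟨fun v => -K (p (v 0)) (p (v 1)), fun f _ => ρ (G (F f) (hF f)), fun a b => ?_,
    fun x hx f hf g hg => ?_⟩
  · simp only [Matrix.cons_val]
    rw [map_neg, mul_neg, ← hK, neg_neg]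
  · exact hc.ρ_unique hT h h' (hF f) hx (by rw [hrF, hf]) (hG _ _) hg

end Difference

theorem IsDifferenceAt.unique (hT : IsThickening c p r m t)
    (h : IsPoissonModT c p r m t ρ br₀ br J) (hc : IsCongruentAt c p t br J br' J')
    {T T' : (Fin 2 → B) → B} {Φ Φ' : RingHom.ker ρ → (Fin 0 → B) → C}
    (hd : IsDifferenceAt c p r t ρ br J br' J' T Φ)
    (hd' : IsDifferenceAt c p r t ρ br J br' J' T' Φ') : T = T' ∧ Φ = Φ' := by
  refine ⟨funext fun v => ?_, funext fun f => funext fun v => ?_⟩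
  · rw [show v = ![v 0, v 1] by ext j; fin_cases j <;> rfl]
    exact hT.t_cancel (by rw [← neg_inj, ← hd.bivector, ← hd'.bivector])
  · rw [Subsingleton.elim v ![]]
    obtain ⟨x, hx, e⟩ := h.flat.exists_lift f f.2
    obtain ⟨g, hg⟩ := hc.ideal x hx
    rw [hd.normal x hx f e.symm g hg, hd'.normal x hx f e.symm g hg]

theorem IsDifferenceAt.add (hc : IsCongruentAt c p t br J br' J')
    (hc' : IsCongruentAt c p t br' J' br'' J'') (hT : IsThickening c p r m t)
    (h'' : IsPoissonModT c p r m t ρ br₀ br'' J'')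
    {T T' : (Fin 2 → B) → B} {Φ Φ' : RingHom.ker ρ → (Fin 0 → B) → C}
    (hd : IsDifferenceAt c p r t ρ br J br' J' T Φ)
    (hd' : IsDifferenceAt c p r t ρ br' J' br'' J'' T' Φ') :
    IsDifferenceAt c p r t ρ br J br'' J'' (T + T') (Φ + Φ') := by
  refine ⟨fun a b => ?_, fun x hx f e g hg => ?_⟩
  · rw [Pi.add_apply, map_add, mul_add]
    linear_combination hd.bivector a b + hd'.bivector a b
  · obtain ⟨a, ha⟩ := hc.ideal x hx
    obtain ⟨b, hb⟩ := hc'.ideal _ ha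
    rw [Pi.add_apply, Pi.add_apply, hd.normal x hx f e a ha,
      hd'.normal _ ha f (by rw [map_sub, hT.r_t, sub_zero, e]) b hb, ← map_add]
    refine h''.flat.ρ_eq (x := x) ?_ hg
    rwa [map_add, mul_add, ← sub_sub]

theorem IsDifferenceAt.refl (h : IsPoissonModT c p r m t ρ br₀ br J) :
    IsDifferenceAt c p r t ρ br J br J 0 0 := by
  refine ⟨fun a b => by simp, fun x hx f e g hg => ?_⟩
  refine (h.flat.t_mul_mem _ ?_).symm
  have := J.sub_mem hx hg
  rwa [sub_sub_cancel] at this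

theorem IsCongruentAt.trans (hc : IsCongruentAt c p t br J br' J')
    (hc' : IsCongruentAt c p t br' J' br'' J'') : IsCongruentAt c p t br J br'' J'' := by
  refine ⟨fun u v => ?_, fun x hx => ?_⟩
  · obtain ⟨g, hg⟩ := hc.bracket u v
    obtain ⟨g', hg'⟩ := hc'.bracket u v
    exact ⟨g + g', by rw [map_add, mul_add, ← hg, ← hg']; ring⟩
  · obtain ⟨g, hg⟩ := hc.ideal x hx
    obtain ⟨g', hg'⟩ := hc'.ideal _ hg
    exact ⟨g + g', by rwa [map_add, mul_add, ← sub_sub]⟩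

end Obstruction

/-! ### Differentials of obstructions and differences -/

section Identities

variable {R A B C O : Type*} [CommRing R] [CommRing A] [CommRing B] [CommRing C] [CommRing O]
  {c : A →+* O} {p : B →+* O} {r : O →+* B} {m : Ideal A} {t : A} {ρ : B →+* C}
  {br₀ : B → B → B} {br br' : O → O → O} {J J' : Ideal O} {k₀ : R →+* B}

/-- The second component of the differential of the complex, on one open. -/
def normalDiff (ρ : B →+* C) (br₀ : B → B → B) (brX : C → C → C)
    (hmem : ∀ (a : B) (f : RingHom.ker ρ), br₀ a f ∈ RingHom.ker ρ) {q : ℕ}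
    (T : (Fin (q + 2) → B) → B) (Φ : RingHom.ker ρ → (Fin q → B) → C) (f : RingHom.ker ρ)
    (v : Fin (q + 1) → B) : C :=
  ρ (T (Fin.cons (f : B) v)) + ceDiff br₀ (fun a x => brX (ρ a) x) (Φ f) v -
    ∑ j : Fin (q + 1), (-1 : ℤ) ^ (j : ℕ) • Φ ⟨br₀ (v j) f, hmem (v j) f⟩ fun l => v (j.succAbove l)

theorem normalDiff_zero (brX : C → C → C)
    (hmem : ∀ (a : B) (f : RingHom.ker ρ), br₀ a f ∈ RingHom.ker ρ)
    (T : (Fin 2 → B) → B) (Φ : RingHom.ker ρ → (Fin 0 → B) → C) (f : RingHom.ker ρ) (a : B) :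
    normalDiff ρ br₀ brX hmem T Φ f ![a] =
      ρ (T ![(f : B), a]) + brX (ρ a) (Φ f ![]) - Φ ⟨br₀ a f, hmem a f⟩ ![] := by
  unfold normalDiff
  rw [ceDiff_zero, show (∑ j : Fin 1, (-1 : ℤ) ^ (j : ℕ) • Φ ⟨br₀ (![a] j) f, hmem (![a] j) f⟩
    fun l => ![a] (j.succAbove l)) = _ from Fin.sum_univ_one _,
    Subsingleton.elim (fun l : Fin 0 => ![a] ((0 : Fin 1).succAbove l)) ![]]
  simp

theorem normalDiff_one (brX : C → C → C)
    (hmem : ∀ (a : B) (f : RingHom.ker ρ), br₀ a f ∈ RingHom.ker ρ)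
    (T : (Fin 3 → B) → B) (Φ : RingHom.ker ρ → (Fin 1 → B) → C) (f : RingHom.ker ρ) (a b : B) :
    normalDiff ρ br₀ brX hmem T Φ f ![a, b] =
      ρ (T ![(f : B), a, b]) + (brX (ρ a) (Φ f ![b]) - Φ f ![br₀ a b] - brX (ρ b) (Φ f ![a])) -
        (Φ ⟨br₀ a f, hmem a f⟩ ![b] - Φ ⟨br₀ b f, hmem b f⟩ ![a]) := by
  unfold normalDiff
  have e0 : (fun l : Fin 1 => ![a, b] ((0 : Fin 2).succAbove l)) = ![b] := by
    ext l; fin_cases l; rfl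
  have e1 : (fun l : Fin 1 => ![a, b] ((1 : Fin 2).succAbove l)) = ![a] := by
    ext l; fin_cases l; rfl
  rw [ceDiff_one, show (∑ j : Fin 2, (-1 : ℤ) ^ (j : ℕ) • Φ ⟨br₀ (![a, b] j) f, hmem (![a, b] j) f⟩
    fun l => ![a, b] (j.succAbove l)) = _ from Fin.sum_univ_two _, e0, e1]
  simp [sub_eq_add_neg]

/-- The first component of the obstruction is closed: this is the Bianchi identity `[br, [br, br]] =
0`. -/
theorem IsObstructionAt.ceDiff_eq_zero (hT : IsThickening c p r m t)
    (h : IsPoissonModT c p r m t ρ br₀ br J) {T : (Fin 3 → B) → B}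
    {Φ : RingHom.ker ρ → (Fin 1 → B) → C} (ho : IsObstructionAt c p r t ρ br J T Φ)
    (v : Fin 4 → B) : ceDiff br₀ br₀ T v = 0 := by
  rw [show v = ![v 0, v 1, v 2, v 3] by ext j; fin_cases j <;> rfl, ceDiff_three]
  generalize v 0 = a; generalize v 1 = b; generalize v 2 = d; generalize v 3 = e
  have hb : ∀ a x y z, c t * p (br₀ a (T ![x, y, z])) =
      -br (p a) (jacobiSum br (p x) (p y) (p z)) := fun a x y z => by
    rw [← h.biderivation.neg_right, ho.jacobi, h.biderivation.const_mul_right, hT.t_mul,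
      hT.t_mul (br _ _), h.r_br, hT.r_p, hT.r_p, hT.r_p]
  have hr : ∀ a b, r (p (br₀ a b)) = r (br (p a) (p b)) := fun a b => by
    rw [hT.r_p, h.r_br, hT.r_p, hT.r_p]
  have j1 : ∀ a b x y, c t * p (T ![br₀ a b, x, y]) =
      -jacobiSum br (br (p a) (p b)) (p x) (p y) := fun a b x y => by
    rw [← ho.jacobi, h.jacobi_congr₃ hT (hr a b) rfl rfl]
  have j2 : ∀ a b x y, c t * p (T ![x, br₀ a b, y]) =
      -jacobiSum br (p x) (br (p a) (p b)) (p y) := fun a b x y => by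
    rw [← ho.jacobi, h.jacobi_congr₃ hT rfl (hr a b) rfl]
  have j3 : ∀ a b x y, c t * p (T ![x, y, br₀ a b]) =
      -jacobiSum br (p x) (p y) (br (p a) (p b)) := fun a b x y => by
    rw [← ho.jacobi, h.jacobi_congr₃ hT rfl rfl (hr a b)]
  refine hT.t_cancel ?_
  simp only [map_add, map_sub, mul_add, mul_sub, map_zero, mul_zero, hb, j1, j2, j3]
  linear_combination -h.biderivation.jacobi_bianchi (p a) (p b) (p d) (p e)

/-- The first components of the obstructions of two liftings differ by the differential of that of
their difference: `½ [br + t T, br + t T] = ½ [br, br] + t [br₀, T]`. -/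
theorem IsDifferenceAt.ceDiff_eq (h₀ : IsBiderivation k₀ br₀) (hT : IsThickening c p r m t)
    (h : IsPoissonModT c p r m t ρ br₀ br J) (h' : IsPoissonModT c p r m t ρ br₀ br' J')
    (hc : IsCongruentAt c p t br J br' J') {T T' : (Fin 3 → B) → B}
    {Φ Φ' : RingHom.ker ρ → (Fin 1 → B) → C} (ho : IsObstructionAt c p r t ρ br J T Φ)
    (ho' : IsObstructionAt c p r t ρ br' J' T' Φ')
    {D : (Fin 2 → B) → B} {Ψ : RingHom.ker ρ → (Fin 0 → B) → C}
    (hd : IsDifferenceAt c p r t ρ br J br' J' D Ψ) (hD : IsPolyderivation k₀ (RingHom.id B) D)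
    (v : Fin 3 → B) : T' v - T v + ceDiff br₀ br₀ D v = 0 := by
  rw [show v = ![v 0, v 1, v 2] by ext j; fin_cases j <;> rfl, ceDiff_two]
  generalize v 0 = a; generalize v 1 = b; generalize v 2 = d
  have key : ∀ x y z, br' (p x) (br' (p y) (p z)) = br (p x) (br (p y) (p z)) +
      c t * p (D ![x, br₀ y z] + br₀ x (D ![y, z])) := fun x y z => by
    rw [hd.bracket_eq hT h h' hc (hT.r_p y) (hT.r_p z), h'.biderivation.add_right,
      h'.biderivation.const_mul_right, hT.t_mul (br' _ _), h'.r_br, hT.r_p, hT.r_p,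
      hd.bracket_eq hT h h' hc (hT.r_p x) (show r (br (p y) (p z)) = br₀ y z by
        rw [h.r_br, hT.r_p, hT.r_p]), map_add]
    ring
  refine hT.t_cancel ?_
  have e := ho.jacobi a b d
  have e' := ho'.jacobi a b d
  simp only [jacobiSum, key] at e e'
  have s1 := hD.two_skew d (br₀ a b)
  have s2 : D ![b, br₀ d a] = -D ![b, br₀ a d] := by
    rw [h₀.skew a d, hD.isBiderivation.neg_right b]
  have s3 : br₀ b (D ![d, a]) = -br₀ b (D ![a, d]) := by
    rw [hD.two_skew a d, h₀.neg_right]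
  rw [s2, s3] at e'
  simp only [map_add, map_sub, mul_add, mul_sub, map_zero, mul_zero, s1, map_neg] at e' ⊢
  linear_combination e - e'

section Normal

variable {brX : C → C → C} (hmem : ∀ (a : B) (f : RingHom.ker ρ), br₀ a f ∈ RingHom.ker ρ)
  (hX : ∀ a b, brX (ρ a) (ρ b) = ρ (br₀ a b)) (h₀ : IsBiderivation k₀ br₀)
include hX h₀

/-- The second component of the differential of the obstruction vanishes: this is the Jacobi
identity for a function in `J` and two functions on the closed fibre, computed modulo `J`. -/
theorem IsObstructionAt.normalDiff_eq_zero (hT : IsThickening c p r m t)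
    (h : IsPoissonModT c p r m t ρ br₀ br J) {T : (Fin 3 → B) → B}
    {Φ : RingHom.ker ρ → (Fin 1 → B) → C} (ho : IsObstructionAt c p r t ρ br J T Φ)
    (f : RingHom.ker ρ) (v : Fin 2 → B) : normalDiff ρ br₀ brX hmem T Φ f v = 0 := by
  rw [show v = ![v 0, v 1] by ext j; fin_cases j <;> rfl, normalDiff_one]
  generalize v 0 = a; generalize v 1 = b
  obtain ⟨x, hx, e⟩ := h.flat.exists_lift f f.2
  obtain ⟨ga, hga⟩ := h.poisson x hx (p a)
  obtain ⟨gb, hgb⟩ := h.poisson x hx (p b)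
  obtain ⟨g, hg⟩ := h.poisson x hx (br (p a) (p b))
  -- `y` and `z` lift `{a, f}` and `{b, f}`
  obtain ⟨y, hy, ey⟩ : ∃ y ∈ J, br x (p a) = c t * p ga - y := ⟨_, J.neg_mem hga, by ring⟩
  obtain ⟨z, hz, ez⟩ : ∃ z ∈ J, br x (p b) = c t * p gb - z := ⟨_, J.neg_mem hgb, by ring⟩
  have lift : ∀ y g a, br x (p a) = c t * p g - y → br₀ a f = r y := fun y g a hy => by
    rw [eq_sub_iff_add_eq', ← eq_sub_iff_add_eq] at hy
    rw [hy, map_sub, hT.r_t, h.r_br, e, hT.r_p, h₀.skew, zero_sub]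
  obtain ⟨gab, hgab⟩ := h.poisson y hy (p b)
  obtain ⟨gba, hgba⟩ := h.poisson z hz (p a)
  have hX' : ∀ a b, brX (ρ a) (-ρ b) = ρ (-br₀ a b) := fun a b => by
    rw [← map_neg, hX, h₀.neg_right]
  rw [ho.ham x hx f e.symm a ga hga, ho.ham x hx f e.symm b gb hgb,
    ho.ham x hx f e.symm (br₀ a b) g
      (h.br_sub_mem hT hx (by rw [h.r_br, hT.r_p, hT.r_p, hT.r_p]) hg),
    ho.ham y hy ⟨br₀ a f, hmem a f⟩ (lift y ga a ey) b gab hgab,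
    ho.ham z hz ⟨br₀ b f, hmem b f⟩ (lift z gb b ez) a gba hgba, hX', hX']
  have hj : -jacobiSum br x (p a) (p b) = c t * p (T ![(f : B), a, b]) := by
    rw [← ho.jacobi, h.jacobi_congr₃ hT (u' := p f) (by rw [e, hT.r_p]) rfl rfl]
  have ht : ∀ a g, br (p a) (c t * p g) = c t * p (br₀ a g) := fun a g => by
    rw [h.biderivation.const_mul_right, hT.t_mul, h.r_br, hT.r_p, hT.r_p]
  have e1 : br (p b) (br x (p a)) = c t * p (br₀ b ga) + br y (p b) := by
    rw [ey, h.biderivation.sub_right, ht, h.biderivation.skew y]; ring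
  have e2 : br (p a) (br (p b) x) = -(c t * p (br₀ a gb) + br z (p a)) := by
    rw [h.biderivation.skew x, h.biderivation.neg_right, ez, h.biderivation.sub_right, ht,
      h.biderivation.skew z]; ring
  simp only [← map_neg, ← map_sub, ← map_add]
  refine h.flat.t_mul_mem _ ?_
  -- The three members of `J` combine to `t` times the function whose restriction is the
  -- differential.
  have := J.sub_mem (J.sub_mem hgba hg) hgab
  convert this using 1
  simp only [map_neg, map_sub, map_add]
  simp only [jacobiSum, e1, e2] at hj
  linear_combination -hj

/-- The second components of the obstructions of two liftings differ by that of the differential of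
their difference. -/
theorem IsDifferenceAt.normalDiff_eq (hT : IsThickening c p r m t)
    (h : IsPoissonModT c p r m t ρ br₀ br J) (h' : IsPoissonModT c p r m t ρ br₀ br' J')
    (hc : IsCongruentAt c p t br J br' J') {T T' : (Fin 3 → B) → B}
    {Φ Φ' : RingHom.ker ρ → (Fin 1 → B) → C} (ho : IsObstructionAt c p r t ρ br J T Φ)
    (ho' : IsObstructionAt c p r t ρ br' J' T' Φ')
    {D : (Fin 2 → B) → B} {Ψ : RingHom.ker ρ → (Fin 0 → B) → C}
    (hd : IsDifferenceAt c p r t ρ br J br' J' D Ψ) (f : RingHom.ker ρ) (v : Fin 1 → B) :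
    Φ' f v - Φ f v + normalDiff ρ br₀ brX hmem D Ψ f v = 0 := by
  rw [show v = ![v 0] by ext j; fin_cases j; rfl, normalDiff_zero]
  generalize v 0 = a
  obtain ⟨x, hx, e⟩ := h.flat.exists_lift f f.2
  obtain ⟨g, hg⟩ := h.poisson x hx (p a)
  obtain ⟨s, hs⟩ := hc.ideal x hx
  obtain ⟨y, hy, ey⟩ : ∃ y ∈ J, br x (p a) = c t * p g - y := ⟨_, J.neg_mem hg, by ring⟩
  obtain ⟨w, hw⟩ := hc.ideal y hy
  have ht : ∀ a g, br' (c t * p g) (p a) = c t * p (br₀ g a) := fun a g => by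
    rw [h'.biderivation.const_mul_left, hT.t_mul, h'.r_br, hT.r_p, hT.r_p]
  have hy' : br₀ a f = r y := by
    rw [eq_sub_iff_add_eq', ← eq_sub_iff_add_eq] at ey
    rw [ey, map_sub, hT.r_t, h.r_br, e, hT.r_p, h₀.skew, zero_sub]
  rw [ho.ham x hx f e.symm a g hg, hd.normal x hx f e.symm s hs,
    hd.normal y hy ⟨br₀ a f, hmem a f⟩ hy' w hw,
    ho'.ham _ hs f (by rw [map_sub, hT.r_t, sub_zero, e]) a
      -- In `{x - t s, a}'`, the bracket of `x` contributes `g`, the change of the bracket `D`, and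
      -- the passage from `J` to `J'` the functions `s` and `w`.
      (g + D ![(f : B), a] - br₀ s a - w), hX, h₀.skew s a]
  · simp only [map_sub, map_add, map_neg]; ring
  · rw [h'.biderivation.sub_left, ht, hd.bracket_eq hT h h' hc (a := f) (b := a) e (hT.r_p a), ey]
    convert J'.neg_mem hw using 1
    simp only [map_sub, map_add]; ring

end Normal

/-! ### Twisting a lifting -/

/-- The bracket `br + t T`. -/
def twistBracket (c : A →+* O) (p : B →+* O) (r : O →+* B) (t : A) (br : O → O → O)
    (T : (Fin 2 → B) → B) (u v : O) : O :=
  br u v + c t * p (T ![r u, r v])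

/-- The ideal of the functions `x - t g` with `x` in `J` and `g` restricting to `Φ(r x)`. -/
def twistIdeal (c : A →+* O) (p : B →+* O) (r : O →+* B) (t : A) (ρ : B →+* C)
    (hT : IsThickening c p r m t) (k₀ : R →+* B) (J : Ideal O)
    (Φ : RingHom.ker ρ → (Fin 0 → B) → C) (hΦ : IsNormalAt ρ k₀ Φ) : Ideal O where
  carrier := {y | ∃ x ∈ J, ∃ f : RingHom.ker ρ, (f : B) = r x ∧ ∃ g, Φ f ![] = ρ g ∧
    x - c t * p g = y}
  zero_mem' := by
    refine ⟨0, J.zero_mem, 0, by simp, 0, ?_, by simp⟩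
    rw [← zero_smul B (0 : RingHom.ker ρ), hΦ.map_smul, map_zero, zero_mul]
  add_mem' := by
    rintro _ _ ⟨x, hx, f, hf, g, hg, rfl⟩ ⟨x', hx', f', hf', g', hg', rfl⟩
    refine ⟨x + x', J.add_mem hx hx', f + f', by simp [hf, hf'], g + g', ?_, ?_⟩
    · rw [hΦ.map_add, hg, hg', map_add]
    · rw [map_add]; ring
  smul_mem' := by
    rintro a _ ⟨x, hx, f, hf, g, hg, rfl⟩
    refine ⟨a * x, J.mul_mem_left _ hx, r a • f, by simp [hf], r a * g, ?_, ?_⟩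
    · rw [hΦ.map_smul, hg, map_mul]
    · rw [map_mul, ← mul_assoc, ← hT.t_mul, smul_eq_mul]; ring

section Twist

variable (hT : IsThickening c p r m t) (h : IsPoissonModT c p r m t ρ br₀ br J)
  (hr : ∀ a, ∃ x, r (c a) = k₀ x) {T : (Fin 2 → B) → B} {Φ : RingHom.ker ρ → (Fin 0 → B) → C}
  (hD : IsPolyderivation k₀ (RingHom.id B) T) (hΦ : IsNormalAt ρ k₀ Φ)
  (hρ : Function.Surjective ρ)

include hT in
theorem r_twistBracket (u v : O) : r (twistBracket c p r t br T u v) = r (br u v) := by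
  rw [twistBracket, map_add, hT.r_t, add_zero]

theorem exists_mem_twistIdeal (hJ : IsFlatIdeal c p r m t ρ J) (hρ : Function.Surjective ρ)
    {x : O} (hx : x ∈ J) : ∃ g, x - c t * p g ∈ twistIdeal c p r t ρ hT k₀ J Φ hΦ := by
  obtain ⟨g, hg⟩ := hρ (Φ ⟨r x, hJ.ρ_r x hx⟩ ![])
  exact ⟨g, x, hx, ⟨r x, hJ.ρ_r x hx⟩, rfl, g, hg.symm, rfl⟩

/-- Twisting does not change the functions in `J` that vanish on the closed fibre; so it preserves
flatness. -/
theorem mem_twistIdeal_of_r_eq_zero (hJ : IsFlatIdeal c p r m t ρ J) {x : O}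
    (hr : r x = 0) : x ∈ twistIdeal c p r t ρ hT k₀ J Φ hΦ ↔ x ∈ J := by
  have h0 : Φ 0 ![] = 0 := by
    rw [← zero_smul B (0 : RingHom.ker ρ), hΦ.map_smul, map_zero, zero_mul]
  constructor
  · rintro ⟨x, hx, f, hf, g, hg, rfl⟩
    rw [map_sub, hT.r_t, sub_zero, ← hf] at hr
    have : f = 0 := Subtype.ext hr
    rw [this, h0] at hg
    exact J.sub_mem hx ((hJ.t_mul_mem_iff hT).2 hg.symm)
  · intro hx
    exact ⟨x, hx, 0, hr.symm, 0, by rw [h0, map_zero], by rw [map_zero, mul_zero, sub_zero]⟩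

include hρ in
theorem IsFlatIdeal.twist (hJ : IsFlatIdeal c p r m t ρ J) :
    IsFlatIdeal c p r m t ρ (twistIdeal c p r t ρ hT k₀ J Φ hΦ) where
  ρ_r := by
    rintro _ ⟨x, hx, f, hf, g, hg, rfl⟩
    rw [map_sub, hT.r_t, sub_zero, hJ.ρ_r x hx]
  exists_lift f hf := by
    obtain ⟨x, hx, rfl⟩ := hJ.exists_lift f hf
    obtain ⟨g, hg⟩ := exists_mem_twistIdeal hT hΦ hJ hρ hx
    exact ⟨_, hg, by rw [map_sub, hT.r_t, sub_zero]⟩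
  tor x hx hx0 := by
    rw [mem_twistIdeal_of_r_eq_zero hT hΦ hJ hx0] at hx
    have := hJ.tor x hx hx0
    refine Submodule.mul_induction_on this (fun a ha y hy => ?_) fun a b ha hb =>
      Ideal.add_mem _ ha hb
    obtain ⟨g, hg⟩ := exists_mem_twistIdeal hT hΦ hJ hρ hy
    have := Ideal.mul_mem_mul ha hg
    rwa [mul_sub, ← mul_assoc, mul_comm a (c t), hT.t_mul_of_mem_map ha, zero_mul, sub_zero] at this
  t_mul_mem g hg :=
    hJ.t_mul_mem g ((mem_twistIdeal_of_r_eq_zero hT hΦ hJ (hT.r_t _)).1 hg)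

theorem isCongruentAt_twist (hJ : IsFlatIdeal c p r m t ρ J) (hρ : Function.Surjective ρ) :
    IsCongruentAt c p t br J (twistBracket c p r t br T) (twistIdeal c p r t ρ hT k₀ J Φ hΦ) :=
  ⟨fun u v => ⟨-T ![r u, r v], by simp [twistBracket]⟩,
    fun _ hx => exists_mem_twistIdeal hT hΦ hJ hρ hx⟩

theorem isCongruentAt_twist_symm :
    IsCongruentAt c p t (twistBracket c p r t br T) (twistIdeal c p r t ρ hT k₀ J Φ hΦ) br J := by
  refine ⟨fun u v => ⟨T ![r u, r v], by simp [twistBracket]⟩, ?_⟩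
  rintro _ ⟨x, hx, f, hf, g, hg, rfl⟩
  exact ⟨-g, by rwa [map_neg, mul_neg, sub_neg_eq_add, sub_add_cancel]⟩

include hT hD hr in
theorem IsBiderivation.twist (hbr : IsBiderivation c br) :
    IsBiderivation c (twistBracket c p r t br T) where
  add_right u v w := by
    simp only [twistBracket, map_add, hbr.add_right, hD.two_add]; ring
  leibniz u v w := by
    have e : ∀ v b, c t * p (r v * b) = v * (c t * p b) := fun v b => by
      rw [mul_left_comm, hT.t_mul (v * p b), map_mul r, hT.r_p]
    simp only [twistBracket, map_mul r, hbr.leibniz, hD.two_mul, map_add, mul_add,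
      RingHom.id_apply, e]
    ring
  const_right u a := by
    obtain ⟨x, hx⟩ := hr a
    rw [twistBracket, hbr.const_right, hx, hD.two_const, map_zero, mul_zero, add_zero]
  self u := by
    rw [twistBracket, hbr.self, hD.two_self, map_zero, mul_zero, add_zero]
  skew u v := by
    rw [twistBracket, twistBracket, hbr.skew, hD.two_skew, map_neg, mul_neg, neg_add]

include h hr hD hρ in
theorem IsPoissonModT.twist :
    IsPoissonModT c p r m t ρ br₀ (twistBracket c p r t br T)
      (twistIdeal c p r t ρ hT k₀ J Φ hΦ) where
  biderivation := h.biderivation.twist hT hr hD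
  r_br u v := by rw [r_twistBracket hT, h.r_br]
  flat := h.flat.twist hT hΦ hρ
  jacobi u v w := by
    have key : ∀ u v w, ∃ g, twistBracket c p r t br T u (twistBracket c p r t br T v w) =
        br u (br v w) + c t * p g := fun u v w => by
      refine ⟨br₀ (r u) (T ![r v, r w]) + T ![r u, r (br v w)], ?_⟩
      rw [twistBracket, r_twistBracket hT, twistBracket, h.biderivation.add_right,
        h.biderivation.const_mul_right, hT.t_mul (br _ _), h.r_br, hT.r_p, map_add]
      ring
    obtain ⟨g, hg⟩ := h.jacobi u v w
    obtain ⟨g₁, h₁⟩ := key u v w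
    obtain ⟨g₂, h₂⟩ := key v w u
    obtain ⟨g₃, h₃⟩ := key w u v
    refine ⟨g + g₁ + g₂ + g₃, ?_⟩
    simp only [map_add, mul_add, ← hg]
    simp only [jacobiSum, h₁, h₂, h₃]
    ring
  poisson := by
    rintro _ ⟨x, hx, f, hf, g, hg, rfl⟩ u
    obtain ⟨g₁, h₁⟩ := h.poisson x hx u
    obtain ⟨g₂, h₂⟩ := exists_mem_twistIdeal hT hΦ h.flat hρ h₁
    refine ⟨g₁ + g₂ - br₀ g (r u) + T ![r x, r u], ?_⟩
    convert h₂ using 1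
    rw [twistBracket, h.biderivation.sub_left, h.biderivation.const_mul_left, hT.t_mul (br (p g) u),
      h.r_br, hT.r_p, map_sub r, hT.r_t, sub_zero]
    simp only [map_add, map_sub]
    ring

include h in
/-- Every pair of a bivector field and a normal field is the difference of a lifting and its twist.
-/
theorem isDifferenceAt_twist : IsDifferenceAt c p r t ρ br J (twistBracket c p r t br T)
    (twistIdeal c p r t ρ hT k₀ J Φ hΦ) T Φ := by
  refine ⟨fun a b => by simp [twistBracket, hT.r_p], fun x hx f hf g => ?_⟩
  rintro ⟨x', hx', f', hf', g', hg', e⟩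
  have hrx : r x = r x' := by
    have := congrArg r e
    rw [map_sub, map_sub, hT.r_t, hT.r_t, sub_zero, sub_zero] at this
    exact this.symm
  rw [show f = f' from Subtype.ext (by rw [hf, hf', hrx]), hg']
  refine h.flat.ρ_eq (x := c t * p g') (by rw [sub_self]; exact J.zero_mem) ?_
  rw [show c t * p g' - c t * p g = x' - x by linear_combination -e]
  exact J.sub_mem hx' hx

end Twist

theorem IsDifferenceAt.bracket_eq_of_zero (hT : IsThickening c p r m t)
    (h : IsPoissonModT c p r m t ρ br₀ br J) (h' : IsPoissonModT c p r m t ρ br₀ br' J')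
    (hc : IsCongruentAt c p t br J br' J') (hd : IsDifferenceAt c p r t ρ br J br' J' 0 0) :
    br = br' := by
  funext u v
  rw [hd.bracket_eq hT h h' hc rfl rfl, Pi.zero_apply, map_zero, mul_zero, add_zero]

theorem IsDifferenceAt.ideal_eq_of_zero (hT : IsThickening c p r m t)
    (h : IsPoissonModT c p r m t ρ br₀ br J) (h' : IsPoissonModT c p r m t ρ br₀ br' J')
    (hc : IsCongruentAt c p t br J br' J') (hc' : IsCongruentAt c p t br' J' br J)
    (hd : IsDifferenceAt c p r t ρ br J br' J' 0 0) : J = J' := by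
  have hle : J ≤ J' := fun x hx => by
    obtain ⟨g, hg⟩ := hc.ideal x hx
    have := hd.normal x hx ⟨r x, h.flat.ρ_r x hx⟩ rfl g hg
    have := J'.add_mem hg ((h'.flat.t_mul_mem_iff hT).2 this.symm)
    rwa [sub_add_cancel] at this
  refine le_antisymm hle fun x hx => ?_
  obtain ⟨y, hy, e⟩ := h.flat.exists_lift (r x) (h'.flat.ρ_r x hx)
  have := hc'.mem_of_r_eq_zero hT h' (J'.sub_mem hx (hle hy)) (by rw [map_sub, e, sub_self])
  simpa using J.add_mem this hy

end Identities

/-! ### Tensor products over a field and flat ideals -/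

section Flat

open TensorProduct

variable {k A B C O : Type*} [Field k] [CommRing A] [CommRing B] [CommRing C] [CommRing O]
  [Algebra k A] [Algebra k B] {c : A →+* O} {p : B →+* O} {r : O →+* B} {t : A}

/-- `O` is the tensor product of `A` and `B` over `k`, with respect to `c` and `p`. -/
def IsTensor (k : Type*) {A B O : Type*} [Field k] [CommRing A] [CommRing B] [CommRing O]
    [Algebra k A] [Algebra k B] (c : A →+* O) (p : B →+* O) : Prop :=
  ∃ e : A ⊗[k] B ≃+* O, ∀ a b, e (a ⊗ₜ b) = c a * p b

namespace IsTensor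

variable (hO : IsTensor k c p)
include hO

theorem induction {P : O → Prop} (h : ∀ a b, P (c a * p b)) (hadd : ∀ x y, P x → P y → P (x + y))
    (x : O) : P x := by
  obtain ⟨e, he⟩ := hO
  rw [← e.apply_symm_apply x]
  induction e.symm x with
  | zero => simpa using h 0 0
  | tmul a b => rw [he]; exact h a b
  | add x y hx hy => rw [map_add]; exact hadd _ _ hx hy

theorem const_eq (x : k) : c (algebraMap k A x) = p (algebraMap k B x) := by
  obtain ⟨e, he⟩ := hO
  have := he (algebraMap k A x) 1
  rw [map_one, mul_one] at this
  rw [← this, Algebra.algebraMap_eq_smul_one, TensorProduct.smul_tmul, he, map_one, one_mul,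
    Algebra.algebraMap_eq_smul_one]

/-- Linear maps out of the tensor product. -/
theorem exists_lift {M : Type*} [AddCommGroup M] (F : A →+ B →+ M)
    (hF : ∀ (x : k) a b, F (x • a) b = F a (x • b)) :
    ∃ L : O →+ M, ∀ a b, L (c a * p b) = F a b := by
  obtain ⟨e, he⟩ := hO
  refine ⟨(TensorProduct.liftAddHom F fun x a b => hF x a b).comp e.symm.toAddMonoidHom,
    fun a b => ?_⟩
  rw [← he]
  simp

/-- Multiplication by `t` is injective on functions on the closed fibre: apply a linear form on `A`
that does not vanish at `t`. -/
theorem t_inj (ht : t ≠ 0) (b : B) (hb : c t * p b = 0) : b = 0 := by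
  obtain ⟨f, hf⟩ : ∃ f : A →ₗ[k] k, f t ≠ 0 := by
    by_contra! H
    exact ht ((Module.forall_dual_apply_eq_zero_iff k t).1 H)
  obtain ⟨L, hL⟩ := hO.exists_lift (M := B)
    (AddMonoidHom.mk' (fun a => AddMonoidHom.mk' (fun b => f a • b) fun x y => smul_add _ x y)
      fun x y => by ext b; simp [add_smul])
    (fun x a b => by simp [smul_smul, mul_comm])
  have := hL t b
  rw [hb, map_zero] at this
  exact (smul_eq_zero.1 this.symm).resolve_left hf

/-- The kernel of the restriction to the closed fibre is generated by the maximal ideal of `A`. -/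
theorem mem_map_of_eq_zero (ε : A →ₐ[k] k) (hrp : ∀ b, r (p b) = b)
    (hrc : ∀ a, r (c a) = algebraMap k B (ε a)) {x : O} (hx : r x = 0) :
    x ∈ (RingHom.ker ε).map c := by
  have : ∀ x, x - p (r x) ∈ (RingHom.ker ε).map c := by
    refine hO.induction (fun a b => ?_) fun x y hx hy => ?_
    · have : c a * p b - p (r (c a * p b)) = c (a - algebraMap k A (ε a)) * p b := by
        rw [map_mul, hrp, hrc, map_mul, ← hO.const_eq, map_sub]; ring
      rw [this]
      exact Ideal.mul_mem_right _ _ (Ideal.mem_map_of_mem c (by simp [RingHom.mem_ker]))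
    · rw [map_add, map_add, add_sub_add_comm]
      exact Ideal.add_mem _ hx hy
  simpa [hx] using this x

theorem isThickening (ε : A →ₐ[k] k) (hrp : ∀ b, r (p b) = b)
    (hrc : ∀ a, r (c a) = algebraMap k B (ε a)) (ht : t ≠ 0)
    (htε : t ∈ RingHom.ker ε) (hmul : ∀ a ∈ RingHom.ker ε, a * t = 0) :
    IsThickening c p r (RingHom.ker ε) t where
  r_p := hrp
  t_mem := htε
  r_const a ha := by rw [hrc, show ε a = 0 from ha, map_zero]
  mem_map _ := hO.mem_map_of_eq_zero ε hrp hrc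
  mul_t := hmul
  t_inj := hO.t_inj ht

end IsTensor

/-- Nakayama's lemma for a nilpotent ideal. -/
theorem le_of_le_sup_smul_of_isNilpotent {A M : Type*} [CommRing A] [AddCommGroup M] [Module A M]
    {m : Ideal A} (hm : IsNilpotent m) {N P : Submodule A M} (h : P ≤ N ⊔ m • P) : P ≤ N := by
  obtain ⟨n, hn⟩ := hm
  have : ∀ j, P ≤ N ⊔ m ^ j • P := by
    intro j
    induction j with
    | zero => simp
    | succ j ih =>
      refine ih.trans (sup_le le_sup_left ?_)
      calc m ^ j • P ≤ m ^ j • (N ⊔ m • P) := Submodule.smul_mono le_rfl h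
        _ = m ^ j • N ⊔ m ^ (j + 1) • P := by
          rw [Submodule.smul_sup, pow_succ, Submodule.mul_smul]
        _ ≤ N ⊔ m ^ (j + 1) • P := sup_le_sup_right Submodule.smul_le_right _
  simpa [hn] using this n

/-- If `m = ker ε` is nilpotent, and `Tor₁(O / J, A / m)` vanishes in the sense that
`J ∩ m O = m J`, then `O / J` is isomorphic to `A ⊗ B / I`, where `I` is the restriction of `J` to
`B`. The isomorphism comes from an `A`-linear automorphism of `O = A ⊗ B` that is the identity
modulo `m` and carries `A ⊗ I` to `J`. -/
theorem IsTensor.exists_quotient_equiv (hO : IsTensor k c p) [Algebra A O] (hc : algebraMap A O = c)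
    (ε : A →ₐ[k] k) (hε : IsNilpotent (RingHom.ker ε))
    (hrp : ∀ b, r (p b) = b) (hrc : ∀ a, r (c a) = algebraMap k B (ε a))
    (hmap : ∀ x, r x = 0 → x ∈ (RingHom.ker ε).map c) (J : Ideal O)
    (htor : ∀ x ∈ J, r x = 0 → x ∈ (RingHom.ker ε).map c * J) (I : Submodule k B)
    (hI : ∀ f, f ∈ I ↔ ∃ x ∈ J, r x = f) :
    ∃ θ : O →ₗ[A] A ⊗[k] (B ⧸ I), Function.Surjective θ ∧
      LinearMap.ker θ = J.restrictScalars A ∧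
      ∀ a b, (∀ x, r x = 0 → c a * x = 0) → θ (c a * p b) = a ⊗ₜ I.mkQ b := by
  let : Algebra k O := ((algebraMap A O).comp (algebraMap k A)).toAlgebra
  have : IsScalarTower k A O := .of_algebraMap_eq fun _ => rfl
  have hk : ∀ (x : k) (u : O), x • u = c (algebraMap k A x) * u := fun x u => by
    rw [Algebra.smul_def, ← hc]; rfl
  -- `p` and `r` as linear maps
  let pL : B →ₗ[k] O :=
    { toFun := p, map_add' := p.map_add,
      map_smul' := fun x b => by
        rw [RingHom.id_apply, hk, hO.const_eq, Algebra.smul_def, map_mul] }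
  let rL : O →ₗ[k] B :=
    { toFun := r, map_add' := r.map_add,
      map_smul' := fun x u => by
        rw [RingHom.id_apply, hk, map_mul, hrc, AlgHom.commutes, Algebra.algebraMap_self,
          RingHom.id_apply, Algebra.smul_def] }
  -- a linear section `s` of `r` that maps `I` to `J`
  obtain ⟨s, hrs, hsI, hsp⟩ : ∃ s : B →ₗ[k] O, (∀ b, r (s b) = b) ∧ (∀ b ∈ I, s b ∈ J) ∧
      ∀ b, r (p b - s b) = 0 := by
    obtain ⟨π, hπ⟩ := I.subtype.exists_leftInverse_of_injective (Submodule.ker_subtype I)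
    let jr : J.restrictScalars k →ₗ[k] I :=
      (rL.comp (J.restrictScalars k).subtype).codRestrict I fun x => (hI _).2 ⟨x, x.2, rfl⟩
    obtain ⟨σ, hσ⟩ := jr.exists_rightInverse_of_surjective (LinearMap.range_eq_top.2 (by
      rintro ⟨f, hf⟩
      obtain ⟨x, hx, rfl⟩ := (hI f).1 hf
      exact ⟨⟨x, hx⟩, rfl⟩))
    have hσ' : ∀ y : I, r (σ y : O) = y := fun y => congrArg Subtype.val (LinearMap.congr_fun hσ y)
    have key : ∀ b, r (p b - p (π b : B) + (σ (π b) : O)) = b := fun b => by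
      rw [map_add, map_sub, hrp, hrp, hσ', sub_add_cancel]
    refine ⟨pL - pL.comp (I.subtype.comp π) + (J.restrictScalars k).subtype.comp (σ.comp π),
      key, fun b hb => ?_, fun b => ?_⟩
    · have : π b = ⟨b, hb⟩ := LinearMap.congr_fun hπ ⟨b, hb⟩
      have e : (pL - pL.comp (I.subtype.comp π) + (J.restrictScalars k).subtype.comp (σ.comp π)) b =
          p b - p (π b : B) + (σ (π b) : O) := rfl
      rw [e, this, sub_self, zero_add]
      exact (σ ⟨b, hb⟩).2
    · rw [map_sub, hrp, sub_eq_zero]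
      exact (key b).symm
  have hsmul : ∀ x, x ∈ (RingHom.ker ε).map c ↔ x ∈ RingHom.ker ε • (⊤ : Submodule A O) := by
    intro x
    rw [Ideal.smul_top_eq_map, hc]; rfl
  -- `ψ₀` is the `A`-linear extension of `s`; it differs from the canonical isomorphism by an
  -- endomorphism `ν` with values in `m O`, which is nilpotent.
  let ψ₀ : A ⊗[k] B →ₗ[A] O := s.liftBaseChange A
  have hψ₀ : ∀ a b, ψ₀ (a ⊗ₜ b) = c a * s b := fun a b => by
    rw [LinearMap.liftBaseChange_tmul, Algebra.smul_def, hc]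
  obtain ⟨e, he⟩ := id hO
  have heA : ∀ (a : A) x, e (a • x) = a • e x := fun a x => by
    induction x with
    | zero => simp
    | tmul a' b =>
      rw [TensorProduct.smul_tmul', he, he, smul_eq_mul, map_mul, Algebra.smul_def, hc, mul_assoc]
    | add x y hx hy => rw [smul_add, map_add, hx, hy, map_add, smul_add]
  let eA : (A ⊗[k] B) ≃ₗ[A] O := { e.toAddEquiv with map_smul' := heA }
  have heA' : ∀ x, eA x = e x := fun _ => rfl
  have hψ : Function.Bijective ψ₀ := by
    let ν : Module.End A O := 1 - ψ₀.comp eA.symm.toLinearMap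
    have hν : ∀ u, ν u ∈ RingHom.ker ε • (⊤ : Submodule A O) := by
      refine hO.induction (fun a b => ?_) fun x y hx hy => ?_
      · have : ν (c a * p b) = a • (p b - s b) := by
          have : eA.symm (c a * p b) = a ⊗ₜ b := by rw [LinearEquiv.symm_apply_eq, heA', he]
          simp only [ν, LinearMap.sub_apply, Module.End.one_apply, LinearMap.comp_apply,
            LinearEquiv.coe_coe, this, hψ₀]
          rw [Algebra.smul_def, hc, mul_sub]
        rw [this]
        exact Submodule.smul_mem _ _ ((hsmul _).1 (hmap _ (hsp b)))
      · rw [map_add]; exact Submodule.add_mem _ hx hy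
    have hn : ∀ n, ∀ u, (ν ^ n) u ∈ (RingHom.ker ε) ^ n • (⊤ : Submodule A O) := by
      intro n
      induction n with
      | zero => intro u; rw [pow_zero, pow_zero, Ideal.one_eq_top, Submodule.top_smul]; trivial
      | succ n ih =>
        intro u
        rw [pow_succ' ν, Module.End.mul_apply]
        have : ((RingHom.ker ε) ^ n • (⊤ : Submodule A O)).map ν ≤
            (RingHom.ker ε) ^ (n + 1) • ⊤ := by
          rw [Submodule.map_smul'', pow_succ, Submodule.mul_smul]
          refine Submodule.smul_mono le_rfl ?_
          rintro _ ⟨x, -, rfl⟩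
          exact hν x
        exact this (Submodule.mem_map_of_mem (ih u))
    have hunit : IsUnit (1 - ν) := by
      refine IsNilpotent.isUnit_one_sub ?_
      obtain ⟨n, h0⟩ := hε
      refine ⟨n, LinearMap.ext fun u => ?_⟩
      have := hn n u
      rw [h0] at this
      simpa using this
    have : (1 - ν : Module.End A O) = ψ₀.comp eA.symm.toLinearMap := sub_sub_cancel _ _
    rw [this, Module.End.isUnit_iff] at hunit
    have e2 : ⇑ψ₀ = (ψ₀.comp eA.symm.toLinearMap) ∘ eA := by ext x; simp
    rw [e2]
    exact hunit.comp eA.bijective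
  let ψ : (A ⊗[k] B) ≃ₗ[A] O := LinearEquiv.ofBijective ψ₀ hψ
  have hψ' : ∀ x, ψ x = ψ₀ x := fun _ => rfl
  -- `N` is the image of `A ⊗ I`; it agrees with `J` modulo `m J`, hence by Nakayama.
  let N : Submodule A O := (LinearMap.range (I.subtype.baseChange A)).map ψ₀
  have hNJ : N ≤ J.restrictScalars A := by
    rintro _ ⟨_, ⟨x, rfl⟩, rfl⟩
    induction x with
    | zero => simp
    | tmul a b =>
      rw [LinearMap.baseChange_tmul, hψ₀]
      exact J.mul_mem_left _ (hsI _ b.2)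
    | add x y hx hy => rw [map_add, map_add]; exact add_mem hx hy
  have hJN : J.restrictScalars A ≤ N := by
    refine le_of_le_sup_smul_of_isNilpotent hε fun x hx => ?_
    have hf : r x ∈ I := (hI _).2 ⟨x, hx, rfl⟩
    have h1 : s (r x) ∈ N := by
      refine ⟨1 ⊗ₜ r x, ⟨1 ⊗ₜ ⟨r x, hf⟩, ?_⟩, ?_⟩
      · rw [LinearMap.baseChange_tmul]; rfl
      · rw [hψ₀, map_one, one_mul]
    have h2 := htor (x - s (r x)) (J.sub_mem hx (hsI _ hf)) (by rw [map_sub, hrs, sub_self])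
    have h4 : x - s (r x) ∈ RingHom.ker ε • J.restrictScalars A := by
      refine Submodule.mul_induction_on h2 (fun a ha y hy => ?_) fun a b => add_mem
      refine Submodule.span_induction (p := fun a _ =>
        a * y ∈ RingHom.ker ε • J.restrictScalars A) ?_ ?_ ?_ ?_ ha
      · rintro _ ⟨a, ha, rfl⟩
        have : c a * y = a • y := by rw [Algebra.smul_def, hc]
        rw [this]
        exact Submodule.smul_mem_smul ha hy
      · rw [zero_mul]; exact zero_mem _
      · intro a b _ _ ha hb
        rw [add_mul]; exact add_mem ha hb
      · intro a b _ hb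
        rw [smul_eq_mul, mul_assoc]
        refine Submodule.smul_induction_on hb (fun z hz n hn => ?_) fun u v hu hv => ?_
        · rw [mul_smul_comm]
          exact Submodule.smul_mem_smul hz (J.mul_mem_left _ hn)
        · rw [mul_add]; exact add_mem hu hv
    rw [← add_sub_cancel (s (r x)) x]
    exact add_mem (Submodule.mem_sup_left h1) (Submodule.mem_sup_right h4)
  have hexact : LinearMap.ker (I.mkQ.baseChange A) = LinearMap.range (I.subtype.baseChange A) := by
    ext x
    have := lTensor_exact A (f := I.subtype) (g := I.mkQ)
      (by rw [LinearMap.exact_iff]; simp) I.mkQ_surjective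
    exact this x
  refine ⟨(I.mkQ.baseChange A).comp ψ.symm.toLinearMap, ?_, ?_, fun a b ha => ?_⟩
  · refine Function.Surjective.comp (g := I.mkQ.baseChange A) ?_ ψ.symm.surjective
    exact LinearMap.lTensor_surjective A I.mkQ_surjective
  · refine le_antisymm (fun x hx => hNJ ?_) fun x hx => ?_
    · rw [LinearMap.mem_ker, LinearMap.comp_apply, ← LinearMap.mem_ker, hexact] at hx
      exact ⟨_, hx, ψ.apply_symm_apply x⟩
    · obtain ⟨y, hy, rfl⟩ := hJN hx
      rw [LinearMap.mem_ker, LinearMap.comp_apply, ← LinearMap.mem_ker, hexact]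
      rw [← hψ' y]
      simpa using hy
  · have : ψ.symm (c a * p b) = a ⊗ₜ b := by
      rw [LinearEquiv.symm_apply_eq, hψ', hψ₀, ← sub_eq_zero, ← mul_sub]
      exact ha _ (hsp b)
    rw [LinearMap.comp_apply, LinearEquiv.coe_coe, this, LinearMap.baseChange_tmul]

end Flat

/-! ### Criteria of flatness, and liftings of regular sequences -/

section FlatCriteria

open TensorProduct

variable {k A B C O : Type*} [Field k] [CommRing A] [CommRing B] [CommRing C] [CommRing O]
  [Algebra k A] [Algebra k B] {c : A →+* O} {p : B →+* O} {r : O →+* B} {t : A} {ρ : B →+* C}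

/-- If `x = ∑ bᵢ yᵢ` with `bᵢ` in `m` vanishes in a flat quotient, then the relation is trivial
there, so the `yᵢ` can be changed to elements of the kernel. -/
theorem mem_map_mul_ker_of_flat {Q : Type*} [CommRing Q] [Algebra A Q] [Module.Flat A Q]
    {m : Ideal A} {q : O →+* Q} (hq : Function.Surjective q)
    (hqc : ∀ a, q (c a) = algebraMap A Q a) {x : O} (hx : q x = 0) (hm : x ∈ m.map c) :
    x ∈ m.map c * RingHom.ker q := by
  have hsm : ∀ (a : A) (u : O), a • q u = q (c a * u) :=
    fun a u => by rw [map_mul, hqc, Algebra.smul_def]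
  rw [Ideal.map, Ideal.span, Submodule.mem_span_set'] at hm
  obtain ⟨n, y, a, hya⟩ := hm
  choose b hb hb' using fun i => (a i).2
  have hxb : x = ∑ i, c (b i) * y i := by
    rw [← hya]
    exact Finset.sum_congr rfl fun i _ => by rw [hb', smul_eq_mul, mul_comm]
  have hrel : ∑ i, b i • q (y i) = 0 := by
    rw [← hx, hxb, map_sum]
    exact Finset.sum_congr rfl fun i _ => hsm _ _
  obtain ⟨κ, e, z, hz, he⟩ := Module.Flat.isTrivialRelation_of_sum_smul_eq_zero
      (R := A) (M := Q) (ι := Fin n) (f := b) (x := fun i => q (y i)) hrel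
  choose w hw using fun j => hq (z j)
  have hJ : ∀ i, y i - ∑ j, c (e i j) * w j ∈ RingHom.ker q := fun i => by
    rw [RingHom.mem_ker, map_sub, map_sum, sub_eq_zero]
    exact (hz i).trans (Finset.sum_congr rfl fun j _ => by rw [← hw, hsm])
  have h0 : ∑ i, c (b i) * ∑ j, c (e i j) * w j = 0 := by
    simp only [Finset.mul_sum]
    rw [Finset.sum_comm]
    refine Finset.sum_eq_zero fun j _ => ?_
    have h1 : ∑ i, c (b i * e i j) = 0 := by
      rw [← map_sum, ← map_zero c, ← he j]
    calc ∑ i, c (b i) * (c (e i j) * w j) = (∑ i, c (b i * e i j)) * w j := by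
          rw [Finset.sum_mul]
          exact Finset.sum_congr rfl fun i _ => by rw [map_mul]; ring
      _ = 0 := by rw [h1, zero_mul]
  have key : x = ∑ i, c (b i) * (y i - ∑ j, c (e i j) * w j) := by
    simp only [mul_sub, Finset.sum_sub_distrib, h0, sub_zero]
    exact hxb
  rw [key]
  exact Ideal.sum_mem _ fun i _ => Ideal.mul_mem_mul (Ideal.mem_map_of_mem c (hb i)) (hJ i)

/-- If `O / J` is flat over `A`, then `J ∩ m O = m J`, by the equational criterion. -/
theorem mem_map_mul_of_flat {m : Ideal A} {J : Ideal O}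
    (h : RingHom.Flat ((Ideal.Quotient.mk J).comp c)) {x : O} (hx : x ∈ J) (hm : x ∈ m.map c) :
    x ∈ m.map c * J := by
  have := @mem_map_mul_ker_of_flat A O _ _ c (O ⧸ J) _ ((Ideal.Quotient.mk J).comp c).toAlgebra h
    m _ Ideal.Quotient.mk_surjective (fun _ => rfl) x (Ideal.Quotient.eq_zero_iff_mem.2 hx) hm
  rwa [Ideal.mk_ker] at this

/-- The kernel of a homomorphism of `k`-algebras, as a subspace. -/
def kerSubmodule (k : Type*) {B C : Type*} [Field k] [CommRing B] [CommRing C] [Algebra k B]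
    (ρ : B →+* C) : Submodule k B :=
  (RingHom.ker ρ).restrictScalars k

/-- An ideal that reduces to the ideal of `X` and satisfies `J ∩ m O = m J` is flat. -/
theorem IsTensor.flat_quotient (hO : IsTensor k c p) (ε : A →ₐ[k] k)
    (hε : IsNilpotent (RingHom.ker ε))
    (hrp : ∀ b, r (p b) = b) (hrc : ∀ a, r (c a) = algebraMap k B (ε a))
    (hmap : ∀ x, r x = 0 → x ∈ (RingHom.ker ε).map c) {J : Ideal O}
    (h1 : ∀ x ∈ J, ρ (r x) = 0) (h2 : ∀ f, ρ f = 0 → ∃ x ∈ J, r x = f)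
    (htor : ∀ x ∈ J, r x = 0 → x ∈ (RingHom.ker ε).map c * J) :
    RingHom.Flat ((Ideal.Quotient.mk J).comp c) := by
  let := c.toAlgebra
  obtain ⟨θ, hθ, hker, -⟩ := hO.exists_quotient_equiv rfl ε hε hrp hrc hmap J htor
    (kerSubmodule k ρ) (fun f => ⟨h2 f, by rintro ⟨x, hx, rfl⟩; exact h1 x hx⟩)
  have : Module.Flat A (O ⧸ LinearMap.ker θ) :=
    Module.Flat.of_linearEquiv (LinearMap.quotKerEquivOfSurjective θ hθ)
  rw [hker] at this
  have e := Submodule.Quotient.restrictScalarsEquiv A J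
  exact Module.Flat.of_linearEquiv e.symm

/-- An ideal that reduces to the ideal of `X` and satisfies `J ∩ m O = m J` meets `t O` in `t J`:
flatness turns `J ∩ t O` into the kernel of `B → B / I` tensored with the line `t A`. -/
theorem IsTensor.isFlatIdeal (hO : IsTensor k c p) (ε : A →ₐ[k] k)
    (hε : IsNilpotent (RingHom.ker ε)) (hrc : ∀ a, r (c a) = algebraMap k B (ε a))
    (hT : IsThickening c p r (RingHom.ker ε) t) (ht : t ≠ 0) {J : Ideal O}
    (h1 : ∀ x ∈ J, ρ (r x) = 0) (h2 : ∀ f, ρ f = 0 → ∃ x ∈ J, r x = f)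
    (htor : ∀ x ∈ J, r x = 0 → x ∈ (RingHom.ker ε).map c * J) :
    IsFlatIdeal c p r (RingHom.ker ε) t ρ J where
  ρ_r := h1
  exists_lift := h2
  tor := htor
  t_mul_mem g hg := by
    let := c.toAlgebra
    obtain ⟨θ, -, hker, hθ⟩ := hO.exists_quotient_equiv rfl ε hε hT.r_p hrc hT.mem_map J htor
      (kerSubmodule k ρ) (fun f => ⟨h2 f, by rintro ⟨x, hx, rfl⟩; exact h1 x hx⟩)
    have h0 : θ (c t * p g) = 0 := by
      rw [← LinearMap.mem_ker, hker]; exact hg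
    rw [hθ t g fun x hx => hT.t_mul_of_mem_map (hT.mem_map x hx)] at h0
    have : (kerSubmodule k ρ).mkQ g = 0 := by
      obtain ⟨f, hf⟩ : ∃ f : A →ₗ[k] k, f t ≠ 0 := by
        by_contra! H
        exact ht ((Module.forall_dual_apply_eq_zero_iff k t).1 H)
      have := congrArg ((TensorProduct.lid k _) ∘ (f.rTensor (B ⧸ kerSubmodule k ρ))) h0
      simp only [Function.comp_apply, LinearMap.rTensor_tmul, TensorProduct.lid_tmul,
        map_zero] at this
      exact (smul_eq_zero.1 this).resolve_left hf
    rw [Submodule.mkQ_apply, Submodule.Quotient.mk_eq_zero] at this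
    exact this

/-- Liftings of a regular sequence generate an ideal `J` with `J ∩ ker r = (ker r) J`: relations
between the members of a regular sequence lift. -/
theorem mem_ker_mul_span_of_regular (hr : Function.Surjective r) {n : ℕ} (F : Fin n → O)
    (hF : RingTheory.Sequence.IsWeaklyRegular B (List.ofFn fun α => r (F α))) {x : O}
    (hx : x ∈ Ideal.span (Set.range F)) (hx0 : r x = 0) :
    x ∈ RingHom.ker r * Ideal.span (Set.range F) := by
  -- regularity, with the initial segments of the sequence as subsets of `Fin n`
  have hreg : ∀ (l : Fin n) (b : B), r (F l) * b ∈ Ideal.span ((fun α => r (F α)) '' {j | j < l}) →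
      b ∈ Ideal.span ((fun α => r (F α)) '' {j | j < l}) := by
    intro l b hb
    rw [RingTheory.Sequence.isWeaklyRegular_iff] at hF
    have := hF l (by simp)
    have e : Ideal.ofList (List.take l (List.ofFn fun α => r (F α))) =
        Ideal.span ((fun α => r (F α)) '' {j | j < l}) := by
      rw [Ideal.ofList]
      congr 1
      ext z
      simp only [Set.mem_ofPred_eq, List.mem_take_iff_getElem, Set.mem_image, List.getElem_ofFn,
        List.length_ofFn]
      constructor
      · rintro ⟨j, hj, rfl⟩
        exact ⟨⟨j, by omega⟩, by simp only [Fin.lt_def]; omega, rfl⟩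
      · rintro ⟨j, hj, rfl⟩
        exact ⟨j, by rw [Fin.lt_def] at hj; omega, rfl⟩
    rw [e, isSMulRegular_quotient_iff_mem_of_smul_mem] at this
    have h2 := this b (by simpa using hb)
    simpa using h2
  have main : ∀ l ≤ n, ∀ x ∈ Ideal.span (F '' {j | (j : ℕ) < l}), r x = 0 →
      x ∈ RingHom.ker r * Ideal.span (F '' {j | (j : ℕ) < l}) := by
    intro l
    induction l with
    | zero =>
      intro _ x hx _
      simp only [not_lt_zero, Set.ofPred_false, Set.image_empty, Ideal.span_empty,
        Ideal.mem_bot] at hx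
      rw [hx]; exact zero_mem _
    | succ l ih =>
      intro hl x hx hx0
      let L : Fin n := ⟨l, hl⟩
      have hset : F '' {j | (j : ℕ) < l + 1} = insert (F L) (F '' {j | (j : ℕ) < l}) := by
        rw [← Set.image_insert_eq]
        congr 1
        ext j
        simp only [Set.mem_ofPred_eq, Set.mem_insert_iff, Fin.ext_iff, L]
        omega
      have hLe : Ideal.span (F '' {j | (j : ℕ) < l}) ≤ Ideal.span (F '' {j | (j : ℕ) < l + 1}) :=
        Ideal.span_mono (Set.image_mono fun j (hj : (j : ℕ) < l) => Nat.lt_succ_of_lt hj)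
      have hFL : F L ∈ Ideal.span (F '' {j | (j : ℕ) < l + 1}) :=
        Ideal.subset_span ⟨L, Nat.lt_succ_self l, rfl⟩
      have hx' := hx
      rw [hset, Ideal.mem_span_insert] at hx'
      obtain ⟨z, y, hy, rfl⟩ := hx'
      have him : Ideal.map r (Ideal.span (F '' {j | (j : ℕ) < l})) =
          Ideal.span ((fun α => r (F α)) '' {j | j < L}) := by
        rw [Ideal.map_span, ← Set.image_comp]; rfl
      have hry : r y ∈ Ideal.span ((fun α => r (F α)) '' {j | j < L}) := by
        rw [← him]; exact Ideal.mem_map_of_mem r hy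
      have hrz := hreg L (r z) (by
        rw [map_add, map_mul] at hx0
        rw [mul_comm, eq_neg_of_add_eq_zero_left hx0]
        exact neg_mem hry)
      rw [← him, Ideal.mem_map_iff_of_surjective r hr] at hrz
      -- By regularity the last coefficient `z` is congruent modulo `ker r` to a combination `z'` of
      -- the earlier members; `z' F` is moved to the other terms.
      obtain ⟨z', hz', hzz'⟩ := hrz
      have h1 : z' * F L + y ∈ Ideal.span (F '' {j | (j : ℕ) < l}) :=
        Ideal.add_mem _ (Ideal.mul_mem_right _ _ hz') hy
      have h2 := ih (by omega) _ h1 (by rw [map_add, map_mul, hzz', ← map_mul, ← map_add, hx0])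
      have h3 : (z - z') * F L ∈ RingHom.ker r * Ideal.span (F '' {j | (j : ℕ) < l + 1}) :=
        Ideal.mul_mem_mul (by rw [RingHom.mem_ker, map_sub, hzz', sub_self]) hFL
      have : z * F L + y = (z' * F L + y) + (z - z') * F L := by ring
      rw [this]
      exact Ideal.add_mem _ (Ideal.mul_mono_right hLe h2) h3
  have e : (F '' {j | (j : ℕ) < n}) = Set.range F := by
    rw [← Set.image_univ]; congr 1; ext j; simp
  have := main n le_rfl x
  rw [e] at this
  exact this hx hx0

/-- If `J` satisfies `J ∩ m O = m J` for a nilpotent `m`, then liftings to `J` of generators of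
the reduction of `J` generate `J`. -/
theorem span_eq_of_tor {m : Ideal A} (hm : IsNilpotent m)
    {J K : Ideal O} (hK : K ≤ J) (hgen : ∀ x ∈ J, ∃ y ∈ K, r y = r x)
    (htor : ∀ x ∈ J, r x = 0 → x ∈ m.map c * J) : K = J := by
  refine le_antisymm hK ?_
  have hn : IsNilpotent (m.map c) := by
    obtain ⟨n, hn⟩ := hm
    exact ⟨n, by rw [← Ideal.map_pow, hn, Ideal.zero_eq_bot, Ideal.map_bot]; rfl⟩
  refine le_of_le_sup_smul_of_isNilpotent hn fun x hx => ?_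
  obtain ⟨y, hy, hyx⟩ := hgen x hx
  rw [← add_sub_cancel y x]
  refine add_mem (Submodule.mem_sup_left hy) (Submodule.mem_sup_right ?_)
  exact htor _ (J.sub_mem hx (hK hy)) (by rw [map_sub, hyx, sub_self])

end FlatCriteria

/-! ### Biderivations of a tensor product -/

section Extension

variable {k A A' B O O' : Type*} [Field k] [CommRing A] [CommRing A'] [CommRing B] [CommRing O]
  [CommRing O'] [Algebra k A] [Algebra k B] {c : A →+* O} {p : B →+* O}
  {c' : A' →+* O'} {p' : B →+* O'} {t : A'}

/-- A linear section of `A' → A` extends to a section of `A' ⊗ B → A ⊗ B`. -/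
theorem IsTensor.exists_section [Algebra k A'] (hO : IsTensor k c p)
    (hO' : IsTensor k c' p') (σ : A →ₗ[k] A') :
    ∃ s : O →+ O', ∀ a b, s (c a * p b) = c' (σ a) * p' b :=
  hO.exists_lift
    (AddMonoidHom.mk' (fun a => AddMonoidHom.mk' (fun b => c' (σ a) * p' b)
      fun x y => by rw [map_add, mul_add]) fun x y => by ext b; simp [add_mul])
    (fun x a b => by
      simp only [AddMonoidHom.mk'_apply]
      rw [map_smul, Algebra.smul_def, Algebra.smul_def, map_mul, map_mul, hO'.const_eq]; ring)

theorem IsTensor.section_mul (hO : IsTensor k c p) {σ : A → A'} {s : O →+ O'}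
    (hs : ∀ a b, s (c a * p b) = c' (σ a) * p' b) (b : B) (x : O) :
    s (p b * x) = p' b * s x := by
  revert x
  refine hO.induction (fun a b' => ?_) fun x y hx hy => ?_
  · rw [mul_left_comm, ← map_mul, hs, hs, map_mul]; ring
  · rw [mul_add, map_add, hx, hy, map_add, mul_add]

theorem IsTensor.map_section (hO : IsTensor k c p) {mp : O' →+* O} {φ : A' → A}
    (hmc : ∀ a, mp (c' a) = c (φ a)) (hmp : ∀ b, mp (p' b) = p b) {σ : A → A'}
    (hσ : ∀ a, φ (σ a) = a) {s : O →+ O'} (hs : ∀ a b, s (c a * p b) = c' (σ a) * p' b) (x : O) :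
    mp (s x) = x := by
  revert x
  refine hO.induction (fun a b => ?_) fun x y hx hy => ?_
  · rw [hs, map_mul, hmc, hmp, hσ]
  · rw [map_add, map_add, hx, hy]

/-- The kernel of `A' ⊗ B → A ⊗ B`. -/
theorem IsTensor.exists_eq_mul_of_map_eq_zero [Algebra k A'] (hO : IsTensor k c p)
    (hO' : IsTensor k c' p')
    {mp : O' →+* O} {φ : A' →ₐ[k] A} (hφ : Function.Surjective φ)
    (hker : RingHom.ker φ = Ideal.span {t})
    (hmc : ∀ a, mp (c' a) = c (φ a)) (hmp : ∀ b, mp (p' b) = p b) {x : O'} (hx : mp x = 0) :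
    ∃ y, x = c' t * y := by
  obtain ⟨σ, hσ⟩ := φ.toLinearMap.exists_rightInverse_of_surjective (LinearMap.range_eq_top.2 hφ)
  have hσ' : ∀ a, φ (σ a) = a := fun a => LinearMap.congr_fun hσ a
  obtain ⟨s, hs⟩ := hO.exists_section hO' σ
  have : ∀ x, ∃ y, x - s (mp x) = c' t * y := by
    refine hO'.induction (fun a b => ?_) fun x y => ?_
    · have : a - σ (φ a) ∈ RingHom.ker φ := by rw [RingHom.mem_ker, map_sub, hσ', sub_self]
      rw [hker, Ideal.mem_span_singleton'] at this
      obtain ⟨a', ha'⟩ := this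
      refine ⟨c' a' * p' b, ?_⟩
      rw [map_mul, hmc, hmp, hs, ← sub_mul, ← map_sub, ← ha', map_mul]; ring
    · rintro ⟨x', hx'⟩ ⟨y', hy'⟩
      refine ⟨x' + y', ?_⟩
      rw [map_add, map_add, add_sub_add_comm, hx', hy', mul_add]
  simpa [hx] using this x

/-- An alternating biderivation over `k` from `B` to `A ⊗ B` extends to an alternating
`A`-bilinear biderivation of `A ⊗ B`. -/
theorem IsTensor.exists_isBiderivation (hO : IsTensor k c p) {D : B → B → O}
    (hadd : ∀ a b b', D a (b + b') = D a b + D a b')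
    (hmul : ∀ a b b', D a (b * b') = p b * D a b' + p b' * D a b)
    (hconst : ∀ a x, D a (algebraMap k B x) = 0)
    (hself : ∀ a, D a a = 0) (hskew : ∀ a b, D b a = -D a b) :
    ∃ br : O → O → O, IsBiderivation c br ∧ ∀ a b, br (p a) (p b) = D a b := by
  have hsm : ∀ a (x : k) b, D a (x • b) = p (algebraMap k B x) * D a b := fun a x b => by
    rw [Algebra.smul_def, hmul, hconst, mul_zero, add_zero]
  have hadd' : ∀ a a' b, D (a + a') b = D a b + D a' b := fun a a' b => by
    rw [hskew, hadd, hskew a, hskew a']; ring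
  have h1 : ∀ b, ∃ L : O →+ O, ∀ a b', L (c a * p b') = c a * D b b' := fun b =>
    hO.exists_lift
      (AddMonoidHom.mk' (fun a => AddMonoidHom.mk' (fun b' => c a * D b b')
        fun x y => by rw [hadd, mul_add]) fun x y => by ext b; simp [add_mul])
      (fun x a b => by
        simp only [AddMonoidHom.mk'_apply, hsm]
        rw [Algebra.smul_def, map_mul, hO.const_eq]; ring)
  -- `L b` is the extension of `D b` that is linear over `A`; it is then extended in the first
  -- argument.
  choose L hL using h1
  have hLadd : ∀ b b', L (b + b') = L b + L b' := fun b b' => by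
    ext x
    revert x
    refine hO.induction (fun a b => ?_) fun x y hx hy => ?_
    · rw [AddMonoidHom.add_apply, hL, hL, hL, hadd', mul_add]
    · rw [map_add, map_add, hx, hy]
  have hLsm : ∀ (x : k) b y, L (x • b) y = p (algebraMap k B x) * L b y := fun x b => by
    refine hO.induction (fun a b => ?_) fun x y hx hy => ?_
    · rw [hL, hL, hskew, hsm, hskew b]; ring
    · rw [map_add, map_add, hx, hy, mul_add]
  obtain ⟨M, hM⟩ := hO.exists_lift (M := O →+ O)
    (AddMonoidHom.mk' (fun a => AddMonoidHom.mk' (fun b => (AddMonoidHom.mulLeft (c a)).comp (L b))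
        fun x y => by rw [hLadd]; ext; simp [mul_add])
        fun x y => by ext b z; simp [add_mul])
    (fun x a b => by
      ext y
      simp only [AddMonoidHom.mk'_apply, AddMonoidHom.comp_apply, AddMonoidHom.coe_mulLeft, hLsm]
      rw [Algebra.smul_def, map_mul, hO.const_eq]; ring)
  have hM' : ∀ a b a' b', M (c a * p b) (c a' * p b') = c a * c a' * D b b' := fun a b a' b' => by
    rw [hM]
    simp only [AddMonoidHom.mk'_apply, AddMonoidHom.comp_apply, AddMonoidHom.coe_mulLeft, hL]
    ring
  have hMc : ∀ x a, M x (c a) = 0 := fun x a => by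
    revert x
    refine hO.induction (fun a' b => ?_) fun x y hx hy => ?_
    · have := hM' a' b a 1
      have h1 : D b 1 = 0 := by simpa using hconst b 1
      rwa [map_one, mul_one, h1, mul_zero] at this
    · rw [map_add, AddMonoidHom.add_apply, hx, hy, add_zero]
  have hMs : ∀ x y, M y x = -M x y := fun x => by
    revert x
    refine hO.induction (fun a b => ?_) fun x x' hx hx' => ?_
    · refine hO.induction (fun a' b' => ?_) fun y y' hy hy' => ?_
      · rw [hM', hM', hskew b b']; ring
      · rw [map_add, AddMonoidHom.add_apply, hy, hy', map_add, neg_add]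
    · intro y
      rw [map_add, hx, hx', map_add, AddMonoidHom.add_apply, neg_add]
  refine ⟨fun x y => M x y, ⟨fun u v w => map_add _ _ _, fun u v w => ?_, hMc, fun u => ?_,
    fun u v => hMs u v⟩, fun a b => ?_⟩
  · revert u
    refine hO.induction (fun a b => ?_) fun x x' hx hx' => ?_
    · revert v
      refine hO.induction (fun a' b' => ?_) fun y y' hy hy' => ?_
      · revert w
        refine hO.induction (fun a'' b'' => ?_) fun z z' hz hz' => ?_
        · rw [hM', hM', show c a' * p b' * (c a'' * p b'') = c (a' * a'') * p (b' * b'') by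
            rw [map_mul, map_mul]; ring, hM', hmul, map_mul]
          ring
        · rw [mul_add, map_add, hz, hz', map_add]; ring
      · rw [add_mul, map_add, hy, hy', map_add]; ring
    · simp only [map_add, AddMonoidHom.add_apply] at hx hx' ⊢
      rw [hx, hx']; ring
  · revert u
    refine hO.induction (fun a b => ?_) fun x x' hx hx' => ?_
    · simp only [hM', hself, mul_zero]
    · have hx : M x x = 0 := hx
      have hx' : M x' x' = 0 := hx'
      simp only [map_add, AddMonoidHom.add_apply, hx, hx', hMs x' x]
      ring
  · have := hM' 1 a 1 b
    simpa using this

/-- A biderivation over `A` of `A ⊗ B` is determined by its values on `B`. -/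
theorem IsTensor.biderivation_ext (hO : IsTensor k c p) {f : O → O'}
    {g : A → A'} (hadd : ∀ x y, f (x + y) = f x + f y)
    (hf : ∀ a x, f (c a * x) = c' (g a) * f x)
    {br : O → O → O} {br' : O' → O' → O'} (h : IsBiderivation c br) (h' : IsBiderivation c' br')
    (H : ∀ a b, f (br (p a) (p b)) = br' (f (p a)) (f (p b))) (u v : O) :
    f (br u v) = br' (f u) (f v) := by
  revert u v
  refine hO.induction (fun a b => ?_) fun x x' hx hx' => ?_
  · refine hO.induction (fun a' b' => ?_) fun y y' hy hy' => ?_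
    · rw [h.const_mul_left, h.const_mul_right, hf, hf, hf, hf, h'.const_mul_left,
        h'.const_mul_right, H]
    · rw [h.add_right, hadd, hy, hy', hadd, h'.add_right]
  · intro y
    rw [h.add_left, hadd, hx, hx', hadd, h'.add_left]

end Extension

/-! ### Sections and their restrictions -/

section Gluing

@[simp]
theorem res_res {T : Scheme.{u}} {U V W : T.Opens} (h : V ≤ U) (h' : W ≤ V) (x : Γ(T, U)) :
    res h' (res h x) = res (h'.trans h) x := by
  change ((T.presheaf.map _) ≫ (T.presheaf.map _)).hom x = _
  rw [← T.presheaf.map_comp]; rfl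

/-- Sections over the members of a directed family of opens, compatible with restriction, glue. -/
theorem existsUnique_glue {T : Scheme.{u}} {ι : Type u} [Preorder ι] (P : ι → T.Opens)
    (hP : Monotone P) (V : T.Opens) (hcov : ∀ x ∈ V, ∃ w, P w ≤ V ∧ x ∈ P w)
    (hdir : ∀ w₁ w₂ x, x ∈ P w₁ → x ∈ P w₂ → ∃ w₃, w₃ ≤ w₁ ∧ w₃ ≤ w₂ ∧ x ∈ P w₃)
    (g : ∀ w, P w ≤ V → Γ(T, P w))
    (hg : ∀ w' w (h : w' ≤ w) (hw : P w ≤ V), res (hP h) (g w hw) = g w' ((hP h).trans hw)) :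
    ∃! x : Γ(T, V), ∀ w (hw : P w ≤ V), res hw x = g w hw := by
  have key := T.sheaf.existsUnique_gluing' (fun w : {w // P w ≤ V} => P w.1) V
    (fun w => homOfLE w.2) (fun x hx => by
      obtain ⟨w, hw, hxw⟩ := hcov x hx
      exact TopologicalSpace.Opens.mem_iSup.2 ⟨⟨w, hw⟩, hxw⟩) (fun w => g w.1 w.2) (by
      intro w₁ w₂
      refine T.sheaf.eq_of_locally_eq'
        (fun w : {w // w ≤ w₁.1 ∧ w ≤ w₂.1} => P w.1) _
        (fun w => homOfLE (le_inf (hP w.2.1) (hP w.2.2))) ?_ _ _ ?_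
      · rintro x ⟨h₁, h₂⟩
        obtain ⟨w, a, b, hx⟩ := hdir w₁.1 w₂.1 x h₁ h₂
        exact TopologicalSpace.Opens.mem_iSup.2 ⟨⟨w, a, b⟩, hx⟩
      · intro w
        have e₁ := (res_res (V := P w₁.1 ⊓ P w₂.1) inf_le_left
          (le_inf (hP w.2.1) (hP w.2.2)) (g w₁.1 w₁.2)).trans (hg w.1 w₁.1 w.2.1 w₁.2)
        have e₂ := (res_res (V := P w₁.1 ⊓ P w₂.1) inf_le_right
          (le_inf (hP w.2.1) (hP w.2.2)) (g w₂.1 w₂.2)).trans (hg w.1 w₂.1 w.2.2 w₂.2)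
        exact e₁.trans e₂.symm)
  obtain ⟨x, hx, hu⟩ := key
  exact ⟨x, fun w hw => hx ⟨w, hw⟩, fun y hy => hu y fun w => hy w.1 w.2⟩

theorem eq_of_res_eq {T : Scheme.{u}} {ι : Type*} (P : ι → T.Opens) {V : T.Opens}
    (hcov : ∀ x ∈ V, ∃ w, P w ≤ V ∧ x ∈ P w) {x y : Γ(T, V)}
    (h : ∀ w (hw : P w ≤ V), res hw x = res hw y) : x = y :=
  T.sheaf.eq_of_locally_eq' (fun w : {w // P w ≤ V} => P w.1) V
    (fun w => homOfLE w.2) (fun x hx => by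
      obtain ⟨w, hw, hxw⟩ := hcov x hx
      exact TopologicalSpace.Opens.mem_iSup.2 ⟨⟨w, hw⟩, hxw⟩) _ _ fun w => h w.1 w.2

theorem exists_affine_le {T : Scheme.{u}} {V : T.Opens} {x : T} (hx : x ∈ V) :
    ∃ W : T.Opens, IsAffineOpen W ∧ W ≤ V ∧ x ∈ W := by
  obtain ⟨W, hW, hxW, hWV⟩ := TopologicalSpace.Opens.isBasis_iff_nbhd.1 T.isBasis_affineOpens hx
  exact ⟨W, hW, hWV, hxW⟩

@[simp]
theorem res_self {T : Scheme.{u}} {U : T.Opens} (h : U ≤ U) (x : Γ(T, U)) : res h x = x := by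
  change (T.presheaf.map (𝟙 _)).hom x = x
  rw [T.presheaf.map_id]; rfl

theorem app_res {Z' Z : Scheme.{u}} (f : Z' ⟶ Z) {V W : Z.Opens} (h : W ≤ V) (x : Γ(Z, V)) :
    (f.app W).hom (res h x) = res (f.preimage_mono h) ((f.app V).hom x) :=
  congrArg (fun g => g.hom x) (f.naturality (homOfLE h).op)

theorem appLE_eq_res_app {Z' Z : Scheme.{u}} (f : Z' ⟶ Z) {V : Z.Opens} {W : Z'.Opens}
    (h : W ≤ f ⁻¹ᵁ V) (x : Γ(Z, V)) : (f.appLE V W h).hom x = res h ((f.app V).hom x) := rfl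

theorem res_const {R : Type u} [CommRing R] {Z : Scheme.{u}} (π : Z ⟶ Spec (.of R))
    {V W : Z.Opens} (h : W ≤ V) (a : R) : res h (const π V a) = const π W a := by
  exact congrArg (fun g => g.hom ((Scheme.ΓSpecIso (.of R)).inv.hom a))
    (π.appLE_map (U := ⊤) (V := V) le_top (homOfLE h).op)

/-- Constants are compatible with a morphism over a morphism of base rings. -/
theorem appLE_const {R R' : Type u} [CommRing R] [CommRing R'] {Z Z' : Scheme.{u}}
    {π : Z ⟶ Spec (.of R)} {π' : Z' ⟶ Spec (.of R')} (f : Z' ⟶ Z) (φ : R →+* R')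
    (h : f ≫ π = π' ≫ Spec.map (CommRingCat.ofHom φ)) {V : Z.Opens} {W : Z'.Opens}
    (e : W ≤ f ⁻¹ᵁ V) (a : R) : (f.appLE V W e).hom (const π V a) = const π' W (φ a) := by
  have h1 : (π.appLE ⊤ V le_top) ≫ f.appLE V W e = (f ≫ π).appLE ⊤ W le_top :=
    Scheme.Hom.appLE_comp_appLE ..
  have h2 : (Spec.map (CommRingCat.ofHom φ)).appLE ⊤ ⊤ le_top ≫ π'.appLE ⊤ W le_top =
      (π' ≫ Spec.map (CommRingCat.ofHom φ)).appLE ⊤ W le_top :=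
    Scheme.Hom.appLE_comp_appLE ..
  have h3 : (f ≫ π).appLE ⊤ W le_top =
      (π' ≫ Spec.map (CommRingCat.ofHom φ)).appLE ⊤ W le_top := by
    simp only [h]
  have h4 : (Scheme.ΓSpecIso (.of R)).inv ≫ (Spec.map (CommRingCat.ofHom φ)).appLE ⊤ ⊤ le_top =
      CommRingCat.ofHom φ ≫ (Scheme.ΓSpecIso (.of R')).inv := by
    rw [Scheme.ΓSpecIso_inv_naturality]
    congr 1
  calc (f.appLE V W e).hom (const π V a) =
      ((Scheme.ΓSpecIso (.of R)).inv ≫ (π.appLE ⊤ V le_top) ≫ f.appLE V W e).hom a := rfl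
    _ = ((CommRingCat.ofHom φ ≫ (Scheme.ΓSpecIso (.of R')).inv) ≫ π'.appLE ⊤ W le_top).hom a := by
      rw [h1, h3, ← h2, ← h4, Category.assoc]
    _ = const π' W (φ a) := rfl

end Gluing

/-! ### Functions on products with the spectrum of an Artinian algebra -/

section Thick

variable {k : Type u} [Field k] {Y : Scheme.{u}} (π : Y ⟶ Spec (.of k))
  {A : Type u} [CommRing A] [Algebra k A] {A' : Type u} [CommRing A'] [Algebra k A']

/-- The functions on `W × Spec A`. -/
abbrev Sec (A : Type u) [CommRing A] [Algebra k A] (W : Y.Opens) : Type u :=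
  Γ(Thick π A, Thick.proj π A ⁻¹ᵁ W)

/-- The constants on `W × Spec A`. -/
abbrev cst (A : Type u) [CommRing A] [Algebra k A] (W : Y.Opens) : A →+* Sec π A W :=
  const (Thick.str π A) (Thick.proj π A ⁻¹ᵁ W)

/-- Restriction of functions on `V × Spec A`. -/
abbrev tres {V W : Y.Opens} (h : W ≤ V) : Sec π A V →+* Sec π A W :=
  res ((Thick.proj π A).preimage_mono h)

theorem Thick.fibre_proj (ε : A →ₐ[k] k) : Thick.fibre π ε ≫ Thick.proj π A = 𝟙 Y :=
  Limits.pullback.lift_fst _ _ _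

theorem Thick.fibre_str (ε : A →ₐ[k] k) : Thick.fibre π ε ≫ Thick.str π A = π ≫ specMap ε :=
  Limits.pullback.lift_snd _ _ _

theorem Thick.map_proj (φ : A' →ₐ[k] A) : Thick.map π φ ≫ Thick.proj π A' = Thick.proj π A :=
  Limits.pullback.lift_fst _ _ _

theorem Thick.map_str (φ : A' →ₐ[k] A) :
    Thick.map π φ ≫ Thick.str π A' = Thick.str π A ≫ specMap φ :=
  Limits.pullback.lift_snd _ _ _

theorem Thick.fibre_map (ε : A →ₐ[k] k) (φ : A' →ₐ[k] A) :
    Thick.fibre π ε ≫ Thick.map π φ = Thick.fibre π (ε.comp φ) := by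
  apply Limits.pullback.hom_ext
  · rw [Category.assoc, Thick.map_proj, Thick.fibre_proj, Thick.fibre_proj]
  · rw [Category.assoc, Thick.map_str, reassoc_of% Thick.fibre_str, Thick.fibre_str,
      ← Spec.map_comp]
    rfl

theorem Thick.fibre_preimage (ε : A →ₐ[k] k) (W : Y.Opens) :
    Thick.fibre π ε ⁻¹ᵁ Thick.proj π A ⁻¹ᵁ W = W := by
  rw [← Scheme.Hom.comp_preimage, Thick.fibre_proj]; rfl

theorem Thick.map_preimage (φ : A' →ₐ[k] A) (W : Y.Opens) :
    Thick.map π φ ⁻¹ᵁ Thick.proj π A' ⁻¹ᵁ W = Thick.proj π A ⁻¹ᵁ W := by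
  rw [← Scheme.Hom.comp_preimage, Thick.map_proj]

/-- Restriction to the closed fibre, of functions on `W × Spec A`. -/
def red (ε : A →ₐ[k] k) (W : Y.Opens) : Sec π A W →+* Γ(Y, W) :=
  ((Thick.fibre π ε).appLE (Thick.proj π A ⁻¹ᵁ W) W (Thick.fibre_preimage π ε W).ge).hom

/-- Restriction from `W × Spec A'` to `W × Spec A`. -/
def mp (φ : A' →ₐ[k] A) (W : Y.Opens) : Sec π A' W →+* Sec π A W :=
  ((Thick.map π φ).appLE (Thick.proj π A' ⁻¹ᵁ W) (Thick.proj π A ⁻¹ᵁ W)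
    (Thick.map_preimage π φ W).ge).hom

theorem red_pull (ε : A →ₐ[k] k) (W : Y.Opens) (b : Γ(Y, W)) :
    red π ε W (pull π A W b) = b := by
  have : (Thick.proj π A).app W ≫ (Thick.fibre π ε).appLE (Thick.proj π A ⁻¹ᵁ W) W
      (Thick.fibre_preimage π ε W).ge = 𝟙 _ := by
    rw [Scheme.Hom.app_eq_appLE, Scheme.Hom.appLE_comp_appLE]
    simp only [Thick.fibre_proj]
    exact (Scheme.Hom.app_eq_appLE (𝟙 Y)).symm.trans (Scheme.Hom.id_app _)
  exact congrArg (fun g => g.hom b) this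

theorem red_cst (ε : A →ₐ[k] k) (W : Y.Opens) (a : A) :
    red π ε W (cst π A W a) = const π W (ε a) :=
  appLE_const _ ε.toRingHom (Thick.fibre_str π ε) _ a

theorem mp_cst (φ : A' →ₐ[k] A) (W : Y.Opens) (a : A') :
    mp π φ W (cst π A' W a) = cst π A W (φ a) :=
  appLE_const _ φ.toRingHom (Thick.map_str π φ) _ a

theorem mp_pull (φ : A' →ₐ[k] A) (W : Y.Opens) (b : Γ(Y, W)) :
    mp π φ W (pull π A' W b) = pull π A W b := by
  have : (Thick.proj π A').app W ≫ (Thick.map π φ).appLE (Thick.proj π A' ⁻¹ᵁ W)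
      (Thick.proj π A ⁻¹ᵁ W) (Thick.map_preimage π φ W).ge = (Thick.proj π A).app W := by
    rw [Scheme.Hom.app_eq_appLE, Scheme.Hom.app_eq_appLE, Scheme.Hom.appLE_comp_appLE]
    simp only [Thick.map_proj]
  exact congrArg (fun g => g.hom b) this

theorem red_mp (ε : A →ₐ[k] k) (φ : A' →ₐ[k] A) (W : Y.Opens) (x : Sec π A' W) :
    red π ε W (mp π φ W x) = red π (ε.comp φ) W x := by
  have : (Thick.map π φ).appLE (Thick.proj π A' ⁻¹ᵁ W) (Thick.proj π A ⁻¹ᵁ W)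
      (Thick.map_preimage π φ W).ge ≫ (Thick.fibre π ε).appLE (Thick.proj π A ⁻¹ᵁ W) W
      (Thick.fibre_preimage π ε W).ge = (Thick.fibre π (ε.comp φ)).appLE (Thick.proj π A' ⁻¹ᵁ W) W
      (Thick.fibre_preimage π _ W).ge := by
    rw [Scheme.Hom.appLE_comp_appLE]
    simp only [Thick.fibre_map]
  exact congrArg (fun g => g.hom x) this

theorem red_res (ε : A →ₐ[k] k) {V W : Y.Opens} (h : W ≤ V) (x : Sec π A V) :
    red π ε W (tres π h x) = res h (red π ε V x) := by
  have := ((Thick.fibre π ε).map_appLE (Thick.fibre_preimage π ε W).ge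
    (homOfLE ((Thick.proj π A).preimage_mono h)).op).trans
    ((Thick.fibre π ε).appLE_map (Thick.fibre_preimage π ε V).ge (homOfLE h).op).symm
  exact congrArg (fun g => g.hom x) this

theorem mp_res (φ : A' →ₐ[k] A) {V W : Y.Opens} (h : W ≤ V) (x : Sec π A' V) :
    mp π φ W (tres π h x) = tres π h (mp π φ V x) := by
  have := ((Thick.map π φ).map_appLE (Thick.map_preimage π φ W).ge
    (homOfLE ((Thick.proj π A').preimage_mono h)).op).trans
    ((Thick.map π φ).appLE_map (Thick.map_preimage π φ V).ge
      (homOfLE ((Thick.proj π A).preimage_mono h)).op).symm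
  exact congrArg (fun g => g.hom x) this

theorem tres_pull {V W : Y.Opens} (h : W ≤ V) (b : Γ(Y, V)) :
    tres π h (pull π A V b) = pull π A W (res h b) := (app_res _ h b).symm

theorem tres_cst {V W : Y.Opens} (h : W ≤ V) (a : A) :
    tres π h (cst π A V a) = cst π A W a := res_const _ _ a

theorem Thick.isPullback_fibre (ε : A →ₐ[k] k) :
    IsPullback (Thick.fibre π ε) π (Thick.str π A) (specMap ε) := by
  refine IsPullback.of_right (h₁₂ := Thick.proj π A) (v₁₃ := π) (h₂₂ := specStr k A) ?_
    (Thick.fibre_str π ε) (IsPullback.of_hasPullback π (specStr k A))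
  rw [Thick.fibre_proj, specMap_aug]
  exact IsPullback.of_id_fst

theorem Thick.isPullback_map (φ : A' →ₐ[k] A) :
    IsPullback (Thick.map π φ) (Thick.str π A) (Thick.str π A') (specMap φ) := by
  refine IsPullback.of_right (h₁₂ := Thick.proj π A') (v₁₃ := π) (h₂₂ := specStr k A') ?_
    (Thick.map_str π φ) (IsPullback.of_hasPullback π (specStr k A'))
  rw [Thick.map_proj, specMap_str]
  exact IsPullback.of_hasPullback π (specStr k A)

instance : IsAffineHom (Thick.proj π A) :=
  MorphismProperty.of_isPullback (IsPullback.of_hasPullback π (specStr k A)).flip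
    (inferInstanceAs (IsAffineHom (specStr k A)))

instance (ε : A →ₐ[k] k) : IsAffineHom (Thick.fibre π ε) :=
  MorphismProperty.of_isPullback (Thick.isPullback_fibre π ε).flip
    (inferInstanceAs (IsAffineHom (specMap ε)))

instance (φ : A' →ₐ[k] A) : IsAffineHom (Thick.map π φ) :=
  MorphismProperty.of_isPullback (Thick.isPullback_map π φ).flip
    (inferInstanceAs (IsAffineHom (specMap φ)))

theorem isAffineOpen_proj {W : Y.Opens} (hW : IsAffineOpen W) :
    IsAffineOpen (Thick.proj π A ⁻¹ᵁ W) := hW.preimage _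

theorem Thick.fibre_surjective [IsLocalRing A] [IsArtinianRing A] (ε : A →ₐ[k] k) :
    Function.Surjective (Thick.fibre π ε) := by
  have : Surjective (specMap ε) := by
    refine ⟨fun x => ?_⟩
    have : Subsingleton (PrimeSpectrum A) := inferInstance
    exact ⟨IsLocalRing.closedPoint k, this.elim _ _⟩
  have : Surjective (Thick.fibre π ε) :=
    MorphismProperty.of_isPullback (Thick.isPullback_fibre π ε).flip this
  exact this.surj

/-- `Y` and `Y × Spec A` have the same topological space. -/
theorem Thick.preimage_fibre_preimage [IsLocalRing A] [IsArtinianRing A] (ε : A →ₐ[k] k)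
    (V : (Thick π A).Opens) : Thick.proj π A ⁻¹ᵁ Thick.fibre π ε ⁻¹ᵁ V = V := by
  ext z
  obtain ⟨y, rfl⟩ := Thick.fibre_surjective π ε z
  have : Thick.fibre π ε (Thick.proj π A (Thick.fibre π ε y)) = Thick.fibre π ε y := by
    have := congrArg (fun f : Y ⟶ Y => f y) (Thick.fibre_proj π ε)
    exact congrArg (Thick.fibre π ε) this
  change Thick.fibre π ε (Thick.proj π A (Thick.fibre π ε y)) ∈ V ↔ _
  rw [this]; rfl

theorem isNilpotent_ker [IsLocalRing A] [IsArtinianRing A] (ε : A →ₐ[k] k) :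
    IsNilpotent (RingHom.ker ε) := by
  have h1 : (RingHom.ker ε).IsMaximal := RingHom.ker_isMaximal_of_surjective (ε : A →+* k)
    fun x => ⟨algebraMap k A x, ε.commutes x⟩
  have := IsArtinianRing.isNilpotent_jacobson_bot (R := A)
  rwa [IsLocalRing.jacobson_eq_maximalIdeal _ bot_ne_top, ← IsLocalRing.eq_maximalIdeal h1] at this

theorem ker_eq_maximalIdeal [IsLocalRing A] (ε : A →ₐ[k] k) :
    RingHom.ker ε = IsLocalRing.maximalIdeal A :=
  IsLocalRing.eq_maximalIdeal (RingHom.ker_isMaximal_of_surjective (ε : A →+* k)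
    fun x => ⟨algebraMap k A x, ε.commutes x⟩)

/-- The functions on `W` as an algebra over `k`. -/
@[reducible]
def constAlgebra (π : Y ⟶ Spec (.of k)) (W : Y.Opens) : Algebra k Γ(Y, W) := (const π W).toAlgebra

/-- For `W` affine, the functions on `W × Spec A` are `A ⊗ Γ(Y, W)`. -/
theorem Thick.isTensor {W : Y.Opens} (hW : IsAffineOpen W) :
    letI := constAlgebra π W
    IsTensor k (cst π A W) (pull π A W) := by
  let := constAlgebra π W
  have H := IsPullback.of_hasPullback π (specStr k A)
  have hU : Thick.proj π A ⁻¹ᵁ W = Thick.proj π A ⁻¹ᵁ W ⊓ Thick.str π A ⁻¹ᵁ ⊤ := by simp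
  have h1 := isIso_pushoutSection_of_isAffineOpen H (US := ⊤) (UT := ⊤) (UX := W) le_top le_top
    hU (isAffineOpen_top _) (isAffineOpen_top _) hW
  replace h1 := (isIso_pushoutSection_iff _ _ _ _).1 h1
  have h2 : IsPushout (CommRingCat.ofHom (const π W)) (CommRingCat.ofHom (algebraMap k A))
      (CommRingCat.ofHom (pull π A W)) (CommRingCat.ofHom (cst π A W)) := by
    refine h1.of_iso (Scheme.ΓSpecIso (.of k)) (Iso.refl _) (Scheme.ΓSpecIso (.of A)) (Iso.refl _)
      ?_ ?_ ?_ ?_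
    · rw [← Iso.inv_comp_eq]
      rfl
    · exact Scheme.ΓSpecIso_naturality _
    · simp only [Iso.refl_hom, Category.comp_id, Category.id_comp]
      exact (Scheme.Hom.app_eq_appLE _).symm
    · rw [← Iso.inv_comp_eq]
      rfl
  let : Algebra Γ(Y, W) (Sec π A W) := (pull π A W).toAlgebra
  let : Algebra A (Sec π A W) := (cst π A W).toAlgebra
  let : Algebra k (Sec π A W) := ((cst π A W).comp (algebraMap k A)).toAlgebra
  have : IsScalarTower k A (Sec π A W) := .of_algebraMap_eq fun _ => rfl
  have : IsScalarTower k Γ(Y, W) (Sec π A W) := .of_algebraMap_eq fun x => by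
    exact congrArg (fun g => g.hom x) h2.w.symm
  have h3 : Algebra.IsPushout k Γ(Y, W) A (Sec π A W) :=
    CommRingCat.isPushout_iff_isPushout.1 h2
  have h4 : Algebra.IsPushout k A Γ(Y, W) (Sec π A W) := h3.symm
  refine ⟨(Algebra.IsPushout.equiv k A Γ(Y, W) (Sec π A W)).toRingEquiv, fun a b => ?_⟩
  change Algebra.IsPushout.equiv k A Γ(Y, W) (Sec π A W) _ = _
  rw [Algebra.IsPushout.equiv_tmul]
  rfl

theorem red_surjective (ε : A →ₐ[k] k) (W : Y.Opens) : Function.Surjective (red π ε W) :=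
  fun b => ⟨pull π A W b, red_pull π ε W b⟩

theorem Thick.isThickening {W : Y.Opens} (hW : IsAffineOpen W) (ε : A →ₐ[k] k) {t : A}
    (ht : t ≠ 0) (htε : t ∈ RingHom.ker ε) (hmul : ∀ a ∈ RingHom.ker ε, a * t = 0) :
    IsThickening (cst π A W) (pull π A W) (red π ε W) (RingHom.ker ε) t :=
  let := constAlgebra π W
  (Thick.isTensor π hW).isThickening ε (red_pull π ε W) (red_cst π ε W) ht htε hmul

theorem mem_map_of_red_eq_zero {W : Y.Opens} (hW : IsAffineOpen W) (ε : A →ₐ[k] k)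
    {x : Sec π A W} (hx : red π ε W x = 0) : x ∈ (RingHom.ker ε).map (cst π A W) :=
  let := constAlgebra π W
  (Thick.isTensor π hW).mem_map_of_eq_zero ε (red_pull π ε W) (red_cst π ε W) hx

theorem ker_red {W : Y.Opens} (hW : IsAffineOpen W) (ε : A →ₐ[k] k) :
    RingHom.ker (red π ε W) = (RingHom.ker ε).map (cst π A W) := by
  refine le_antisymm (fun x hx => mem_map_of_red_eq_zero π hW ε hx) ?_
  rw [Ideal.map_le_iff_le_comap]
  intro a ha
  have ha' : ε a = 0 := ha
  rw [Ideal.mem_comap, RingHom.mem_ker, red_cst, ha', map_zero]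

end Thick

/-! ### Ideals of closed subschemes and their base changes -/

section Subschemes

/-- The ideal of the base change of a closed subscheme, for a base change of schemes whose
functions are restrictions. -/
theorem ker_inr_of_isPushout {R S Q P : Type u} [CommRing R] [CommRing S] [CommRing Q] [CommRing P]
    {f : R →+* S} {q : R →+* Q} {f' : Q →+* P} {q' : S →+* P} (hq : Function.Surjective q)
    (h : IsPushout (CommRingCat.ofHom f) (CommRingCat.ofHom q) (CommRingCat.ofHom q')
      (CommRingCat.ofHom f')) : RingHom.ker q' = (RingHom.ker q).map f := by
  have hw : ∀ x, q' (f x) = f' (q x) := fun x => congrArg (fun g => g.hom x) h.w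
  refine le_antisymm ?_ ?_
  · let J := (RingHom.ker q).map f
    let g : Q →+* S ⧸ J := RingHom.liftOfSurjective q hq ⟨(Ideal.Quotient.mk J).comp f, fun x hx => by
      rw [RingHom.mem_ker, RingHom.comp_apply, Ideal.Quotient.eq_zero_iff_mem]
      exact Ideal.mem_map_of_mem f hx⟩
    have hg : ∀ x, g (q x) = Ideal.Quotient.mk J (f x) := fun x => by
      have := RingHom.liftOfSurjective_comp_apply q hq ⟨(Ideal.Quotient.mk J).comp f, fun x hx => by
        rw [RingHom.mem_ker, RingHom.comp_apply, Ideal.Quotient.eq_zero_iff_mem]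
        exact Ideal.mem_map_of_mem f hx⟩ x
      exact this
    let d := h.desc (CommRingCat.ofHom (Ideal.Quotient.mk J)) (CommRingCat.ofHom g) (by
      ext x; exact (hg x).symm)
    intro x hx
    have h1 : d.hom (q' x) = Ideal.Quotient.mk J x :=
      congrArg (fun g => g.hom x) (h.inl_desc (CommRingCat.ofHom (Ideal.Quotient.mk J))
        (CommRingCat.ofHom g) (by ext x; exact (hg x).symm))
    rw [RingHom.mem_ker] at hx
    rw [hx, map_zero] at h1
    exact Ideal.Quotient.eq_zero_iff_mem.1 h1.symm
  · rw [Ideal.map_le_iff_le_comap]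
    intro x hx
    rw [Ideal.mem_comap, RingHom.mem_ker, hw, show q x = 0 from hx, map_zero]

/-- On an affine open, the inverse image of an ideal sheaf under an affine morphism is the ideal
generated by the inverse image. -/
theorem ideal_comap_of_isAffineHom {Z Z' : Scheme.{u}} (I : Z.IdealSheafData) (s : Z' ⟶ Z)
    [IsAffineHom s] (V : Z.affineOpens) :
    (I.comap s).ideal ⟨s ⁻¹ᵁ V.1, V.2.preimage s⟩ = (I.ideal V).map (s.app V.1).hom := by
  have H := (IsPullback.of_hasPullback s I.subschemeι).flip
  have e : Limits.pullback.fst s I.subschemeι ⁻¹ᵁ s ⁻¹ᵁ V.1 =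
      Limits.pullback.snd s I.subschemeι ⁻¹ᵁ (I.subschemeι ⁻¹ᵁ V.1) ⊓
        Limits.pullback.fst s I.subschemeι ⁻¹ᵁ s ⁻¹ᵁ V.1 := by
    rw [right_eq_inf, ← Scheme.Hom.comp_preimage, ← Scheme.Hom.comp_preimage, H.w]
  have h1 := (isIso_pushoutSection_iff _ _ _ _).1 (isIso_pushoutSection_of_isAffineOpen H
    (US := V.1) (UT := s ⁻¹ᵁ V.1) (UX := I.subschemeι ⁻¹ᵁ V.1) le_rfl le_rfl e V.2
    (V.2.preimage s) (V.2.preimage _))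
  have h2 := ker_inr_of_isPushout (f := (s.app V.1).hom) (q := (I.subschemeι.app V.1).hom)
    (q' := ((Limits.pullback.fst s I.subschemeι).app (s ⁻¹ᵁ V.1)).hom)
    (f' := ((Limits.pullback.snd s I.subschemeι).appLE (I.subschemeι ⁻¹ᵁ V.1)
      (Limits.pullback.fst s I.subschemeι ⁻¹ᵁ s ⁻¹ᵁ V.1) (e.le.trans inf_le_left)).hom)
    (Scheme.Hom.app_surjective _ _ V.2) (by
      have := h1.flip
      simp only [← Scheme.Hom.app_eq_appLE] at this
      exact this)
  rw [Scheme.IdealSheafData.ker_subschemeι_app] at h2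
  rw [← h2]
  exact Scheme.Hom.ker_apply _ _

/-- A closed subscheme induces another one if and only if the ideal sheaf of the second is the
inverse image of the ideal sheaf of the first. -/
theorem inducesSubscheme_iff {T Z S T' Z' S' : Scheme.{u}} {ι : T ⟶ Z} {ρ : Z ⟶ S} {ι' : T' ⟶ Z'}
    {ρ' : Z' ⟶ S'} {s : Z' ⟶ Z} {b : S' ⟶ S} [IsClosedImmersion ι] [IsClosedImmersion ι']
    (h : IsPullback s ρ' ρ b) :
    InducesSubscheme ι ρ ι' ρ' s b ↔ ι'.ker = ι.ker.comap s := by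
  constructor
  · rintro ⟨j, hj, H⟩
    have H' : IsPullback ι' j s ι := (IsPullback.of_bot H hj h).flip
    rw [← Scheme.IdealSheafData.ker_fst_of_isClosedImmersion, ← H'.isoPullback_hom_fst,
      Scheme.Hom.ker_comp_of_isIso]
  · intro hk
    have hle : ι.ker ≤ (ι' ≫ s).ker := by
      rw [Scheme.Hom.ker_comp, Scheme.IdealSheafData.le_map_iff_comap_le, hk]
    have hj := IsClosedImmersion.lift_fac ι (ι' ≫ s) hle
    have H := isPullback_of_isClosedImmersion ι' ι (IsClosedImmersion.lift ι (ι' ≫ s) hle) s hj.symm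
      hk.symm
    exact ⟨_, hj, H.flip.paste_vert h⟩

theorem ideal_comap_appLE {Z Z' : Scheme.{u}} (I : Z.IdealSheafData) (s : Z' ⟶ Z)
    [IsAffineHom s] {V : Z.Opens} (hV : IsAffineOpen V) {V' : Z'.Opens} (h : V' = s ⁻¹ᵁ V)
    (hV' : IsAffineOpen V') :
    (I.comap s).ideal ⟨V', hV'⟩ = (I.ideal ⟨V, hV⟩).map (s.appLE V V' h.le).hom := by
  subst h
  rw [← Scheme.Hom.app_eq_appLE]
  exact ideal_comap_of_isAffineHom I s ⟨V, hV⟩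

/-- A morphism out of a closed subscheme of an affine scheme is flat if and only if the
corresponding quotient ring is flat. -/
theorem flat_appLE_subschemeι_iff {R : Type u} [CommRing R] {Z : Scheme.{u}}
    (π : Z ⟶ Spec (.of R)) (I : Z.IdealSheafData) {V : Z.Opens} (hV : IsAffineOpen V) :
    RingHom.Flat ((I.subschemeι ≫ π).appLE ⊤ (I.subschemeι ⁻¹ᵁ V) le_top).hom ↔
      RingHom.Flat ((Ideal.Quotient.mk (RingHom.ker (I.subschemeι.app V).hom)).comp
        (const π V)) := by
  let e := RingHom.quotientKerEquivOfSurjective (Scheme.Hom.app_surjective I.subschemeι V hV)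
  have h1 : ((I.subschemeι ≫ π).appLE ⊤ (I.subschemeι ⁻¹ᵁ V) le_top).hom.comp
      (Scheme.ΓSpecIso (.of R)).inv.hom = (e : _ →+* _).comp
        ((Ideal.Quotient.mk (RingHom.ker (I.subschemeι.app V).hom)).comp (const π V)) := by
    ext a
    have h2 := appLE_const (π := π) (π' := I.subschemeι ≫ π) I.subschemeι (RingHom.id R)
      (by rw [CommRingCat.ofHom_id, Spec.map_id, Category.comp_id]) (le_refl (I.subschemeι ⁻¹ᵁ V)) a
    rw [← Scheme.Hom.app_eq_appLE] at h2
    exact h2.symm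
  have b1 : Function.Bijective (Scheme.ΓSpecIso (.of R)).inv.hom :=
    (Scheme.ΓSpecIso (.of R)).symm.commRingCatIsoToRingEquiv.bijective
  rw [← RingHom.Flat.comp_iff_of_bijective_right b1, h1]
  exact RingHom.Flat.comp_iff_of_bijective_left (g := e.toRingHom) e.bijective

/-- Flatness of a closed subscheme can be checked on an affine cover of the ambient scheme. -/
theorem flat_subschemeι_iff {R : Type u} [CommRing R] {Z : Scheme.{u}}
    (π : Z ⟶ Spec (.of R)) (I : Z.IdealSheafData) {ι : Type*} (V : ι → Z.affineOpens)
    (hcov : ⨆ j, (V j : Z.Opens) = ⊤) :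
    Flat (I.subschemeι ≫ π) ↔
      ∀ j, RingHom.Flat ((Ideal.Quotient.mk (RingHom.ker (I.subschemeι.app (V j)).hom)).comp
        (const π (V j).1)) := by
  rw [HasRingHomProperty.iff_of_iSup_eq_top (P := @Flat)
    (fun j => ⟨I.subschemeι ⁻¹ᵁ (V j).1, (V j).2.preimage I.subschemeι⟩)
    (by rw [← Scheme.Hom.preimage_iSup, hcov]; rfl)]
  exact forall_congr' fun j => flat_appLE_subschemeι_iff π I (V j).2

end Subschemes

section DeformationIdeal

variable {k : Type u} [Field k] {X Y : Scheme.{u}} {π : Y ⟶ Spec (.of k)} {i : X ⟶ Y}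
  {Λ₀ : PoissonStructure π}
  {A : Type u} [CommRing A] [Algebra k A] {A' : Type u} [CommRing A'] [Algebra k A']

/-- The ideal, in the functions on `W × Spec A`, of a closed subscheme of `Y × Spec A`. -/
def secIdeal (I : (Thick π A).IdealSheafData) (W : Y.Opens) : Ideal (Sec π A W) :=
  RingHom.ker (I.subschemeι.app (Thick.proj π A ⁻¹ᵁ W)).hom

theorem secIdeal_eq (I : (Thick π A).IdealSheafData) {W : Y.Opens} (hW : IsAffineOpen W) :
    secIdeal I W = I.ideal ⟨_, isAffineOpen_proj π hW⟩ :=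
  Scheme.IdealSheafData.ker_subschemeι_app I ⟨_, isAffineOpen_proj π hW⟩

theorem tres_mem_secIdeal (I : (Thick π A).IdealSheafData) {V W : Y.Opens} (h : W ≤ V)
    {x : Sec π A V} (hx : x ∈ secIdeal I V) : tres π h x ∈ secIdeal I W := by
  have h1 : (I.subschemeι.app (Thick.proj π A ⁻¹ᵁ V)).hom x = 0 := hx
  change (I.subschemeι.app (Thick.proj π A ⁻¹ᵁ W)).hom _ = 0
  rw [app_res, h1, map_zero]

/-- On affine opens the restrictions of the ideal of a closed subscheme generate its ideal. -/
theorem map_secIdeal (I : (Thick π A).IdealSheafData) {V W : Y.Opens} (hV : IsAffineOpen V)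
    (hW : IsAffineOpen W) (h : W ≤ V) : (secIdeal I V).map (tres π h) = secIdeal I W := by
  rw [secIdeal_eq I hV, secIdeal_eq I hW]
  exact I.map_ideal (U := ⟨_, isAffineOpen_proj π hW⟩) (V := ⟨_, isAffineOpen_proj π hV⟩)
    ((Thick.proj π A).preimage_mono h)

theorem exists_affine_cover_proj (π : Y ⟶ Spec (.of k)) (A : Type u) [CommRing A] [Algebra k A]
    (P : Y.Opens → Prop) (hP : ∀ y, ∃ W, IsAffineOpen W ∧ P W ∧ y ∈ W) :
    ⨆ W : {W : Y.affineOpens // P W}, Thick.proj π A ⁻¹ᵁ (W.1 : Y.Opens) = ⊤ := by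
  rw [eq_top_iff]
  intro z _
  obtain ⟨W, hW, hPW, hz⟩ := hP (Thick.proj π A z)
  exact TopologicalSpace.Opens.mem_iSup.2 ⟨⟨⟨W, hW⟩, hPW⟩, hz⟩

/-- `X` is the closed fibre of a closed subscheme of `Y × Spec A` if and only if, on an affine
cover, the ideal of `X` is the reduction of the ideal of the subscheme. -/
theorem inducesSubscheme_fibre_iff [IsClosedImmersion i] (ε : A →ₐ[k] k)
    (I : (Thick π A).IdealSheafData) (P : Y.Opens → Prop)
    (hP : ∀ y, ∃ W, IsAffineOpen W ∧ P W ∧ y ∈ W) :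
    InducesSubscheme I.subschemeι (Thick.str π A) i π (Thick.fibre π ε) (specMap ε) ↔
      ∀ W, IsAffineOpen W → P W →
        RingHom.ker (i.app W).hom = (secIdeal I W).map (red π ε W) := by
  rw [inducesSubscheme_iff (Thick.isPullback_fibre π ε), Scheme.IdealSheafData.ker_subschemeι]
  have key : ∀ W (hW : IsAffineOpen W), (I.comap (Thick.fibre π ε)).ideal ⟨W, hW⟩ =
      (secIdeal I W).map (red π ε W) := fun W hW => by
    rw [secIdeal_eq I hW]
    exact ideal_comap_appLE I _ (isAffineOpen_proj π hW) (Thick.fibre_preimage π ε W).symm hW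
  constructor
  · intro h W hW _
    rw [← key W hW, ← h]
    exact (Scheme.Hom.ker_apply i ⟨W, hW⟩).symm
  · intro h
    refine Scheme.IdealSheafData.ext_of_iSup_eq_top
      (fun W : {W : Y.affineOpens // P W} => W.1) ?_ fun W => ?_
    · rw [eq_top_iff]
      intro y _
      obtain ⟨W, hW, hPW, hy⟩ := hP y
      exact TopologicalSpace.Opens.mem_iSup.2 ⟨⟨⟨W, hW⟩, hPW⟩, hy⟩
    · exact (Scheme.Hom.ker_apply i W.1).trans ((h W.1 W.1.2 W.2).trans (key W.1 W.1.2).symm)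

theorem inducesSubscheme_map_iff (φ : A' →ₐ[k] A) (I' : (Thick π A').IdealSheafData)
    (I : (Thick π A).IdealSheafData) (P : Y.Opens → Prop)
    (hP : ∀ y, ∃ W, IsAffineOpen W ∧ P W ∧ y ∈ W) :
    InducesSubscheme I'.subschemeι (Thick.str π A') I.subschemeι (Thick.str π A) (Thick.map π φ)
        (specMap φ) ↔
      ∀ W, IsAffineOpen W → P W → secIdeal I W = (secIdeal I' W).map (mp π φ W) := by
  rw [inducesSubscheme_iff (Thick.isPullback_map π φ), Scheme.IdealSheafData.ker_subschemeι,
    Scheme.IdealSheafData.ker_subschemeι]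
  have key : ∀ W (hW : IsAffineOpen W), (I'.comap (Thick.map π φ)).ideal
      ⟨_, isAffineOpen_proj π hW⟩ = (secIdeal I' W).map (mp π φ W) := fun W hW => by
    rw [secIdeal_eq I' hW]
    exact ideal_comap_appLE I' _ (isAffineOpen_proj π hW) (Thick.map_preimage π φ W).symm
      (isAffineOpen_proj π hW)
  constructor
  · intro h W hW _
    rw [← key W hW, ← h, secIdeal_eq I hW]
  · intro h
    refine Scheme.IdealSheafData.ext_of_iSup_eq_top
      (fun W : {W : Y.affineOpens // P W} => ⟨_, isAffineOpen_proj π W.1.2⟩)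
      (exists_affine_cover_proj π A P hP) fun W => ?_
    rw [key W.1 W.1.2, ← h W.1 W.1.2 W.2, secIdeal_eq I W.1.2]

theorem mem_map_red_iff (ε : A →ₐ[k] k) {W : Y.Opens} {J : Ideal (Sec π A W)} {f : Γ(Y, W)} :
    f ∈ J.map (red π ε W) ↔ ∃ x ∈ J, red π ε W x = f :=
  Ideal.mem_map_iff_of_surjective _ (red_surjective π ε W)

end DeformationIdeal

/-! ### Sections of the complex, from their values on affine opens -/

section Sections

variable {k : Type u} [Field k] {X Y : Scheme.{u}} {π : Y ⟶ Spec (.of k)} {i : X ⟶ Y}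
  {Λ₀ : PoissonStructure π} {ΛX : PoissonStructure (i ≫ π)}

theorem PoissonStructure.isBiderivation {R : Type u} [CommRing R] {Z : Scheme.{u}}
    {ρ : Z ⟶ Spec (.of R)} (Λ : PoissonStructure ρ) (V : Z.Opens) :
    IsBiderivation (const ρ V) (Λ.bracket V) :=
  ⟨Λ.add_right V, Λ.leibniz V, Λ.const_right V, Λ.self V, Λ.skew V⟩

/-- The family commutes with restriction. -/
def PolyCompat (U : Y.Opens) {q : ℕ} (P : PolyFamily Y U q) : Prop :=
  ∀ (V W : Y.Opens) (hV : V ≤ U) (h : W ≤ V) (v : Fin q → Γ(Y, V)),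
    res h (P ⟨V, hV⟩ v) = P ⟨W, h.trans hV⟩ fun l => res h (v l)

/-- The family commutes with restriction. -/
def NormalCompat (U : Y.Opens) {p : ℕ} (Φ : NormalFamily i U p) : Prop :=
  ∀ (V W : Y.Opens) (hV : V ≤ U) (h : W ≤ V) (f : RingHom.ker (i.app V).hom)
    (f' : RingHom.ker (i.app W).hom), (f' : Γ(Y, W)) = res h f → ∀ v : Fin p → Γ(Y, V),
      res (i.preimage_mono h) (Φ ⟨V, hV⟩ f v) = Φ ⟨W, h.trans hV⟩ f' fun l => res h (v l)

/-- Restriction of elements of the ideal of `X`. -/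
def kres (i : X ⟶ Y) {V W : Y.Opens} (h : W ≤ V) (f : RingHom.ker (i.app V).hom) :
    RingHom.ker (i.app W).hom :=
  ⟨res h f, by
    rw [RingHom.mem_ker, app_res]
    exact (congrArg (res _) f.2).trans (map_zero _)⟩

theorem exists_affine_le_of_mem_preimage {V : Y.Opens} {x : X} (hx : x ∈ i ⁻¹ᵁ V) :
    ∃ W : Y.affineOpens, (W : Y.Opens) ≤ V ∧ x ∈ i ⁻¹ᵁ (W : Y.Opens) := by
  obtain ⟨W, hW, hWV, hx⟩ := exists_affine_le (T := Y) (V := V) (x := i x) hx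
  exact ⟨⟨W, hW⟩, hWV, hx⟩

theorem eq_of_res_affine {V : Y.Opens} {a b : Γ(Y, V)}
    (h : ∀ W (_ : IsAffineOpen W) (hW : W ≤ V), res hW a = res hW b) : a = b :=
  eq_of_res_eq (fun W : Y.affineOpens => (W : Y.Opens)) (fun x hx => by
    obtain ⟨W, hW, hWV, hx⟩ := exists_affine_le hx
    exact ⟨⟨W, hW⟩, hWV, hx⟩) fun W => h W W.2

theorem eq_of_res_preimage_affine {V : Y.Opens} {a b : Γ(X, i ⁻¹ᵁ V)}
    (h : ∀ W (_ : IsAffineOpen W) (hW : W ≤ V),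
      res (i.preimage_mono hW) a = res (i.preimage_mono hW) b) : a = b :=
  eq_of_res_eq (fun W : {W : Y.affineOpens // (W : Y.Opens) ≤ V} => i ⁻¹ᵁ (W.1 : Y.Opens))
    (fun x hx => by
      obtain ⟨W, hWV, hx⟩ := exists_affine_le_of_mem_preimage hx
      exact ⟨⟨W, hWV⟩, i.preimage_mono hWV, hx⟩) fun W _ => h W.1 W.1.2 W.2

theorem PolyCompat.ext {U : Y.Opens} {q : ℕ} {P P' : PolyFamily Y U q} (h : PolyCompat U P)
    (h' : PolyCompat U P') (H : ∀ W (_ : IsAffineOpen W) (hW : W ≤ U), P ⟨W, hW⟩ = P' ⟨W, hW⟩) :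
    P = P' := by
  funext ⟨V, hV⟩ v
  refine eq_of_res_affine fun W hW hWV => ?_
  rw [h V W hV hWV, h' V W hV hWV, H W hW]

theorem NormalCompat.ext {U : Y.Opens} {q : ℕ} {P P' : NormalFamily i U q} (h : NormalCompat U P)
    (h' : NormalCompat U P')
    (H : ∀ W (_ : IsAffineOpen W) (hW : W ≤ U), P ⟨W, hW⟩ = P' ⟨W, hW⟩) : P = P' := by
  funext ⟨V, hV⟩ f v
  refine eq_of_res_preimage_affine fun W hW hWV => ?_
  rw [h V W hV hWV f (kres i hWV f) rfl, h' V W hV hWV f (kres i hWV f) rfl, H W hW]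

theorem pair_ext {U : Y.Opens} {p : ℕ} {s s' : PairFamily i U p} (h : PolyCompat U s.1)
    (h' : PolyCompat U s'.1) (k : NormalCompat U s.2) (k' : NormalCompat U s'.2)
    (H : ∀ W (_ : IsAffineOpen W) (hW : W ≤ U),
      s.1 ⟨W, hW⟩ = s'.1 ⟨W, hW⟩ ∧ s.2 ⟨W, hW⟩ = s'.2 ⟨W, hW⟩) : s = s' :=
  Prod.ext (h.ext h' fun W hW hWU => (H W hW hWU).1) (k.ext k' fun W hW hWU => (H W hW hWU).2)

theorem complexSections_ext {U : Y.Opens} {p : ℕ} {s s' : PairFamily i U p}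
    (hs : s ∈ complexSections π i U p) (hs' : s' ∈ complexSections π i U p)
    (H : ∀ W (_ : IsAffineOpen W) (hW : W ≤ U),
      s.1 ⟨W, hW⟩ = s'.1 ⟨W, hW⟩ ∧ s.2 ⟨W, hW⟩ = s'.2 ⟨W, hW⟩) : s = s' :=
  pair_ext hs.1.restrict hs'.1.restrict hs.2.restrict hs'.2.restrict H

theorem comp_update {α β : Type*} {n : ℕ} (f : α → β) (v : Fin n → α) (l : Fin n) (a : α) :
    (fun m => f (Function.update v l a m)) = Function.update (fun m => f (v m)) l (f a) :=
  Function.comp_update f v l a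

/-- A family of polyderivations on the affine opens that is compatible with restriction extends
to a section of the sheaf of polyderivations. -/
theorem exists_isPolyvector (U : Y.Opens) {q : ℕ}
    (D : ∀ W, IsAffineOpen W → W ≤ U → (Fin q → Γ(Y, W)) → Γ(Y, W))
    (hD : ∀ W hW hWU, IsPolyderivation (const π W) (RingHom.id Γ(Y, W)) (D W hW hWU))
    (hres : ∀ V W hV hVU hW (h : W ≤ V) v,
      res h (D V hV hVU v) = D W hW (h.trans hVU) fun l => res h (v l)) :
    ∃ P : PolyFamily Y U q, IsPolyvector π U P ∧ ∀ W hW hWU, P ⟨W, hWU⟩ = D W hW hWU := by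
  have key : ∀ (V : Set.Iic U) (v : Fin q → Γ(Y, V.1)), ∃ x : Γ(Y, V.1),
      ∀ W (hW : IsAffineOpen W) (hWV : W ≤ V.1),
        res hWV x = D W hW (hWV.trans V.2) fun l => res hWV (v l) := by
    intro V v
    obtain ⟨x, hx, -⟩ := existsUnique_glue (fun W : Y.affineOpens => (W : Y.Opens))
      (fun _ _ h => h) V.1
      (fun x hx => by
        obtain ⟨W, hW, hWV, hx⟩ := exists_affine_le hx
        exact ⟨⟨W, hW⟩, hWV, hx⟩)
      (fun W₁ W₂ x h₁ h₂ => by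
        obtain ⟨W, hW, hWV, hx⟩ := exists_affine_le (V := W₁.1 ⊓ W₂.1) ⟨h₁, h₂⟩
        exact ⟨⟨W, hW⟩, hWV.trans inf_le_left, hWV.trans inf_le_right, hx⟩)
      (fun W hW => D W W.2 (hW.trans V.2) fun l => res hW (v l))
      (fun W' W h hW => by
        refine (hres _ _ _ _ W'.2 h _).trans ?_
        congr 1
        funext l
        exact res_res _ _ _)
    exact ⟨x, fun W hW => hx ⟨W, hW⟩⟩
  choose P hP using key
  have hcompat : PolyCompat U P := by
    intro V W hV h v
    refine eq_of_res_affine fun W' hW' hWW' => ?_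
    rw [res_res, hP ⟨V, hV⟩ v W' hW' (hWW'.trans h), hP ⟨W, h.trans hV⟩ _ W' hW' hWW']
    congr 1
    funext l
    rw [res_res]
  refine ⟨P, ⟨fun V hV => ⟨?_, ?_, ?_, ?_⟩, hcompat⟩, fun W hW hWU => ?_⟩
  · intro v l a b
    refine eq_of_res_affine fun W hW hWV => ?_
    rw [map_add, hP ⟨V, hV⟩ _ W hW, hP ⟨V, hV⟩ _ W hW, hP ⟨V, hV⟩ _ W hW, comp_update, comp_update,
      comp_update, map_add, (hD W hW _).map_add]
  · intro v l a b
    refine eq_of_res_affine fun W hW hWV => ?_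
    simp only [RingHom.id_apply]
    rw [map_add, map_mul, map_mul, hP ⟨V, hV⟩ _ W hW, hP ⟨V, hV⟩ _ W hW, hP ⟨V, hV⟩ _ W hW,
      comp_update, comp_update, comp_update, map_mul, (hD W hW _).leibniz]
    rfl
  · intro v l x
    refine eq_of_res_affine fun W hW hWV => ?_
    rw [hP ⟨V, hV⟩ _ W hW, comp_update, res_const, (hD W hW _).map_const, map_zero]
  · intro v l m hlm hv
    refine eq_of_res_affine fun W hW hWV => ?_
    rw [hP ⟨V, hV⟩ _ W hW, (hD W hW _).alternating _ l m hlm (by rw [hv]), map_zero]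
  · funext v
    have := hP ⟨W, hWU⟩ v W hW le_rfl
    rw [res_self] at this
    rw [this]
    congr 1
    funext l
    exact res_self _ _

/-- A compatible family of sections of the normal terms on the affine opens extends to a section
of the sheaf. -/
theorem exists_isNormalSection (U : Y.Opens) {q : ℕ}
    (D : ∀ W, IsAffineOpen W → W ≤ U → RingHom.ker (i.app W).hom → (Fin q → Γ(Y, W)) →
      Γ(X, i ⁻¹ᵁ W))
    (hD : ∀ W hW hWU, IsNormalAt (i.app W).hom (const π W) (D W hW hWU))
    (hres : ∀ V W hV hVU hW (h : W ≤ V) f v, res (i.preimage_mono h) (D V hV hVU f v) =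
      D W hW (h.trans hVU) (kres i h f) fun l => res h (v l)) :
    ∃ P : NormalFamily i U q, IsNormalSection π i U P ∧ ∀ W hW hWU, P ⟨W, hWU⟩ = D W hW hWU := by
  have hkk : ∀ {V W W' : Y.Opens} (h : W ≤ V) (h' : W' ≤ W) (f : RingHom.ker (i.app V).hom),
      kres i h' (kres i h f) = kres i (h'.trans h) f := fun h h' f => Subtype.ext (res_res _ _ _)
  have key : ∀ (V : Set.Iic U) (f : RingHom.ker (i.app V.1).hom) (v : Fin q → Γ(Y, V.1)),
      ∃ x : Γ(X, i ⁻¹ᵁ V.1), ∀ W (hW : IsAffineOpen W) (hWV : W ≤ V.1),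
        res (i.preimage_mono hWV) x =
          D W hW (hWV.trans V.2) (kres i hWV f) fun l => res hWV (v l) := by
    intro V f v
    obtain ⟨x, hx, -⟩ := existsUnique_glue
      -- The cover is indexed by affine opens of `Y`, not by their preimages: the values of `D` at
      -- opens with equal preimages are not visibly equal.
      (fun W : {W : Y.affineOpens // (W : Y.Opens) ≤ V.1} => i ⁻¹ᵁ (W.1 : Y.Opens))
      (fun _ _ h => i.preimage_mono h) (i ⁻¹ᵁ V.1)
      (fun x hx => by
        obtain ⟨W, hWV, hx⟩ := exists_affine_le_of_mem_preimage hx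
        exact ⟨⟨W, hWV⟩, i.preimage_mono hWV, hx⟩)
      (fun W₁ W₂ x h₁ h₂ => by
        obtain ⟨W, hWV, hx⟩ := exists_affine_le_of_mem_preimage (i := i)
          (V := W₁.1.1 ⊓ W₂.1.1) (x := x) ⟨h₁, h₂⟩
        exact ⟨⟨W, (hWV.trans inf_le_left).trans W₁.2⟩, hWV.trans inf_le_left,
          hWV.trans inf_le_right, hx⟩)
      (fun W _ => D W.1 W.1.2 (W.2.trans V.2) (kres i W.2 f)
        fun l => res W.2 (v l))
      (fun W' W h hW => by
        refine (hres _ _ _ _ W'.1.2 h _ _).trans ?_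
        rw [hkk]
        congr 1
        funext l
        exact res_res _ _ _)
    exact ⟨x, fun W hW hWV => hx ⟨⟨W, hW⟩, hWV⟩ (i.preimage_mono hWV)⟩
  choose P hP using key
  refine ⟨P, ⟨fun V hV f => ⟨?_, ?_, ?_, ?_⟩, ?_, ?_, ?_⟩, fun W hW hWU => ?_⟩
  · intro v l a b
    refine eq_of_res_preimage_affine fun W hW hWV => ?_
    rw [map_add, hP ⟨V, hV⟩ _ _ W hW hWV, hP ⟨V, hV⟩ _ _ W hW hWV, hP ⟨V, hV⟩ _ _ W hW hWV,
      comp_update, comp_update, comp_update, map_add, ((hD W hW _).polyderivation _).map_add]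
  · intro v l a b
    refine eq_of_res_preimage_affine fun W hW hWV => ?_
    rw [map_add, map_mul, map_mul, hP ⟨V, hV⟩ _ _ W hW hWV, hP ⟨V, hV⟩ _ _ W hW hWV,
      hP ⟨V, hV⟩ _ _ W hW hWV, comp_update, comp_update, comp_update, map_mul,
      ((hD W hW _).polyderivation _).leibniz, app_res, app_res]
  · intro v l x
    refine eq_of_res_preimage_affine fun W hW hWV => ?_
    rw [hP ⟨V, hV⟩ _ _ W hW hWV, comp_update, res_const, ((hD W hW _).polyderivation _).map_const,
      map_zero]
  · intro v l m hlm hv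
    refine eq_of_res_preimage_affine fun W hW hWV => ?_
    rw [hP ⟨V, hV⟩ _ _ W hW hWV, ((hD W hW _).polyderivation _).alternating _ l m hlm (by rw [hv]),
      map_zero]
  · intro V hV f g v
    refine eq_of_res_preimage_affine fun W hW hWV => ?_
    rw [map_add, hP ⟨V, hV⟩ _ _ W hW hWV, hP ⟨V, hV⟩ _ _ W hW hWV, hP ⟨V, hV⟩ _ _ W hW hWV,
      ← (hD W hW _).map_add]
    congr 1
    exact Subtype.ext (map_add (res hWV) _ _)
  · intro V hV a f v
    refine eq_of_res_preimage_affine fun W hW hWV => ?_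
    rw [map_mul, hP ⟨V, hV⟩ _ _ W hW hWV, hP ⟨V, hV⟩ _ _ W hW hWV, ← app_res i hWV,
      ← (hD W hW _).map_smul]
    congr 1
    exact Subtype.ext (map_mul (res hWV) _ _)
  · intro V W hV h f f' hf v
    obtain rfl : f' = kres i h f := Subtype.ext hf
    refine eq_of_res_preimage_affine fun W' hW' hWW' => ?_
    rw [res_res, hP ⟨V, hV⟩ f v W' hW' (hWW'.trans h), hP ⟨W, h.trans hV⟩ _ _ W' hW' hWW', hkk]
    congr 1
    funext l
    rw [res_res]
  · funext f v
    have := hP ⟨W, hWU⟩ f v W hW le_rfl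
    rw [res_self] at this
    rw [this]
    congr 1
    · exact Subtype.ext (res_self _ _)
    · funext l
      exact res_self _ _

theorem ceDiff_map {A M A' M' : Type*} [AddCommGroup M] [AddCommGroup M'] {br : A → A → A}
    {act : A → M → M} {br' : A' → A' → A'} {act' : A' → M' → M'} (f : A → A') (g : M →+ M')
    (hbr : ∀ a b, f (br a b) = br' (f a) (f b)) (hact : ∀ a x, g (act a x) = act' (f a) (g x))
    {p : ℕ} {D : (Fin p → A) → M} {D' : (Fin p → A') → M'}
    (hD : ∀ v, g (D v) = D' fun l => f (v l)) (h : Fin (p + 1) → A) :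
    g (ceDiff br act D h) = ceDiff br' act' D' fun l => f (h l) := by
  simp only [ceDiff, map_sum, map_zsmul, map_sub, hD, hact, comp_update, hbr]

theorem differential_polyCompat (hi : IsPoissonHom i ΛX Λ₀) {U : Y.Opens} {p : ℕ}
    {s : PairFamily i U p} (hs : s ∈ complexSections π i U p) :
    PolyCompat U (differential hi U p s).1 := fun V W hV h v =>
  ceDiff_map (res h) (res h).toAddMonoidHom (Λ₀.restrict V W h) (Λ₀.restrict V W h)
    (hs.1.restrict V W hV h) v

theorem differential_normalCompat (hi : IsPoissonHom i ΛX Λ₀) {U : Y.Opens} {p : ℕ}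
    {s : PairFamily i U p} (hs : s ∈ complexSections π i U p) :
    NormalCompat U (differential hi U p s).2 := by
  intro V W hV h f f' hf v
  have e1 := ceDiff_map (res h) (res (i.preimage_mono h)).toAddMonoidHom
    (br := Λ₀.bracket V) (br' := Λ₀.bracket W) (Λ₀.restrict V W h)
    (act := fun a x => ΛX.bracket (i ⁻¹ᵁ V) ((i.app V).hom a) x)
    (act' := fun a x => ΛX.bracket (i ⁻¹ᵁ W) ((i.app W).hom a) x)
    (fun a x => by
      refine (ΛX.restrict _ _ (i.preimage_mono h) _ _).trans ?_
      rw [app_res]; rfl)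
    (hs.2.restrict V W hV h f f' hf) v
  have e2 := app_res i h (s.1 ⟨V, hV⟩ (Fin.cons (f : Γ(Y, V)) v))
  rw [hs.1.restrict V W hV h] at e2
  have e3 : (fun l => res h ((Fin.cons (f : Γ(Y, V)) v : Fin (p + 2) → Γ(Y, V)) l)) =
      Fin.cons (f' : Γ(Y, W)) (fun l => res h (v l)) := by
    rw [hf]
    funext l
    refine Fin.cases ?_ (fun l => ?_) l <;> rfl
  rw [e3] at e2
  change res _ (_ + _ - _) = _ + _ - _
  rw [map_sub, map_add, map_sum, ← e2]
  refine congrArg₂ (· - ·) (congrArg₂ (· + ·) rfl e1) (Finset.sum_congr rfl fun j _ => ?_)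
  rw [map_zsmul]
  congr 1
  refine hs.2.restrict V W hV h _ _ ?_ _
  change Λ₀.bracket W _ _ = res h (Λ₀.bracket V _ _)
  rw [Λ₀.restrict, hf]

/-- The second component of the differential, on a fixed open. -/
theorem differential_snd (hi : IsPoissonHom i ΛX Λ₀) {U : Y.Opens} {p : ℕ}
    (s : PairFamily i U p) (V : Set.Iic U) :
    (differential hi U p s).2 V = normalDiff (i.app V.1).hom (Λ₀.bracket V.1)
      (ΛX.bracket (i ⁻¹ᵁ V.1)) (fun a f => bracket_mem_ker hi V.1 a f f.2) (s.1 V) (s.2 V) := rfl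

end Sections

/-! ### Lifts on an open subset, their obstructions and differences -/

section Family

variable {k : Type u} [Field k] {X Y : Scheme.{u}} {π : Y ⟶ Spec (.of k)} {i : X ⟶ Y}
  {Λ₀ : PoissonStructure π} {ΛX : PoissonStructure (i ≫ π)}
  {A : Type u} [CommRing A] [Algebra k A] {ε : A →ₐ[k] k} {t : A}

/-- `t` spans a one-dimensional ideal of a local algebra with nilpotent maximal ideal `ker ε`. -/
structure IsSmall (ε : A →ₐ[k] k) (t : A) : Prop where
  ne_zero : t ≠ 0
  mem : t ∈ RingHom.ker ε
  mul : ∀ a ∈ RingHom.ker ε, a * t = 0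
  nilpotent : IsNilpotent (RingHom.ker ε)

theorem IsSmall.isThickening (h : IsSmall ε t) {W : Y.Opens} (hW : IsAffineOpen W) :
    IsThickening (cst π A W) (pull π A W) (red π ε W) (RingHom.ker ε) t :=
  Thick.isThickening π hW ε h.ne_zero h.mem h.mul

theorem exists_cst_eq_pull {W : Y.Opens} (hW : IsAffineOpen W) (x : k) :
    ∃ a, pull π A W (const π W x) = cst π A W a :=
  let := constAlgebra π W
  ⟨algebraMap k A x, ((Thick.isTensor π hW).const_eq x).symm⟩

/-- A bracket and an ideal in the functions on `W × Spec A`, for each open `W` of `Y`. Only the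
values on affine opens matter. -/
structure PreLift (π : Y ⟶ Spec (.of k)) (A : Type u) [CommRing A] [Algebra k A] where
  br : ∀ W : Y.Opens, Sec π A W → Sec π A W → Sec π A W
  J : ∀ W : Y.Opens, Ideal (Sec π A W)

/-- On `U × Spec A`, `L` is a bracket on the structure sheaf with an ideal sheaf, which form a
deformation modulo `t`. -/
structure IsLift (Λ₀ : PoissonStructure π) (i : X ⟶ Y) (ε : A →ₐ[k] k) (t : A) (L : PreLift π A)
    (U : Y.Opens) : Prop where
  modT : ∀ W, IsAffineOpen W → W ≤ U → IsPoissonModT (cst π A W) (pull π A W) (red π ε W)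
    (RingHom.ker ε) t (i.app W).hom (Λ₀.bracket W) (L.br W) (L.J W)
  br_res : ∀ V W, IsAffineOpen V → IsAffineOpen W → V ≤ U → ∀ (h : W ≤ V) x y,
    tres π h (L.br V x y) = L.br W (tres π h x) (tres π h y)
  J_res : ∀ V W, IsAffineOpen V → IsAffineOpen W → V ≤ U → ∀ (h : W ≤ V), ∀ x ∈ L.J V,
    tres π h x ∈ L.J W

theorem IsLift.mono {L : PreLift π A} {U U' : Y.Opens} (h : IsLift Λ₀ i ε t L U) (hU : U' ≤ U) :
    IsLift Λ₀ i ε t L U' :=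
  ⟨fun W hW hWU => h.modT W hW (hWU.trans hU),
    fun V W hV hW hVU => h.br_res V W hV hW (hVU.trans hU),
    fun V W hV hW hVU => h.J_res V W hV hW (hVU.trans hU)⟩

/-- The section `s` of the complex over `U` is the obstruction of `L` to being a deformation. -/
structure IsObs (ε : A →ₐ[k] k) (t : A) (L : PreLift π A) (U : Y.Opens) (s : PairFamily i U 1) :
    Prop where
  mem : s ∈ complexSections π i U 1
  at_affine : ∀ W, IsAffineOpen W → ∀ hW : W ≤ U, IsObstructionAt (cst π A W) (pull π A W)
    (red π ε W) t (i.app W).hom (L.br W) (L.J W) (s.1 ⟨W, hW⟩) (s.2 ⟨W, hW⟩)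

/-- `L` and `L'` agree modulo `t` on the affine opens contained in `U`. -/
structure IsCong (t : A) (L L' : PreLift π A) (U : Y.Opens) : Prop where
  left : ∀ W, IsAffineOpen W → W ≤ U →
    IsCongruentAt (cst π A W) (pull π A W) t (L.br W) (L.J W) (L'.br W) (L'.J W)
  right : ∀ W, IsAffineOpen W → W ≤ U →
    IsCongruentAt (cst π A W) (pull π A W) t (L'.br W) (L'.J W) (L.br W) (L.J W)

theorem IsCong.symm {L L' : PreLift π A} {U : Y.Opens} (h : IsCong t L L' U) :
    IsCong t L' L U := ⟨h.right, h.left⟩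

theorem IsCong.trans {L L' L'' : PreLift π A} {U : Y.Opens} (h : IsCong t L L' U)
    (h' : IsCong t L' L'' U) : IsCong t L L'' U :=
  ⟨fun W hW hU => (h.left W hW hU).trans (h'.left W hW hU),
    fun W hW hU => (h'.right W hW hU).trans (h.right W hW hU)⟩

theorem IsCong.mono {L L' : PreLift π A} {U U' : Y.Opens} (h : IsCong t L L' U) (hU : U' ≤ U) :
    IsCong t L L' U' :=
  ⟨fun W hW hWU => h.left W hW (hWU.trans hU), fun W hW hWU => h.right W hW (hWU.trans hU)⟩

/-- The section `s` of the complex over `U` is the difference of two lifts that agree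
modulo `t`. -/
structure IsDiff (ε : A →ₐ[k] k) (t : A) (L L' : PreLift π A) (U : Y.Opens)
    (s : PairFamily i U 0) : Prop where
  mem : s ∈ complexSections π i U 0
  at_affine : ∀ W, IsAffineOpen W → ∀ hW : W ≤ U, IsDifferenceAt (cst π A W) (pull π A W)
    (red π ε W) t (i.app W).hom (L.br W) (L.J W) (L'.br W) (L'.J W) (s.1 ⟨W, hW⟩) (s.2 ⟨W, hW⟩)

theorem IsObs.restrict {L : PreLift π A} {U U' : Y.Opens} {s : PairFamily i U 1}
    (h : IsObs ε t L U s) (hU : U' ≤ U) : IsObs ε t L U' (restrictPair i 1 hU s) :=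
  ⟨restrictPair_mem hU h.mem, fun W hW hWU => h.at_affine W hW (hWU.trans hU)⟩

theorem IsDiff.restrict {L L' : PreLift π A} {U U' : Y.Opens} {s : PairFamily i U 0}
    (h : IsDiff ε t L L' U s) (hU : U' ≤ U) : IsDiff ε t L L' U' (restrictPair i 0 hU s) :=
  ⟨restrictPair_mem hU h.mem, fun W hW hWU => h.at_affine W hW (hWU.trans hU)⟩

variable (ht : IsSmall ε t) {U : Y.Opens} {L L' L'' : PreLift π A}
  (hL : IsLift Λ₀ i ε t L U) (hL' : IsLift Λ₀ i ε t L' U) (hc : IsCong t L L' U)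
include ht hL

/-- The obstructions on the affine opens are unique, hence compatible with restriction, and form a
section of the complex. -/
theorem IsLift.exists_isObs : ∃ s : PairFamily i U 1, IsObs ε t L U s := by
  have ho := fun W hW hWU => (hL.modT W hW hWU).exists_obstructionAt (ht.isThickening hW)
  choose T Φ ho using ho
  obtain ⟨P, hP, hPD⟩ := exists_isPolyvector (π := π) U T
    (fun W hW hWU => (ho W hW hWU).isPolyderivation (ht.isThickening hW) (hL.modT W hW hWU)
      (exists_cst_eq_pull hW)) (fun V W hV hVU hW h v => by
      have e1 := (ho V hV hVU).jacobi (v 0) (v 1) (v 2)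
      have e2 := (ho W hW (h.trans hVU)).jacobi (res h (v 0)) (res h (v 1)) (res h (v 2))
      have e3 : tres π h (jacobiSum (L.br V) (pull π A V (v 0)) (pull π A V (v 1))
          (pull π A V (v 2))) = jacobiSum (L.br W) (pull π A W (res h (v 0)))
          (pull π A W (res h (v 1))) (pull π A W (res h (v 2))) := by
        simp only [jacobiSum, map_add, hL.br_res V W hV hW hVU h, tres_pull]
      have e4 : ∀ {B : Type u} (w : Fin 3 → B), w = ![w 0, w 1, w 2] := fun w => by
        funext l; fin_cases l <;> rfl
      rw [e4 v, e4 fun l => res h _]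
      apply (ht.isThickening (π := π) hW).t_cancel
      refine Eq.trans ?_ e2
      rw [← e3, ← map_neg, e1, map_mul, tres_cst, tres_pull])
  obtain ⟨Q, hQ, hQD⟩ := exists_isNormalSection (π := π) (i := i) U Φ
    (fun W hW hWU => (ho W hW hWU).isNormalAt (ht.isThickening hW) (hL.modT W hW hWU)
      (exists_cst_eq_pull hW)) (fun V W hV hVU hW h f v => by
      obtain ⟨x, hx, hxf⟩ := (hL.modT V hV hVU).flat.exists_lift f f.2
      obtain ⟨g, hg⟩ := (hL.modT V hV hVU).poisson x hx (pull π A V (v 0))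
      have e1 := (ho V hV hVU).ham x hx f hxf.symm (v 0) g hg
      have e2 := (ho W hW (h.trans hVU)).ham (tres π h x) (hL.J_res V W hV hW hVU h x hx)
        (kres i h f) (by rw [red_res, hxf]; rfl) (res h (v 0)) (res h g) (by
          have := hL.J_res V W hV hW hVU h _ hg
          rwa [map_sub, hL.br_res V W hV hW hVU h, map_mul, tres_cst, tres_pull, tres_pull] at this)
      have e4 : ∀ {B : Type u} (w : Fin 1 → B), w = ![w 0] := fun w => by
        funext l; fin_cases l; rfl
      rw [e4 v, e4 fun l => res h _, e1, map_neg, ← app_res]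
      exact e2.symm)
  exact ⟨(P, Q), ⟨hP, hQ⟩, fun W hW hWU => by
    have := ho W hW hWU
    rw [← hPD W hW hWU, ← hQD W hW hWU] at this
    exact this⟩

/-- The obstruction of a lift is closed. -/
theorem IsObs.differential_eq_zero (hi : IsPoissonHom i ΛX Λ₀) {s : PairFamily i U 1}
    (h : IsObs ε t L U s) : differential hi U 1 s = 0 := by
  refine pair_ext (differential_polyCompat hi h.mem) (fun _ _ _ _ _ => map_zero _)
    (differential_normalCompat hi h.mem) (fun _ _ _ _ _ _ _ _ => map_zero _) fun W hW hWU =>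
      ⟨?_, ?_⟩
  · funext v
    exact (h.at_affine W hW hWU).ceDiff_eq_zero (ht.isThickening hW) (hL.modT W hW hWU) v
  · rw [differential_snd]
    funext f v
    exact (h.at_affine W hW hWU).normalDiff_eq_zero _ (fun a b => (hi W a b).symm)
      (Λ₀.isBiderivation W) (ht.isThickening hW) (hL.modT W hW hWU) f v

include hL' hc

/-- Two lifts that agree modulo `t` have a difference, by the uniqueness of the differences on the
affine opens. -/
theorem IsLift.exists_isDiff : ∃ s : PairFamily i U 0, IsDiff ε t L L' U s := by
  have hd := fun W hW hWU => (hL.modT W hW hWU).exists_differenceAt (ht.isThickening hW)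
    (hL'.modT W hW hWU) (hc.left W hW hWU)
  choose T Φ hd using hd
  obtain ⟨P, hP, hPD⟩ := exists_isPolyvector (π := π) U T
    (fun W hW hWU => (hd W hW hWU).isPolyderivation (ht.isThickening hW) (hL.modT W hW hWU)
      (hL'.modT W hW hWU) (exists_cst_eq_pull hW)) (fun V W hV hVU hW h v => by
      have e1 := (hd V hV hVU).bivector (v 0) (v 1)
      have e2 := (hd W hW (h.trans hVU)).bivector (res h (v 0)) (res h (v 1))
      have e4 : ∀ {B : Type u} (w : Fin 2 → B), w = ![w 0, w 1] := fun w => by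
        funext l; fin_cases l <;> rfl
      rw [e4 v, e4 fun l => res h _]
      apply (ht.isThickening (π := π) hW).t_cancel
      refine neg_injective (Eq.trans ?_ e2)
      have e3 := congrArg (tres π h) e1
      rw [map_sub, hL.br_res V W hV hW hVU h, hL'.br_res V W hV hW hVU h, map_neg, map_mul,
        tres_cst, tres_pull, tres_pull, tres_pull] at e3
      exact e3.symm)
  obtain ⟨Q, hQ, hQD⟩ := exists_isNormalSection (π := π) (i := i) U Φ
    (fun W hW hWU => (hd W hW hWU).isNormalAt (ht.isThickening hW) (hL.modT W hW hWU)
      (hc.left W hW hWU)) (fun V W hV hVU hW h f v => by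
      obtain ⟨x, hx, hxf⟩ := (hL.modT V hV hVU).flat.exists_lift f f.2
      obtain ⟨g, hg⟩ := (hc.left V hV hVU).ideal x hx
      have e1 := (hd V hV hVU).normal x hx f hxf.symm g hg
      have e2 := (hd W hW (h.trans hVU)).normal (tres π h x) (hL.J_res V W hV hW hVU h x hx)
        (kres i h f) (by rw [red_res, hxf]; rfl) (res h g) (by
          have := hL'.J_res V W hV hW hVU h _ hg
          rwa [map_sub, map_mul, tres_cst, tres_pull] at this)
      rw [Subsingleton.elim v ![], Subsingleton.elim (fun l => res h _) ![], e1, ← app_res]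
      exact e2.symm)
  exact ⟨(P, Q), ⟨hP, hQ⟩, fun W hW hWU => by
    have := hd W hW hWU
    rw [← hPD W hW hWU, ← hQD W hW hWU] at this
    exact this⟩

omit hL' in
theorem IsDiff.unique {s s' : PairFamily i U 0} (h : IsDiff ε t L L' U s)
    (h' : IsDiff ε t L L' U s') : s = s' :=
  complexSections_ext h.mem h'.mem fun W hW hWU =>
    (h.at_affine W hW hWU).unique (ht.isThickening hW) (hL.modT W hW hWU) (hc.left W hW hWU)
      (h'.at_affine W hW hWU)

/-- The obstructions of two lifts differ by the differential of their difference. -/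
theorem IsDiff.differential_eq (hi : IsPoissonHom i ΛX Λ₀) {s s' : PairFamily i U 1}
    {a : PairFamily i U 0} (hs : IsObs ε t L U s) (hs' : IsObs ε t L' U s')
    (ha : IsDiff ε t L L' U a) : s' - s + differential hi U 0 a = 0 := by
  refine pair_ext (fun V W hV h v => ?_) (fun _ _ _ _ _ => map_zero _)
    (fun V W hV h f f' hf v => ?_) (fun _ _ _ _ _ _ _ _ => map_zero _) fun W hW hWU => ⟨?_, ?_⟩
  · refine (map_add (res h) _ _).trans ?_
    refine congrArg₂ (· + ·) ?_ (differential_polyCompat hi ha.mem V W hV h v)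
    exact (map_sub (res h) _ _).trans (congrArg₂ (· - ·) (hs'.mem.1.restrict V W hV h v)
      (hs.mem.1.restrict V W hV h v))
  · refine (map_add (res (i.preimage_mono h)) _ _).trans ?_
    refine congrArg₂ (· + ·) ?_ (differential_normalCompat hi ha.mem V W hV h f f' hf v)
    exact (map_sub (res _) _ _).trans (congrArg₂ (· - ·) (hs'.mem.2.restrict V W hV h f f' hf v)
      (hs.mem.2.restrict V W hV h f f' hf v))
  · funext v
    exact (ha.at_affine W hW hWU).ceDiff_eq (Λ₀.isBiderivation W) (ht.isThickening hW)
      (hL.modT W hW hWU) (hL'.modT W hW hWU) (hc.left W hW hWU) (hs.at_affine W hW hWU)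
      (hs'.at_affine W hW hWU) (ha.mem.1.polyderivation W hWU) v
  · funext f v
    exact (ha.at_affine W hW hWU).normalDiff_eq (fun a f => bracket_mem_ker hi W a f f.2)
      (fun a b => (hi W a b).symm)
      (Λ₀.isBiderivation W) (ht.isThickening hW) (hL.modT W hW hWU) (hL'.modT W hW hWU)
      (hc.left W hW hWU) (hs.at_affine W hW hWU) (hs'.at_affine W hW hWU) f v

/-- Lifts with difference zero are equal. -/
theorem IsDiff.eq_of_zero (h : IsDiff ε t L L' U (0 : PairFamily i U 0)) {W : Y.Opens}
    (hW : IsAffineOpen W) (hWU : W ≤ U) : L.br W = L'.br W ∧ L.J W = L'.J W :=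
  ⟨(h.at_affine W hW hWU).bracket_eq_of_zero (ht.isThickening hW) (hL.modT W hW hWU)
      (hL'.modT W hW hWU) (hc.left W hW hWU),
    (h.at_affine W hW hWU).ideal_eq_of_zero (ht.isThickening hW) (hL.modT W hW hWU)
      (hL'.modT W hW hWU) (hc.left W hW hWU) (hc.right W hW hWU)⟩

omit hL hL' in
theorem IsDiff.add (hc' : IsCong t L' L'' U) (hL'' : IsLift Λ₀ i ε t L'' U)
    {a a' : PairFamily i U 0} (h : IsDiff ε t L L' U a) (h' : IsDiff ε t L' L'' U a') :
    IsDiff ε t L L'' U (a + a') :=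
  ⟨add_mem h.mem h'.mem, fun W hW hWU => (h.at_affine W hW hWU).add (hc.left W hW hWU)
    (hc'.left W hW hWU) (ht.isThickening hW) (hL''.modT W hW hWU) (h'.at_affine W hW hWU)⟩

omit hL' hc ht in
theorem IsLift.isDiff_refl : IsDiff ε t L L U (0 : PairFamily i U 0) :=
  ⟨zero_mem _, fun W hW hWU => IsDifferenceAt.refl (hL.modT W hW hWU)⟩

omit hL' hc in
/-- A lift can be changed by any section of the complex in degree zero. -/
theorem IsLift.exists_twist [IsClosedImmersion i] {a : PairFamily i U 0}
    (ha : a ∈ complexSections π i U 0) :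
    ∃ L' : PreLift π A, IsLift Λ₀ i ε t L' U ∧ IsCong t L L' U ∧ IsDiff ε t L L' U a := by
  have hN : ∀ W (hWU : W ≤ U), IsNormalAt (i.app W).hom (const π W) (a.2 ⟨W, hWU⟩) :=
    fun W hWU => ⟨ha.2.polyderivation W hWU, ha.2.map_add W hWU, ha.2.map_smul W hWU⟩
  have hex : ∀ W, ∃ q : (Sec π A W → Sec π A W → Sec π A W) × Ideal (Sec π A W),
      ∀ (hW : IsAffineOpen W) (hWU : W ≤ U),
        q.1 = twistBracket (cst π A W) (pull π A W) (red π ε W) t (L.br W) (a.1 ⟨W, hWU⟩) ∧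
        q.2 = twistIdeal (cst π A W) (pull π A W) (red π ε W) t (i.app W).hom
          (ht.isThickening hW) (const π W) (L.J W) (a.2 ⟨W, hWU⟩) (hN W hWU) := by
    intro W
    by_cases h : IsAffineOpen W ∧ W ≤ U
    · exact ⟨(twistBracket (cst π A W) (pull π A W) (red π ε W) t (L.br W) (a.1 ⟨W, h.2⟩),
        twistIdeal (cst π A W) (pull π A W) (red π ε W) t (i.app W).hom
          (ht.isThickening h.1) (const π W) (L.J W) (a.2 ⟨W, h.2⟩) (hN W h.2)),
        fun hW hWU => ⟨rfl, rfl⟩⟩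
    · exact ⟨(L.br W, L.J W), fun hW hWU => absurd ⟨hW, hWU⟩ h⟩
  choose q hq using hex
  have hbr : ∀ W, IsAffineOpen W → ∀ (hWU : W ≤ U), (q W).1 = _ := fun W hW hWU => (hq W hW hWU).1
  have hJ := fun W hW hWU => (hq W hW hWU).2
  have hr : ∀ W x, ∃ y, red π ε W (cst π A W x) = const π W y := fun W x => ⟨_, red_cst π ε W x⟩
  have hρ : ∀ W, IsAffineOpen W → Function.Surjective (i.app W).hom :=
    fun W hW => Scheme.Hom.app_surjective i W hW
  refine ⟨⟨fun W => (q W).1, fun W => (q W).2⟩, ⟨fun W hW hWU => ?_, fun V W hV hW hVU h x y => ?_,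
    fun V W hV hW hVU h x hx => ?_⟩, ⟨fun W hW hWU => ?_, fun W hW hWU => ?_⟩, ha,
    fun W hW hWU => ?_⟩
  · dsimp only
    rw [hbr W hW hWU, hJ W hW hWU]
    exact (hL.modT W hW hWU).twist (ht.isThickening hW) (hr W) (ha.1.polyderivation W hWU) _
      (hρ W hW)
  · dsimp only
    rw [hbr V hV hVU, hbr W hW (h.trans hVU)]
    simp only [twistBracket, map_add, map_mul, tres_cst, tres_pull, hL.br_res V W hV hW hVU h,
      red_res]
    rw [ha.1.restrict V W hVU h]
    congr 4
    refine congrArg (a.1 ⟨W, h.trans hVU⟩) ?_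
    funext l
    fin_cases l <;> rfl
  · dsimp only at hx ⊢
    rw [hJ V hV hVU] at hx
    rw [hJ W hW (h.trans hVU)]
    obtain ⟨y, hy, f, hf, g, hg, rfl⟩ := hx
    refine ⟨tres π h y, hL.J_res V W hV hW hVU h y hy, kres i h f, ?_, res h g, ?_, ?_⟩
    · rw [red_res, ← hf]; rfl
    · have := ha.2.restrict V W hVU h f (kres i h f) rfl ![]
      rw [hg, ← app_res i h] at this
      rw [this, Subsingleton.elim (fun l => res h _) ![]]
    · rw [map_sub, map_mul, tres_cst, tres_pull]
  · dsimp only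
    rw [hbr W hW hWU, hJ W hW hWU]
    exact isCongruentAt_twist (ht.isThickening hW) _ (hL.modT W hW hWU).flat (hρ W hW)
  · dsimp only
    rw [hbr W hW hWU, hJ W hW hWU]
    exact isCongruentAt_twist_symm (ht.isThickening hW) _
  · dsimp only
    rw [hbr W hW hWU, hJ W hW hWU]
    exact isDifferenceAt_twist (ht.isThickening hW) (hL.modT W hW hWU) _

end Family

/-! ### Deformations as lifts without obstruction -/

section IdealSheaf

/-- The push-forward to `Z` of the ideal sheaf of an ideal of functions on an affine open `V`. -/
theorem exists_idealSheafData {Z : Scheme.{u}} {V : Z.Opens} [QuasiCompact V.ι]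
    (J : Ideal Γ(Z, V)) : ∃ I : Z.IdealSheafData,
      ∀ W (hW : IsAffineOpen W), IsAffineOpen (W ⊓ V) → I.ideal ⟨W, hW⟩ =
        (J.map (res inf_le_right)).comap (res (inf_le_left : W ⊓ V ≤ W)) := by
  let J' : Ideal Γ(V, ⊤) := J.map V.topIso.inv.hom
  refine ⟨(Scheme.IdealSheafData.ofIdealTop J').map V.ι, fun W hW hWV => ?_⟩
  have hE : V.ι ''ᵁ (V.ι ⁻¹ᵁ W) = W ⊓ V := by
    rw [Scheme.Hom.image_preimage_eq_opensRange_inf, Scheme.Opens.opensRange_ι, inf_comm]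
  have hW' : IsAffineOpen (V.ι ⁻¹ᵁ W) := by
    rw [← Scheme.Hom.isAffineOpen_iff_of_isOpenImmersion V.ι, hE]
    exact hWV
  rw [Scheme.IdealSheafData.ideal_map _ _ ⟨W, hW⟩ hW', Scheme.IdealSheafData.ofIdealTop_ideal,
    Ideal.map_map]
  have key : ∀ E (_ : E = W ⊓ V) (h₁ : E ≤ V) (h₂ : E ≤ W),
      (J.map (res h₁)).comap (res h₂) =
        (J.map (res inf_le_right)).comap (res (inf_le_left : W ⊓ V ≤ W)) := by
    rintro E rfl h₁ h₂; rfl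
  rw [← key _ hE (V.ι_image_le _) (hE.le.trans inf_le_left)]
  have e1 : ((V : Scheme).presheaf.map (homOfLE (le_top : V.ι ⁻¹ᵁ W ≤ ⊤)).op).hom.comp
      V.topIso.inv.hom = res (Z := Z) (V.ι_image_le (V.ι ⁻¹ᵁ W)) := by
    change ((Z.presheaf.map _) ≫ (Z.presheaf.map _)).hom = _
    rw [← Z.presheaf.map_comp]; rfl
  rw [← e1]
  rfl

end IdealSheaf

section Globalization

variable {k : Type u} [Field k] {X Y : Scheme.{u}} {π : Y ⟶ Spec (.of k)} {i : X ⟶ Y}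
  {Λ₀ : PoissonStructure π} {ΛX : PoissonStructure (i ≫ π)}
  {A : Type u} [CommRing A] [Algebra k A] {ε : A →ₐ[k] k} {t : A}

theorem res_fibre_app {V : (Thick π A).Opens} {W : Y.Opens} (h : W ≤ Thick.fibre π ε ⁻¹ᵁ V)
    (h' : Thick.proj π A ⁻¹ᵁ W ≤ V) (x : Γ(Thick π A, V)) :
    res h (((Thick.fibre π ε).app V).hom x) = red π ε W (res h' x) :=
  (congrArg (fun g => g.hom x) ((Thick.fibre π ε).map_appLE
    (Thick.fibre_preimage π ε W).ge (homOfLE h').op)).symm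

variable (i) in
theorem map_ker_app [IsClosedImmersion i] {V W : Y.Opens} (hV : IsAffineOpen V)
    (hW : IsAffineOpen W) (h : W ≤ V) :
    (RingHom.ker (i.app V).hom).map (res h) = RingHom.ker (i.app W).hom := by
  rw [← Scheme.Hom.ker_apply i ⟨V, hV⟩, ← Scheme.Hom.ker_apply i ⟨W, hW⟩]
  exact i.ker.map_ideal (U := ⟨W, hW⟩) (V := ⟨V, hV⟩) h

/-- The ideals of a lift form a quasi-coherent sheaf: the ideal of `W` is generated by that of a
larger affine open, since it is so on the closed fibre and `J ∩ m O = m J`. -/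
theorem IsLift.map_J [IsClosedImmersion i] (ht : IsSmall ε t) {L : PreLift π A} {V W : Y.Opens}
    (hL : IsLift Λ₀ i ε t L V) (hV : IsAffineOpen V) (hW : IsAffineOpen W) (h : W ≤ V) :
    (L.J V).map (tres π h) = L.J W := by
  have hw := (hL.modT W hW h).flat
  have hv := (hL.modT V hV le_rfl).flat
  refine span_eq_of_tor (r := red π ε W) (c := cst π A W) ht.nilpotent
    (Ideal.map_le_iff_le_comap.2 (hL.J_res V W hV hW le_rfl h)) (fun x hx => ?_) hw.tor
  have h1 : red π ε W x ∈ RingHom.ker (i.app W).hom := hw.ρ_r x hx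
  have h2 : RingHom.ker (i.app W).hom ≤ ((L.J V).map (tres π h)).map (red π ε W) := by
    rw [← map_ker_app i hV hW h, Ideal.map_le_iff_le_comap]
    intro f hf
    obtain ⟨y, hy, rfl⟩ := hv.exists_lift f hf
    rw [Ideal.mem_comap, ← red_res]
    exact Ideal.mem_map_of_mem _ (Ideal.mem_map_of_mem _ hy)
  exact (mem_map_red_iff ε).1 (h2 h1)

/-- The bracket and the ideals of a deformation. -/
def Deformation.preLift (η : Deformation i Λ₀ ε) : PreLift π A where
  br W := η.Λ.bracket (Thick.proj π A ⁻¹ᵁ W)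
  J W := secIdeal η.ideal W

theorem Deformation.red_bracket (η : Deformation i Λ₀ ε) (W : Y.Opens) (x y : Sec π A W) :
    red π ε W (η.Λ.bracket _ x y) = Λ₀.bracket W (red π ε W x) (red π ε W y) := by
  have h := η.induces_poisson (Thick.proj π A ⁻¹ᵁ W) x y
  have h2 := congrArg (res (Thick.fibre_preimage π ε W).ge) h
  rw [Λ₀.restrict] at h2
  exact h2

theorem Deformation.isFlat (η : Deformation i Λ₀ ε) {W : Y.Opens} (hW : IsAffineOpen W) :
    RingHom.Flat ((Ideal.Quotient.mk (secIdeal η.ideal W)).comp (cst π A W)) := by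
  have := η.flat
  refine (flat_appLE_subschemeι_iff (Thick.str π A) η.ideal (isAffineOpen_proj π hW)).1 ?_
  exact Flat.flat_appLE _ (isAffineOpen_top _) ((isAffineOpen_proj π hW).preimage _) _

theorem Deformation.ker_eq [IsClosedImmersion i] (η : Deformation i Λ₀ ε) {W : Y.Opens}
    (hW : IsAffineOpen W) : RingHom.ker (i.app W).hom = (secIdeal η.ideal W).map (red π ε W) :=
  (inducesSubscheme_fibre_iff ε η.ideal (fun _ => True) fun y => by
    obtain ⟨W, hW, -, hy⟩ := exists_affine_le (T := Y) (V := ⊤) (x := y) trivial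
    exact ⟨W, hW, trivial, hy⟩).1 η.induces_subscheme W hW trivial

theorem Deformation.tor (η : Deformation i Λ₀ ε) {W : Y.Opens} (hW : IsAffineOpen W)
    {x : Sec π A W} (hx : x ∈ secIdeal η.ideal W) (hr : red π ε W x = 0) :
    x ∈ (RingHom.ker ε).map (cst π A W) * secIdeal η.ideal W :=
  mem_map_mul_of_flat (η.isFlat hW) hx (mem_map_of_red_eq_zero π hW ε hr)

/-- A deformation is a lift; flatness gives `J ∩ m O = m J`. -/
theorem Deformation.isLift [IsClosedImmersion i] (ht : IsSmall ε t) (η : Deformation i Λ₀ ε) :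
    IsLift Λ₀ i ε t η.preLift ⊤ where
  modT W hW _ := by
    let := constAlgebra π W
    refine ⟨η.Λ.isBiderivation _, η.red_bracket W, ?_, fun u v w => ⟨0, ?_⟩, fun x hx u => ⟨0, ?_⟩⟩
    · have hk := η.ker_eq hW
      refine (Thick.isTensor π hW).isFlatIdeal ε ht.nilpotent (red_cst π ε W)
        (ht.isThickening hW) ht.ne_zero (fun x hx => ?_) (fun f hf => ?_) fun x => η.tor hW
      · have : red π ε W x ∈ RingHom.ker (i.app W).hom := by
          rw [hk]; exact Ideal.mem_map_of_mem _ hx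
        exact this
      · have : f ∈ RingHom.ker (i.app W).hom := hf
        rw [hk] at this
        exact (mem_map_red_iff ε).1 this
    · rw [map_zero, mul_zero]
      exact η.Λ.jacobi _ u v w
    · rw [map_zero, mul_zero, sub_zero]
      exact η.isPoisson _ x u hx
  br_res V W _ _ _ h x y := η.Λ.restrict _ _ _ x y
  J_res V W _ _ _ h x hx := tres_mem_secIdeal _ h hx

theorem IsLift.isObs_zero {L : PreLift π A} {U : Y.Opens}
    (hL : IsLift Λ₀ i ε t L U)
    (hjac : ∀ W, IsAffineOpen W → W ≤ U → ∀ u v w, jacobiSum (L.br W) u v w = 0)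
    (hpois : ∀ W, IsAffineOpen W → W ≤ U → ∀ x ∈ L.J W, ∀ u, L.br W x u ∈ L.J W) :
    IsObs ε t L U (0 : PairFamily i U 1) :=
  ⟨zero_mem _, fun W hW hWU => ⟨fun a b d => by
    rw [hjac W hW hWU, neg_zero]
    exact (by rw [map_zero, mul_zero] : (0 : Sec π A W) = cst π A W t * pull π A W 0),
    fun x hx f _ b g hg => by
      have h1 := (L.J W).sub_mem (hpois W hW hWU x hx (pull π A W b)) hg
      rw [sub_sub_cancel] at h1
      rw [(hL.modT W hW hWU).flat.t_mul_mem g h1, neg_zero]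
      rfl⟩⟩

/-- If the obstruction of a lift vanishes, then its bracket satisfies the Jacobi identity. -/
theorem IsObs.jacobi_of_zero (ht : IsSmall ε t) {L : PreLift π A} {U : Y.Opens}
    (hL : IsLift Λ₀ i ε t L U) (h : IsObs ε t L U (0 : PairFamily i U 1)) {W : Y.Opens}
    (hW : IsAffineOpen W) (hWU : W ≤ U) (u v w : Sec π A W) : jacobiSum (L.br W) u v w = 0 := by
  have h1 := (h.at_affine W hW hWU).jacobi (red π ε W u) (red π ε W v) (red π ε W w)
  have h2 : cst π A W t * pull π A W ((0 : PairFamily i U 1).1 ⟨W, hWU⟩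
      ![red π ε W u, red π ε W v, red π ε W w]) = 0 := by
    refine Eq.trans (congrArg _ (map_zero _)) (mul_zero _)
  rw [h2, neg_eq_zero] at h1
  rw [← h1]
  exact (hL.modT W hW hWU).jacobi_congr₃ (ht.isThickening hW) (red_pull π ε W _).symm
    (red_pull π ε W _).symm (red_pull π ε W _).symm

/-- If the obstruction of a lift vanishes, then its ideal is a Poisson ideal. -/
theorem IsObs.poisson_of_zero (ht : IsSmall ε t) {L : PreLift π A} {U : Y.Opens}
    (hL : IsLift Λ₀ i ε t L U) (h : IsObs ε t L U (0 : PairFamily i U 1)) {W : Y.Opens}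
    (hW : IsAffineOpen W) (hWU : W ≤ U) {x : Sec π A W} (hx : x ∈ L.J W) (u : Sec π A W) :
    L.br W x u ∈ L.J W := by
  have hm := hL.modT W hW hWU
  obtain ⟨g, hg⟩ := hm.poisson x hx (pull π A W (red π ε W u))
  have h1 := (h.at_affine W hW hWU).ham x hx ⟨red π ε W x, hm.flat.ρ_r x hx⟩ rfl _ g hg
  have h2 : (i.app W).hom g = 0 := neg_eq_zero.1 (h1.symm.trans rfl)
  have h3 := (hm.flat.t_mul_mem_iff (ht.isThickening hW)).2 h2
  have h4 := (L.J W).add_mem hg h3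
  rw [sub_add_cancel] at h4
  have h5 := hm.br_sub_mem (ht.isThickening hW) hx (red_pull π ε W (red π ε W u)) (w := 0)
    (by rwa [sub_zero])
  rwa [sub_zero] at h5

theorem Deformation.isObs [IsClosedImmersion i] (ht : IsSmall ε t) (η : Deformation i Λ₀ ε) :
    IsObs ε t η.preLift ⊤ (0 : PairFamily i ⊤ 1) :=
  (η.isLift ht).isObs_zero (fun _ _ _ => η.Λ.jacobi _) fun _ _ _ x hx u => η.isPoisson _ x u hx

end Globalization

/-! ### Gluing of ideals -/

section IdealGluing

variable {k : Type u} [Field k] {X Y : Scheme.{u}} {π : Y ⟶ Spec (.of k)} {i : X ⟶ Y}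
  {A : Type u} [CommRing A] [Algebra k A]

theorem isAffineOpen_inf (π : Y ⟶ Spec (.of k)) [IsSeparated π] {V W : Y.Opens}
    (hV : IsAffineOpen V) (hW : IsAffineOpen W) : IsAffineOpen (V ⊓ W) :=
  isAffineHom_diagonal_iff.1 (inferInstance : IsAffineHom (Limits.pullback.diagonal π)) ⊤
    (isAffineOpen_top _) V le_top W le_top hV hW

theorem quasiCompact_ι_of_isAffineOpen [IsSeparated π] {V : (Thick π A).Opens}
    (hV : IsAffineOpen V) : QuasiCompact V.ι := by
  have : IsAffine V := hV
  have : IsAffineHom V.ι := IsAffineHom.of_comp V.ι (Thick.str π A)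
  infer_instance

/-- The ideal of a closed subscheme can be computed locally. -/
theorem mem_secIdeal_of_locally {ι : Type*} (I : (Thick π A).IdealSheafData) {W : Y.Opens}
    (P : ι → Y.Opens) (hcov : ∀ y ∈ W, ∃ j, y ∈ P j) {x : Sec π A W}
    (h : ∀ j, tres π (inf_le_left : W ⊓ P j ≤ W) x ∈ secIdeal I (W ⊓ P j)) : x ∈ secIdeal I W := by
  change (I.subschemeι.app _).hom x = 0
  refine eq_of_res_eq (fun j => I.subschemeι ⁻¹ᵁ Thick.proj π A ⁻¹ᵁ (W ⊓ P j)) (fun z hz => ?_)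
    fun j hj => ?_
  · obtain ⟨j, hj⟩ := hcov _ hz
    exact ⟨j, I.subschemeι.preimage_mono ((Thick.proj π A).preimage_mono inf_le_left), hz, hj⟩
  · have := h j
    change (I.subschemeι.app _).hom _ = 0 at this
    rw [app_res] at this
    exact this.trans (map_zero _).symm

/-- Ideals on the small affine opens (those with `S W`), compatible with restriction, are those of
one ideal sheaf: the intersection of the push-forwards of the ideals of finitely many members of an
affine cover. -/
theorem exists_ideal_of_forall_map [IsSeparated π] [QuasiCompact π]
    (J : ∀ W : Y.Opens, Ideal (Sec π A W)) (S : Y.Opens → Prop)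
    (hcov : ∀ y, ∃ W, IsAffineOpen W ∧ S W ∧ y ∈ W)
    (hJ : ∀ V W, IsAffineOpen V → IsAffineOpen W → S V → ∀ h : W ≤ V,
      (J V).map (tres π h) = J W) :
    ∃ I : (Thick π A).IdealSheafData, ∀ W, IsAffineOpen W → S W → secIdeal I W = J W := by
  have : CompactSpace Y := QuasiCompact.compactSpace_of_compactSpace π
  choose V hV hSV hyV using hcov
  obtain ⟨s, hs⟩ := CompactSpace.elim_nhds_subcover (fun y => (V y : Set Y))
    fun y => (V y).isOpen.mem_nhds (hyV y)
  have hs' : ∀ y, ∃ z : s, y ∈ V z := fun y => by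
    have : y ∈ ⋃ x ∈ s, (V x : Set Y) := hs ▸ trivial
    simp only [Set.mem_iUnion] at this
    obtain ⟨z, hz, hy⟩ := this
    exact ⟨⟨z, hz⟩, hy⟩
  have hex : ∀ U : Y.Opens, IsAffineOpen U → S U → ∃ I : (Thick π A).IdealSheafData,
      ∀ W, IsAffineOpen W → secIdeal I W = (J (W ⊓ U)).comap (tres π inf_le_left) := by
    intro U hU hSU
    have := quasiCompact_ι_of_isAffineOpen (isAffineOpen_proj (A := A) π hU)
    obtain ⟨I, hI⟩ := exists_idealSheafData (J U)
    refine ⟨I, fun W hW => ?_⟩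
    rw [secIdeal_eq I hW, hI _ (isAffineOpen_proj π hW)
      (isAffineOpen_proj (A := A) π (isAffineOpen_inf π hW hU)),
      ← hJ U (W ⊓ U) hU (isAffineOpen_inf π hW hU) hSU inf_le_right]
    rfl
  choose I hI using fun z : s => hex (V z) (hV z) (hSV z)
  refine ⟨⨅ z, I z, fun W hW hSW => ?_⟩
  have hmem : ∀ x : Sec π A W, x ∈ secIdeal (⨅ z, I z) W ↔
      ∀ z : s, tres π (inf_le_left : W ⊓ V z ≤ W) x ∈ J (W ⊓ V z) := fun x => by
    have h1 : ∀ z : s, x ∈ (I z).ideal ⟨_, isAffineOpen_proj π hW⟩ ↔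
        tres π (inf_le_left : W ⊓ V z ≤ W) x ∈ J (W ⊓ V z) := fun z => by
      rw [← secIdeal_eq (I z) hW, hI z W hW]; rfl
    rw [secIdeal_eq _ hW, Scheme.IdealSheafData.ideal_iInf, iInf_apply, Ideal.mem_iInf]
    exact forall_congr' h1
  have hW' : ∀ z : s, IsAffineOpen (W ⊓ V z) := fun z => isAffineOpen_inf π hW (hV z)
  -- `J` is an ideal sheaf `I₀` near `W`, so membership in `J W` can be checked on the cover.
  obtain ⟨I₀, hI₀⟩ := hex W hW hSW
  have hI₀' : ∀ U (h : U ≤ W), IsAffineOpen U → secIdeal I₀ U = J U := by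
    intro U h hU
    rw [hI₀ U hU]
    have key : ∀ E (_ : E = U) (h₁ : E ≤ U), (J E).comap (tres π h₁) = J U := by
      rintro E rfl h₁
      ext x
      rw [Ideal.mem_comap, res_self]
    exact key _ (inf_eq_left.2 h) _
  ext x
  rw [hmem, ← hI₀' W le_rfl hW]
  constructor
  · intro h
    refine mem_secIdeal_of_locally I₀ (fun z : s => V z) (fun y _ => hs' y) fun z => ?_
    rw [hI₀' _ inf_le_left (hW' z)]
    exact h z
  · intro h z
    rw [← hI₀' _ inf_le_left (hW' z)]
    exact tres_mem_secIdeal I₀ inf_le_left h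

end IdealGluing

/-! ### Gluing of brackets and deformations -/

section BracketGluing

variable {k : Type u} [Field k] {X Y : Scheme.{u}} {π : Y ⟶ Spec (.of k)} {i : X ⟶ Y}
  {Λ₀ : PoissonStructure π} {A : Type u} [CommRing A] [Algebra k A] [IsLocalRing A]
  [IsArtinianRing A] {ε : A →ₐ[k] k} {t : A} {S : Y.Opens → Prop}

/-- The open `V` of `Y × Spec A` is covered by the products `W × Spec A` with `S W`. In the gluing
lemmas the predicate `S` singles out the small opens: those contained in a member of a cover. -/
def IsCoveredBy (S : Y.Opens → Prop) (V : (Thick π A).Opens) : Prop :=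
  ∀ z ∈ V, ∃ W, S W ∧ z ∈ Thick.proj π A ⁻¹ᵁ W

theorem IsCoveredBy.exists_affine (ε : A →ₐ[k] k) {V : (Thick π A).Opens} (h : IsCoveredBy S V)
    (hS : ∀ V W, W ≤ V → S V → S W) {z : Thick π A} (hz : z ∈ V) :
    ∃ W : {W : Y.affineOpens // S W}, Thick.proj π A ⁻¹ᵁ (W.1 : Y.Opens) ≤ V ∧
      z ∈ Thick.proj π A ⁻¹ᵁ (W.1 : Y.Opens) := by
  obtain ⟨W, hW, hzW⟩ := h z hz
  rw [← Thick.preimage_fibre_preimage π ε V] at hz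
  obtain ⟨W', hW', hle, hz'⟩ := exists_affine_le (V := W ⊓ Thick.fibre π ε ⁻¹ᵁ V)
    (x := Thick.proj π A z) ⟨hzW, hz⟩
  refine ⟨⟨⟨W', hW'⟩, hS W W' (hle.trans inf_le_left) hW⟩, ?_, hz'⟩
  exact ((Thick.proj π A).preimage_mono (hle.trans inf_le_right)).trans
    (Thick.preimage_fibre_preimage π ε V).le

theorem IsCoveredBy.eq_of_res_eq (ε : A →ₐ[k] k) {V : (Thick π A).Opens} (h : IsCoveredBy S V)
    (hS : ∀ V W, W ≤ V → S V → S W) {x y : Γ(Thick π A, V)}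
    (H : ∀ W, IsAffineOpen W → S W → ∀ hW : Thick.proj π A ⁻¹ᵁ W ≤ V, res hW x = res hW y) :
    x = y :=
  PoissonDef.eq_of_res_eq
    (fun W : {W : Y.affineOpens // S W} => Thick.proj π A ⁻¹ᵁ (W.1 : Y.Opens))
    (fun _ hz => h.exists_affine ε hS hz) fun W => H W.1 W.1.2 W.2

/-- Brackets on the products `W × Spec A` with `W` affine and small, compatible with restriction,
glue. -/
theorem exists_bracket_glue (ε : A →ₐ[k] k) (hS : ∀ V W, W ≤ V → S V → S W)
    (br : ∀ W : Y.Opens, Sec π A W → Sec π A W → Sec π A W)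
    (hbr : ∀ V W, IsAffineOpen V → IsAffineOpen W → S V → ∀ (h : W ≤ V) x y,
      tres π h (br V x y) = br W (tres π h x) (tres π h y)) :
    ∃ B : ∀ V : (Thick π A).Opens, Γ(Thick π A, V) → Γ(Thick π A, V) → Γ(Thick π A, V),
      ∀ V, IsCoveredBy S V → ∀ x y W, IsAffineOpen W → S W →
        ∀ hW : Thick.proj π A ⁻¹ᵁ W ≤ V, res hW (B V x y) = br W (res hW x) (res hW y) := by
  have key : ∀ (V : (Thick π A).Opens) (x y : Γ(Thick π A, V)), ∃ b : Γ(Thick π A, V),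
      IsCoveredBy S V → ∀ W, IsAffineOpen W → S W →
        ∀ hW : Thick.proj π A ⁻¹ᵁ W ≤ V, res hW b = br W (res hW x) (res hW y) := by
    intro V x y
    by_cases hV : IsCoveredBy S V
    · obtain ⟨b, hb, -⟩ := existsUnique_glue
        (fun W : {W : Y.affineOpens // S W} => Thick.proj π A ⁻¹ᵁ (W.1 : Y.Opens))
        (fun _ _ h => (Thick.proj π A).preimage_mono h) V
        (fun _ hz => hV.exists_affine ε hS hz)
        (fun W₁ W₂ z h₁ h₂ => by
          obtain ⟨W, hW, hle, hz⟩ := exists_affine_le (V := (W₁.1 : Y.Opens) ⊓ W₂.1)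
            (x := Thick.proj π A z) ⟨h₁, h₂⟩
          exact ⟨⟨⟨W, hW⟩, hS _ _ (hle.trans inf_le_left) W₁.2⟩, hle.trans inf_le_left,
            hle.trans inf_le_right, hz⟩)
        (fun W hW => br W.1 (res hW x) (res hW y))
        (fun W' W h hW => (hbr W.1 W'.1 W.1.2 W'.1.2 W.2 h _ _).trans (by
          rw [res_res, res_res]))
      exact ⟨b, fun _ W hW hSW hWV => hb ⟨⟨W, hW⟩, hSW⟩ hWV⟩
    · exact ⟨0, fun h => absurd h hV⟩
  choose B hB using key
  exact ⟨B, fun V hV x y W hW hSW hWV => hB V x y hV W hW hSW hWV⟩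

/-- Lifts on the small opens without obstruction, compatible with restriction, come from a
deformation. -/
theorem exists_deformation [IsSeparated π] [QuasiCompact π] [IsClosedImmersion i]
    (ht : IsSmall ε t) (hS : ∀ V W, W ≤ V → S V → S W)
    (hcov : ∀ y, ∃ W, IsAffineOpen W ∧ S W ∧ y ∈ W) (L : PreLift π A)
    (hL : ∀ W, IsAffineOpen W → S W → IsLift Λ₀ i ε t L W)
    (hO : ∀ W, IsAffineOpen W → S W → IsObs ε t L W (0 : PairFamily i W 1)) :
    ∃ η : Deformation i Λ₀ ε, ∀ W, IsAffineOpen W → S W →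
      η.preLift.br W = L.br W ∧ η.preLift.J W = L.J W := by
  obtain ⟨I, hI⟩ := exists_ideal_of_forall_map L.J S hcov
    fun V W hV hW hSV h => (hL V hV hSV).map_J ht hV hW h
  obtain ⟨B, hB⟩ := exists_bracket_glue ε hS L.br
    fun V W hV hW hSV h => (hL V hV hSV).br_res V W hV hW le_rfl h
  have hall : ∀ V : (Thick π A).Opens, IsCoveredBy S V := fun V z _ => by
    obtain ⟨W, -, hW, hz⟩ := hcov (Thick.proj π A z)
    exact ⟨W, hW, hz⟩
  replace hB := fun V => hB V (hall V)
  have hm := fun W hW hSW => (hL W hW hSW).modT W hW le_rfl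
  have hext := fun V {x y} => (hall V).eq_of_res_eq ε hS (x := x) (y := y)
  let Λ : PoissonStructure (Thick.str π A) :=
    { bracket := B
      add_right := fun V a b c => hext V fun W hW hSW hWV => by
        rw [map_add]
        simp only [hB _ _ _ W hW hSW hWV, map_add]
        exact (hm W hW hSW).biderivation.add_right _ _ _
      leibniz := fun V a b c => hext V fun W hW hSW hWV => by
        rw [map_add, map_mul, map_mul]
        simp only [hB _ _ _ W hW hSW hWV, map_mul]
        exact (hm W hW hSW).biderivation.leibniz _ _ _
      const_right := fun V a c => hext V fun W hW hSW hWV => by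
        rw [map_zero, hB _ _ _ W hW hSW hWV, res_const]
        exact (hm W hW hSW).biderivation.const_right _ _
      self := fun V a => hext V fun W hW hSW hWV => by
        rw [map_zero, hB _ _ _ W hW hSW hWV]
        exact (hm W hW hSW).biderivation.self _
      skew := fun V a b => hext V fun W hW hSW hWV => by
        rw [map_neg, hB _ _ _ W hW hSW hWV, hB _ _ _ W hW hSW hWV]
        exact (hm W hW hSW).biderivation.skew _ _
      jacobi := fun V a b c => hext V fun W hW hSW hWV => by
        simp only [jacobiSum, map_add, hB _ _ _ W hW hSW hWV, map_zero]
        exact (hO W hW hSW).jacobi_of_zero ht (hL W hW hSW) hW le_rfl _ _ _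
      restrict := fun V V' h a b => hext V' fun W hW hSW hWV => by
        rw [res_res, hB _ _ _ W hW hSW _, hB _ _ _ W hW hSW hWV, res_res, res_res] }
  have hproj : ∀ W, IsAffineOpen W → S W → B (Thick.proj π A ⁻¹ᵁ W) = L.br W := by
    intro W hW hSW
    funext x y
    have := hB (Thick.proj π A ⁻¹ᵁ W) x y W hW hSW le_rfl
    rwa [res_self, res_self, res_self] at this
  refine ⟨⟨Λ, I, ?_, fun V a b ha => ?_, fun V a b => ?_, ?_⟩, fun W hW hSW =>
    ⟨hproj W hW hSW, hI W hW hSW⟩⟩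
  · refine (flat_subschemeι_iff (Thick.str π A) I
      (fun W : {W : Y.affineOpens // S W} => ⟨_, isAffineOpen_proj π W.1.2⟩)
      (exists_affine_cover_proj π A S hcov)).2 fun W => ?_
    change RingHom.Flat ((Ideal.Quotient.mk (secIdeal I W.1)).comp (cst π A W.1))
    rw [hI W.1 W.1.2 W.2]
    have hf := (hm W.1 W.1.2 W.2).flat
    let := constAlgebra π (W.1 : Y.Opens)
    exact (Thick.isTensor π W.1.2).flat_quotient ε ht.nilpotent (red_pull π ε _) (red_cst π ε _)
      (fun x hx => mem_map_of_red_eq_zero π W.1.2 ε hx) hf.ρ_r hf.exists_lift hf.tor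
  · refine PoissonDef.eq_of_res_eq (fun W : {W : Y.affineOpens // S W ∧ Thick.proj π A ⁻¹ᵁ W ≤ V} =>
      I.subschemeι ⁻¹ᵁ Thick.proj π A ⁻¹ᵁ (W.1 : Y.Opens)) (fun z hz => ?_) fun W _ => ?_
    · obtain ⟨W, hWV, hzW⟩ := (hall V).exists_affine ε hS hz
      exact ⟨⟨W.1, W.2, hWV⟩, I.subschemeι.preimage_mono hWV, hzW⟩
    · obtain ⟨W, hSW, hWV⟩ := W
      have h1 : res hWV a ∈ secIdeal I W := by
        change (I.subschemeι.app _).hom _ = 0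
        rw [app_res, ha, map_zero]
      rw [hI W W.2 hSW] at h1
      have h2 := (hO W W.2 hSW).poisson_of_zero ht (hL W W.2 hSW) W.2 le_rfl h1 (res hWV b)
      rw [← hI W W.2 hSW, ← hB V a b W W.2 hSW hWV] at h2
      change (I.subschemeι.app _).hom _ = 0 at h2
      rw [app_res] at h2
      exact h2.trans (map_zero _).symm
  · refine PoissonDef.eq_of_res_eq
      (fun W : {W : Y.affineOpens // S W ∧ Thick.proj π A ⁻¹ᵁ W ≤ V} => (W.1 : Y.Opens))
      (fun y hy => ?_) fun W hWV => ?_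
    · obtain ⟨W, hWV, hzW⟩ := (hall V).exists_affine ε hS
        (show Thick.fibre π ε y ∈ V from hy)
      have h1 := Scheme.Hom.preimage_mono (Thick.fibre π ε) hWV
      rw [Thick.fibre_preimage] at h1
      have h2 : y ∈ Thick.fibre π ε ⁻¹ᵁ Thick.proj π A ⁻¹ᵁ (W.1 : Y.Opens) := hzW
      rw [Thick.fibre_preimage] at h2
      exact ⟨⟨W.1, W.2, hWV⟩, h1, h2⟩
    · obtain ⟨W, hSW, hWV'⟩ := W
      rw [res_fibre_app hWV hWV', hB V a b W W.2 hSW hWV', (hm W W.2 hSW).r_br, Λ₀.restrict,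
        res_fibre_app hWV hWV', res_fibre_app hWV hWV']
  · refine (inducesSubscheme_fibre_iff ε I S hcov).2 fun W hW hSW => ?_
    rw [hI W hW hSW]
    have hf := (hm W hW hSW).flat
    ext f
    rw [mem_map_red_iff]
    exact ⟨hf.exists_lift f, by rintro ⟨x, hx, rfl⟩; exact hf.ρ_r x hx⟩

end BracketGluing

/-! ### Lifts of a deformation along a small extension -/

section Over

variable {k : Type u} [Field k] {X Y : Scheme.{u}} {π : Y ⟶ Spec (.of k)} {i : X ⟶ Y}
  {Λ₀ : PoissonStructure π} {A : Type u} [CommRing A] [Algebra k A] {ε : A →ₐ[k] k}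
  {A' : Type u} [CommRing A'] [Algebra k A'] {φ : A' →ₐ[k] A} {t : A'}

theorem mp_surjective (hφ : Function.Surjective φ) {W : Y.Opens} (hW : IsAffineOpen W) :
    Function.Surjective (mp π φ W) := by
  let := constAlgebra π W
  refine (Thick.isTensor π (A := A) hW).induction (fun a b => ?_) fun x y => ?_
  · obtain ⟨a, rfl⟩ := hφ a
    exact ⟨cst π A' W a * pull π A' W b, by rw [map_mul, mp_cst, mp_pull]⟩
  · rintro ⟨x, rfl⟩ ⟨y, rfl⟩
    exact ⟨x + y, map_add _ _ _⟩

theorem exists_eq_of_mp_eq_zero (ht : IsSmall (ε.comp φ) t) (hφ : Function.Surjective φ)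
    (hker : RingHom.ker φ = Ideal.span {t}) {W : Y.Opens} (hW : IsAffineOpen W) {x : Sec π A' W}
    (hx : mp π φ W x = 0) : ∃ g, x = cst π A' W t * pull π A' W g := by
  let := constAlgebra π W
  obtain ⟨y, rfl⟩ := (Thick.isTensor π (A := A) hW).exists_eq_mul_of_map_eq_zero
    (Thick.isTensor π (A := A') hW) hφ hker (mp_cst π φ W) (mp_pull π φ W) hx
  exact ⟨_, (ht.isThickening hW).t_mul y⟩

theorem mp_t_mul (hker : RingHom.ker φ = Ideal.span {t}) (W : Y.Opens) (x : Sec π A' W) :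
    mp π φ W (cst π A' W t * x) = 0 := by
  have : φ t = 0 := by
    have : t ∈ RingHom.ker φ := hker ▸ Ideal.mem_span_singleton_self t
    exact this
  rw [map_mul, mp_cst, this, map_zero, zero_mul]

theorem res_map_app {V : (Thick π A').Opens} {W : Y.Opens}
    (h : Thick.proj π A ⁻¹ᵁ W ≤ Thick.map π φ ⁻¹ᵁ V) (h' : Thick.proj π A' ⁻¹ᵁ W ≤ V)
    (x : Γ(Thick π A', V)) :
    res h (((Thick.map π φ).app V).hom x) = mp π φ W (res h' x) :=
  (congrArg (fun g => g.hom x) ((Thick.map π φ).map_appLE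
    (Thick.map_preimage π φ W).ge (homOfLE h').op)).symm

/-- On `U × Spec A'`, the bracket and the ideals of `L` induce those of `η` along
`φ : A' → A`. -/
structure IsOver (φ : A' →ₐ[k] A) (η : Deformation i Λ₀ ε) (L : PreLift π A') (U : Y.Opens) :
    Prop where
  br : ∀ W, IsAffineOpen W → W ≤ U → ∀ x y,
    mp π φ W (L.br W x y) = η.preLift.br W (mp π φ W x) (mp π φ W y)
  J : ∀ W, IsAffineOpen W → W ≤ U → η.preLift.J W = (L.J W).map (mp π φ W)

section

variable (ht : IsSmall (ε.comp φ) t) (hφ : Function.Surjective φ)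
  (hker : RingHom.ker φ = Ideal.span {t}) {η : Deformation i Λ₀ ε} {L L' : PreLift π A'}
  {U : Y.Opens}

theorem IsOver.mono (h : IsOver φ η L U) {U' : Y.Opens} (hU : U' ≤ U) : IsOver φ η L U' :=
  ⟨fun W hW hWU => h.br W hW (hWU.trans hU), fun W hW hWU => h.J W hW (hWU.trans hU)⟩

include hφ in
theorem IsOver.mem_J_iff (h : IsOver φ η L U) {W : Y.Opens} (hW : IsAffineOpen W) (hWU : W ≤ U)
    {x : Sec π A W} : x ∈ η.preLift.J W ↔ ∃ y ∈ L.J W, mp π φ W y = x := by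
  rw [h.J W hW hWU]
  exact Ideal.mem_map_iff_of_surjective _ (mp_surjective hφ hW)

include ht hφ hker

/-- Two lifts of one deformation agree modulo `t`. -/
theorem IsOver.isCong (h : IsOver φ η L U) (h' : IsOver φ η L' U) : IsCong t L L' U := by
  have key : ∀ {L L' : PreLift π A'}, IsOver φ η L U → IsOver φ η L' U →
      ∀ W, IsAffineOpen W → W ≤ U →
        IsCongruentAt (cst π A' W) (pull π A' W) t (L.br W) (L.J W) (L'.br W) (L'.J W) := by
    intro L L' h h' W hW hWU
    refine ⟨fun u v => exists_eq_of_mp_eq_zero ht hφ hker hW ?_, fun x hx => ?_⟩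
    · rw [map_sub, h.br W hW hWU, h'.br W hW hWU, sub_self]
    · obtain ⟨y, hy, hyx⟩ := (h'.mem_J_iff hφ hW hWU).1 ((h.mem_J_iff hφ hW hWU).2 ⟨x, hx, rfl⟩)
      obtain ⟨g, hg⟩ := exists_eq_of_mp_eq_zero ht hφ hker hW (x := x - y)
        (by rw [map_sub, hyx, sub_self])
      exact ⟨g, by rwa [← hg, sub_sub_cancel]⟩
  exact ⟨key h h', key h' h⟩

omit ht hφ in
theorem IsOver.of_isCong (h : IsOver φ η L U) (hc : IsCong t L L' U) : IsOver φ η L' U := by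
  refine ⟨fun W hW hWU x y => ?_, fun W hW hWU => ?_⟩
  · obtain ⟨g, hg⟩ := (hc.right W hW hWU).bracket x y
    rw [← h.br W hW hWU, ← sub_eq_zero, ← map_sub, hg, mp_t_mul hker]
  · have key : ∀ {L L' : PreLift π A'},
        IsCongruentAt (cst π A' W) (pull π A' W) t (L.br W) (L.J W) (L'.br W) (L'.J W) →
        (L.J W).map (mp π φ W) ≤ (L'.J W).map (mp π φ W) := by
      intro L L' hc
      rw [Ideal.map_le_iff_le_comap]
      intro x hx
      obtain ⟨g, hg⟩ := hc.ideal x hx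
      have := Ideal.mem_map_of_mem (mp π φ W) hg
      rwa [map_sub, mp_t_mul hker, sub_zero] at this
    rw [h.J W hW hWU]
    exact le_antisymm (key (hc.left W hW hWU)) (key (hc.right W hW hWU))

/-- A flat lifting of a deformation is Poisson modulo `t`. -/
theorem IsOver.isPoissonModT (h : IsOver φ η L U) {W : Y.Opens} (hW : IsAffineOpen W)
    (hWU : W ≤ U) (hbr : IsBiderivation (cst π A' W) (L.br W))
    (hJ : IsFlatIdeal (cst π A' W) (pull π A' W) (red π (ε.comp φ) W) (RingHom.ker (ε.comp φ)) t
      (i.app W).hom (L.J W)) :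
    IsPoissonModT (cst π A' W) (pull π A' W) (red π (ε.comp φ) W) (RingHom.ker (ε.comp φ)) t
      (i.app W).hom (Λ₀.bracket W) (L.br W) (L.J W) := by
  refine ⟨hbr, fun u v => ?_, hJ, fun u v w => exists_eq_of_mp_eq_zero ht hφ hker hW ?_,
    fun x hx u => ?_⟩
  · rw [← red_mp, h.br W hW hWU]
    refine (η.red_bracket W _ _).trans ?_
    rw [red_mp, red_mp]
  · simp only [jacobiSum, map_add, h.br W hW hWU]
    exact η.Λ.jacobi _ _ _ _
  · have h1 : mp π φ W (L.br W x u) ∈ η.preLift.J W := by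
      rw [h.br W hW hWU]
      exact η.isPoisson _ _ _ ((h.mem_J_iff hφ hW hWU).2 ⟨x, hx, rfl⟩)
    obtain ⟨y, hy, hyx⟩ := (h.mem_J_iff hφ hW hWU).1 h1
    obtain ⟨g, hg⟩ := exists_eq_of_mp_eq_zero ht hφ hker hW (x := L.br W x u - y)
      (by rw [map_sub, hyx, sub_self])
    exact ⟨g, by rwa [← hg, sub_sub_cancel]⟩

end

theorem proj_preimage_le_of_le_map [IsLocalRing A'] [IsArtinianRing A'] (ε : A →ₐ[k] k)
    (φ : A' →ₐ[k] A) {V : (Thick π A').Opens} {W : Y.Opens}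
    (h : Thick.proj π A ⁻¹ᵁ W ≤ Thick.map π φ ⁻¹ᵁ V) : Thick.proj π A' ⁻¹ᵁ W ≤ V := by
  rw [← Thick.preimage_fibre_preimage π (ε.comp φ) V, ← Thick.fibre_map,
    Scheme.Hom.comp_preimage]
  refine (Thick.proj π A').preimage_mono ?_
  have := (Thick.fibre π ε).preimage_mono h
  rwa [Thick.fibre_preimage] at this

/-- Whether a deformation lifts another one can be checked on the small affine opens. -/
theorem Deformation.lifts_iff [IsLocalRing A] [IsArtinianRing A] [IsLocalRing A']
    [IsArtinianRing A']
    {η' : Deformation i Λ₀ (ε.comp φ)}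
    {η : Deformation i Λ₀ ε} (S : Y.Opens → Prop) (hS : ∀ V W, W ≤ V → S V → S W)
    (hcov : ∀ y, ∃ W, IsAffineOpen W ∧ S W ∧ y ∈ W) :
    η'.Lifts η ↔ ∀ W, IsAffineOpen W → S W → IsOver φ η η'.preLift W := by
  have hall : ∀ V : (Thick π A).Opens, IsCoveredBy S V := fun V z _ => by
    obtain ⟨W, -, hW, hz⟩ := hcov (Thick.proj π A z)
    exact ⟨W, hW, hz⟩
  constructor
  · rintro ⟨h1, h2⟩ W _ _
    refine ⟨fun W hW _ x y => ?_, fun W hW _ =>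
      (inducesSubscheme_map_iff φ η'.ideal η.ideal (fun _ => True) fun y => by
        obtain ⟨W, hW, -, hy⟩ := exists_affine_le (T := Y) (V := ⊤) (x := y) trivial
        exact ⟨W, hW, trivial, hy⟩).1 h2 W hW trivial⟩
    have h3 := congrArg (res (Thick.map_preimage π φ W).ge) (h1 (Thick.proj π A' ⁻¹ᵁ W) x y)
    rw [η.Λ.restrict] at h3
    exact h3
  · intro h
    refine ⟨fun V a b => (hall _).eq_of_res_eq ε hS fun W hW hSW hWV => ?_,
      (inducesSubscheme_map_iff φ η'.ideal η.ideal S hcov).2 fun W hW hSW =>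
        (h W hW hSW).J W hW le_rfl⟩
    have hWV' := proj_preimage_le_of_le_map ε φ hWV
    rw [res_map_app hWV hWV', η.Λ.restrict, η'.Λ.restrict, res_map_app hWV hWV',
      res_map_app hWV hWV']
    exact (h W hW hSW).br W hW le_rfl _ _

end Over

/-! ### The lifts defined by local liftings -/

section LocalLift

variable {k : Type u} [Field k] {X Y : Scheme.{u}} {π : Y ⟶ Spec (.of k)} {i : X ⟶ Y}
  {Λ₀ : PoissonStructure π} {A : Type u} [CommRing A] [Algebra k A] {ε : A →ₐ[k] k}
  {A' : Type u} [CommRing A'] [Algebra k A'] {φ : A' →ₐ[k] A} {t : A'}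

theorem flat_res {Z : Scheme.{u}} {V W : Z.Opens} (hV : IsAffineOpen V) (hW : IsAffineOpen W)
    (h : W ≤ V) : (res h).Flat := by
  have h' : W ≤ 𝟙 Z ⁻¹ᵁ V := h
  have h1 := Flat.flat_appLE (𝟙 Z) hV hW h'
  rwa [show ((𝟙 Z : Z ⟶ Z).appLE V W h').hom = res h from
    RingHom.ext fun x => by rw [appLE_eq_res_app, Scheme.Hom.id_app]; rfl] at h1

theorem isWeaklyRegular_res {Z : Scheme.{u}} {V W : Z.Opens} (hV : IsAffineOpen V)
    (hW : IsAffineOpen W) (h : W ≤ V) {n : ℕ} {f : Fin n → Γ(Z, V)}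
    (hf : RingTheory.Sequence.IsWeaklyRegular Γ(Z, V) (List.ofFn f)) :
    RingTheory.Sequence.IsWeaklyRegular Γ(Z, W) (List.ofFn fun α => res h (f α)) := by
  let := (res h).toAlgebra
  have : Module.Flat Γ(Z, V) Γ(Z, W) := flat_res hV hW h
  have := hf.of_flat (S := Γ(Z, W))
  rwa [List.map_ofFn] at this

/-- Normal fields that agree on generators of the ideal are equal. -/
theorem IsNormalAt.ext {R B C : Type*} [CommRing R] [CommRing B] [CommRing C] {ρ : B →+* C}
    {k₀ : R →+* B} {q : ℕ} {Φ Φ' : RingHom.ker ρ → (Fin q → B) → C} (h : IsNormalAt ρ k₀ Φ)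
    (h' : IsNormalAt ρ k₀ Φ') {ι : Type*} (F : ι → B)
    (hF : Ideal.span (Set.range F) = RingHom.ker ρ)
    (H : ∀ α (f : RingHom.ker ρ), (f : B) = F α → Φ f = Φ' f) : Φ = Φ' := by
  have key : ∀ x ∈ Ideal.span (Set.range F), ∀ hx : x ∈ RingHom.ker ρ,
      Φ ⟨x, hx⟩ = Φ' ⟨x, hx⟩ := by
    intro x hx
    refine Submodule.span_induction (p := fun x _ => ∀ hx : x ∈ RingHom.ker ρ,
      Φ ⟨x, hx⟩ = Φ' ⟨x, hx⟩) ?_ ?_ ?_ ?_ hx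
    · rintro _ ⟨α, rfl⟩ hα
      exact H α _ rfl
    · intro h0
      funext v
      have e : (⟨0, h0⟩ : RingHom.ker ρ) = (0 : B) • ⟨0, h0⟩ := by ext; simp
      rw [e, h.map_smul, h'.map_smul, map_zero, zero_mul, zero_mul]
    · intro x y hx hy ihx ihy hxy
      funext v
      have e : (⟨x + y, hxy⟩ : RingHom.ker ρ) = ⟨x, hF ▸ hx⟩ + ⟨y, hF ▸ hy⟩ := rfl
      rw [e, h.map_add, h'.map_add, ihx, ihy]
    · intro a x hx ih hax
      funext v
      have e : (⟨a • x, hax⟩ : RingHom.ker ρ) = a • ⟨x, hF ▸ hx⟩ := rfl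
      rw [e, h.map_smul, h'.map_smul, ih]
  funext f
  exact key f (hF.ge f.2) f.2

variable {η : Deformation i Λ₀ ε} (D : LocalLiftings η φ)

open Classical in
/-- The bracket and the ideals that the local liftings define over one member of the cover. -/
def LocalLiftings.preLift (y : Y) : PreLift π A' where
  -- outside the member of the cover, the bracket is zero and the ideal is the empty supremum
  br W u v := if h : W ≤ D.cover.U y then
    D.Λ y ⟨Thick.proj π A' ⁻¹ᵁ W, (Thick.proj π A').preimage_mono h⟩ ![u, v] else 0
  J W := ⨆ h : W ≤ D.cover.U y, Ideal.span (Set.range fun β => tres π h (D.F y β))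

variable {D}

theorem LocalLiftings.preLift_br {y : Y} {W : Y.Opens} (h : W ≤ D.cover.U y) (u v : Sec π A' W) :
    (D.preLift y).br W u v =
      D.Λ y ⟨Thick.proj π A' ⁻¹ᵁ W, (Thick.proj π A').preimage_mono h⟩ ![u, v] := dif_pos h

theorem LocalLiftings.preLift_J {y : Y} {W : Y.Opens} (h : W ≤ D.cover.U y) :
    (D.preLift y).J W = Ideal.span (Set.range fun β => tres π h (D.F y β)) := iSup_pos h

theorem LocalLiftings.tres_mem_J {y : Y} {W : Y.Opens} (h : W ≤ D.cover.U y) (β : Fin (D.n y)) :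
    tres π h (D.F y β) ∈ (D.preLift y).J W := by
  rw [preLift_J h]
  exact Ideal.subset_span ⟨β, rfl⟩

variable (D)

theorem LocalLiftings.isOver (y : Y) : IsOver φ η (D.preLift y) (D.cover.U y) where
  br W _ hWU u v := by
    have h1 := congrArg (res (Thick.map_preimage π φ W).ge)
      (D.Λ_lifts y (Thick.proj π A' ⁻¹ᵁ W) ((Thick.proj π A').preimage_mono hWU) u v)
    rw [η.Λ.restrict] at h1
    rw [preLift_br hWU]
    exact h1
  J W hW hWU := by
    have h1 : secIdeal η.ideal (D.cover.U y) =
        Ideal.span (Set.range fun α => mp π φ (D.cover.U y) (D.F y α)) := by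
      have h2 := congrArg (Ideal.map (res (Thick.map_preimage π φ (D.cover.U y)).ge)) (D.span_F y)
      rw [Ideal.map_span, ← Set.range_comp] at h2
      refine Eq.trans ?_ h2.symm
      have key : ∀ E (h : Thick.proj π A ⁻¹ᵁ D.cover.U y = E), secIdeal η.ideal (D.cover.U y) =
          Ideal.map (res h.le) (RingHom.ker (η.ideal.subschemeι.app E).hom) := by
        rintro E rfl
        rw [show res (le_refl (Thick.proj π A ⁻¹ᵁ D.cover.U y)) = RingHom.id _ from
          RingHom.ext fun x => res_self _ x, Ideal.map_id]
        rfl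
      exact key _ (Thick.map_preimage π φ (D.cover.U y)).symm
    change secIdeal η.ideal W = _
    rw [← map_secIdeal η.ideal (D.affine y) hW hWU, h1, preLift_J hWU, Ideal.map_span,
      Ideal.map_span, ← Set.range_comp, ← Set.range_comp]
    congr 2
    funext α
    exact (mp_res π φ hWU _).symm

theorem LocalLiftings.red_F (y : Y) {W : Y.Opens} (h : W ≤ D.cover.U y) (α : Fin (D.n y)) :
    red π (ε.comp φ) W (tres π h (D.F y α)) = res h (D.f y α) := by
  have h1 := congrArg (res (Thick.fibre_preimage π (ε.comp φ) (D.cover.U y)).ge)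
    (D.F_reduces y α)
  have h2 : red π (ε.comp φ) _ (D.F y α) = red π (ε.comp φ) _ (pull π A' _ (D.f y α)) := h1
  rw [red_res, h2, red_pull]

theorem LocalLiftings.span_res_f [IsClosedImmersion i] (y : Y) {W : Y.Opens}
    (hW : IsAffineOpen W) (h : W ≤ D.cover.U y) :
    Ideal.span (Set.range fun α => res h (D.f y α)) = RingHom.ker (i.app W).hom := by
  rw [← map_ker_app i (D.affine y) hW h, ← D.span_f, Ideal.map_span, ← Set.range_comp]
  rfl

/-- The ideal generated by liftings of a regular sequence is flat. -/
theorem LocalLiftings.isFlatIdeal [IsClosedImmersion i] (ht : IsSmall (ε.comp φ) t) (y : Y)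
    {W : Y.Opens} (hW : IsAffineOpen W) (h : W ≤ D.cover.U y) :
    IsFlatIdeal (cst π A' W) (pull π A' W) (red π (ε.comp φ) W) (RingHom.ker (ε.comp φ)) t
      (i.app W).hom ((D.preLift y).J W) := by
  have hmap : ((D.preLift y).J W).map (red π (ε.comp φ) W) = RingHom.ker (i.app W).hom := by
    rw [preLift_J h, Ideal.map_span, ← Set.range_comp, ← D.span_res_f y hW h]
    congr 2
    funext α
    exact D.red_F y h α
  let := constAlgebra π W
  refine (Thick.isTensor π hW).isFlatIdeal (ε.comp φ) ht.nilpotent (red_cst π _ W)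
    (ht.isThickening hW) ht.ne_zero (fun x hx => ?_) (fun f hf => ?_) fun x hx hx0 => ?_
  · have : red π (ε.comp φ) W x ∈ RingHom.ker (i.app W).hom :=
      hmap ▸ Ideal.mem_map_of_mem _ hx
    exact this
  · exact (mem_map_red_iff _).1 (hmap.ge hf)
  · rw [← ker_red π hW]
    rw [preLift_J h] at hx ⊢
    refine mem_ker_mul_span_of_regular (red_surjective π _ W) _ ?_ hx hx0
    simp only [D.red_F y h]
    exact isWeaklyRegular_res (D.affine y) hW h (D.regular y)

theorem LocalLiftings.isLift [IsClosedImmersion i] (ht : IsSmall (ε.comp φ) t)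
    (hφ : Function.Surjective φ) (hker : RingHom.ker φ = Ideal.span {t}) (y : Y) :
    IsLift Λ₀ i (ε.comp φ) t (D.preLift y) (D.cover.U y) where
  modT W hW hWU := by
    refine (D.isOver y).isPoissonModT ht hφ hker hW hWU ?_ (D.isFlatIdeal ht y hW hWU)
    have h1 := ((D.isPolyvector y).polyderivation (Thick.proj π A' ⁻¹ᵁ W)
      ((Thick.proj π A').preimage_mono hWU)).isBiderivation
    rwa [← show (D.preLift y).br W = _ from funext fun u => funext fun v => preLift_br hWU u v]
      at h1
  br_res V W _ _ hVU h u v := by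
    rw [preLift_br hVU, preLift_br (h.trans hVU),
      (D.isPolyvector y).restrict _ _ _ ((Thick.proj π A').preimage_mono h)]
    congr 1
    funext l
    fin_cases l <;> rfl
  J_res V W _ _ hVU h x hx := by
    rw [preLift_J hVU] at hx
    have h1 := Ideal.mem_map_of_mem (tres π h) hx
    rw [Ideal.map_span, ← Set.range_comp] at h1
    rw [preLift_J (h.trans hVU)]
    convert h1 using 3
    funext α
    exact (res_res _ _ _).symm

end LocalLift

/-! ### Obstruction cochains -/

section Cochain

variable {k : Type u} [Field k] {X Y : Scheme.{u}} {π : Y ⟶ Spec (.of k)} {i : X ⟶ Y}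
  {Λ₀ : PoissonStructure π} {A : Type u} [CommRing A] [Algebra k A] {ε : A →ₐ[k] k}
  {A' : Type u} [CommRing A'] [Algebra k A'] {φ : A' →ₐ[k] A} {t : A'}
  {η : Deformation i Λ₀ ε} (D : LocalLiftings η φ)

theorem eq_of_tres_affine {V : Y.Opens} {x y : Sec π A V}
    (h : ∀ W (_ : IsAffineOpen W) (hW : W ≤ V), tres π hW x = tres π hW y) : x = y :=
  eq_of_res_eq (fun W : {W : Y.affineOpens // (W : Y.Opens) ≤ V} =>
    Thick.proj π A ⁻¹ᵁ (W.1 : Y.Opens)) (fun z hz => by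
      obtain ⟨W, hW, hWV, hz⟩ := exists_affine_le (V := V) (x := Thick.proj π A z) hz
      exact ⟨⟨⟨W, hW⟩, hWV⟩, (Thick.proj π A).preimage_mono hWV, hz⟩) fun W _ => h W.1 W.1.2 W.2

theorem LocalLiftings.tres_Λ {y : Y} {V W : Y.Opens} (hV : V ≤ D.cover.U y) (h : W ≤ V)
    (u v : Sec π A' V) :
    tres π h (D.Λ y ⟨Thick.proj π A' ⁻¹ᵁ V, (Thick.proj π A').preimage_mono hV⟩ ![u, v]) =
      (D.preLift y).br W (tres π h u) (tres π h v) := by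
  rw [preLift_br (h.trans hV), (D.isPolyvector y).restrict _ _ _ ((Thick.proj π A').preimage_mono h)]
  congr 1
  funext l
  fin_cases l <;> rfl

theorem LocalLiftings.tres_mem_J_of_mem_span {y : Y} {V W : Y.Opens} (hV : V ≤ D.cover.U y)
    (h : W ≤ V) {x : Sec π A' V} (hx : x ∈ Ideal.span (Set.range fun β => tres π hV (D.F y β))) :
    tres π h x ∈ (D.preLift y).J W := by
  have h1 := Ideal.mem_map_of_mem (tres π h) hx
  rw [Ideal.map_span, ← Set.range_comp] at h1
  rw [preLift_J (h.trans hV)]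
  convert h1 using 3
  funext α
  exact (res_res _ _ _).symm

theorem vec_two {α : Type*} (v : Fin 2 → α) : v = ![v 0, v 1] := by
  funext l; fin_cases l <;> rfl

theorem vec_three {α : Type*} (v : Fin 3 → α) : v = ![v 0, v 1, v 2] := by
  funext l; fin_cases l <;> rfl

/-- The obstructions and differences of the local liftings form an obstruction cochain. -/
theorem isObstructionCochain_of_isObs [IsClosedImmersion i] {s : CechFamily i D.cover}
    (hO : ∀ y, IsObs (ε.comp φ) t (D.preLift y) (D.cover.U y) (s.1 y))
    (hD : ∀ y z, IsDiff (ε.comp φ) t (D.preLift y) (D.preLift z) (D.cover.U y ⊓ D.cover.U z)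
      (s.2 y z)) : IsObstructionCochain D t s where
  mem₁ y := (hO y).mem
  mem₀ y z := (hD y z).mem
  jacobiator y V hV a b c := by
    refine eq_of_tres_affine fun W hW hWV => ?_
    have h1 := ((hO y).at_affine W hW (hWV.trans hV)).jacobi (res hWV a) (res hWV b) (res hWV c)
    rw [tmul, map_mul, tres_cst, tres_pull, (hO y).mem.1.restrict V W hV hWV,
      vec_three fun l => res hWV _]
    refine Eq.trans ?_ h1
    simp only [jacobiSum, map_neg, map_add, D.tres_Λ hV hWV, tres_pull]
  hamiltonian y V hV α f hf x g hg := by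
    refine eq_of_res_preimage_affine fun W hW hWV => ?_
    have h1 := ((hO y).at_affine W hW (hWV.trans hV)).ham (tres π (hWV.trans hV) (D.F y α))
      (LocalLiftings.tres_mem_J _ α) (kres i hWV f) (by
        rw [D.red_F]; exact (congrArg (res hWV) hf).trans (res_res _ _ _)) (res hWV x) (res hWV g)
      (by
        have := D.tres_mem_J_of_mem_span hV hWV hg
        rw [map_sub, D.tres_Λ hV hWV, tmul, map_mul, tres_cst, tres_pull, tres_pull] at this
        rwa [res_res] at this)
    rw [(hO y).mem.2.restrict V W hV hWV f (kres i hWV f) rfl, map_neg, ← app_res i hWV, ← h1]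
    refine congrArg ((s.1 y).2 ⟨W, hWV.trans hV⟩ (kres i hWV f)) ?_
    funext l; fin_cases l; rfl
  bivector y z V hV a b := by
    refine eq_of_tres_affine fun W hW hWV => ?_
    have h1 := ((hD y z).at_affine W hW (hWV.trans hV)).bivector (res hWV a) (res hWV b)
    rw [tmul, map_neg, map_mul, tres_cst, tres_pull, (hD y z).mem.1.restrict V W hV hWV,
      vec_two fun l => res hWV _]
    refine Eq.trans ?_ h1
    rw [map_sub, D.tres_Λ (hV.trans inf_le_left) hWV, D.tres_Λ (hV.trans inf_le_right) hWV]
    simp only [tres_pull]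
  normal y z V hV α f hf g hg := by
    refine eq_of_res_preimage_affine fun W hW hWV => ?_
    have h1 := ((hD y z).at_affine W hW (hWV.trans hV)).normal
      (tres π ((hWV.trans hV).trans inf_le_left) (D.F y α))
      (LocalLiftings.tres_mem_J _ α) (kres i hWV f) (by
        rw [D.red_F]; exact (congrArg (res hWV) hf).trans (res_res _ _ _)) (res hWV g)
      (by
        have := D.tres_mem_J_of_mem_span (hV.trans inf_le_right) hWV hg
        rw [map_sub, tmul, map_mul, tres_cst, tres_pull] at this
        rwa [res_res] at this)
    rw [(hD y z).mem.2.restrict V W hV hWV f (kres i hWV f) rfl, ← app_res i hWV, ← h1]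
    exact congrArg ((s.2 y z).2 ⟨W, hWV.trans hV⟩ (kres i hWV f)) (Subsingleton.elim _ _)

variable (ht : IsSmall (ε.comp φ) t) (hφ : Function.Surjective φ)
  (hker : RingHom.ker φ = Ideal.span {t})
include ht hφ hker

theorem LocalLiftings.isCong (y z : Y) :
    IsCong t (D.preLift y) (D.preLift z) (D.cover.U y ⊓ D.cover.U z) :=
  ((D.isOver y).mono inf_le_left).isCong ht hφ hker ((D.isOver z).mono inf_le_right)

variable [IsClosedImmersion i]

theorem LocalLiftings.exists_isObs_isDiff : ∃ s : CechFamily i D.cover,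
    (∀ y, IsObs (ε.comp φ) t (D.preLift y) (D.cover.U y) (s.1 y)) ∧
    ∀ y z, IsDiff (ε.comp φ) t (D.preLift y) (D.preLift z) (D.cover.U y ⊓ D.cover.U z)
      (s.2 y z) := by
  have h1 := fun y => (D.isLift ht hφ hker y).exists_isObs ht
  have h2 := fun y z => ((D.isLift ht hφ hker y).mono inf_le_left).exists_isDiff ht
    ((D.isLift ht hφ hker z).mono inf_le_right) (D.isCong ht hφ hker y z)
  choose a ha using h1
  choose b hb using h2
  exact ⟨(a, b), ha, hb⟩

/-- The conditions on an obstruction cochain determine it. -/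
theorem IsObstructionCochain.unique {s s' : CechFamily i D.cover}
    (h : IsObstructionCochain D t s) (h' : IsObstructionCochain D t s') : s = s' := by
  refine Prod.ext (funext fun y => ?_) (funext fun y => funext fun z => ?_)
  · refine complexSections_ext (h.mem₁ y) (h'.mem₁ y) fun W hW hWU => ⟨?_, ?_⟩
    · funext v
      rw [vec_three v]
      apply (ht.isThickening (π := π) hW).t_cancel
      exact (h.jacobiator y W hWU _ _ _).symm.trans (h'.jacobiator y W hWU _ _ _)
    · have hs := (h.mem₁ y).2
      have hs' := (h'.mem₁ y).2
      refine IsNormalAt.ext (k₀ := const π W)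
        ⟨hs.polyderivation W hWU, hs.map_add W hWU, hs.map_smul W hWU⟩
        ⟨hs'.polyderivation W hWU, hs'.map_add W hWU, hs'.map_smul W hWU⟩
        (fun α => res hWU (D.f y α)) (D.span_res_f y hW hWU) fun α f hf => ?_
      funext v
      obtain ⟨g, hg⟩ := ((D.isLift ht hφ hker y).modT W hW hWU).poisson _
        (LocalLiftings.tres_mem_J hWU α) (pull π A' W (v 0))
      rw [LocalLiftings.preLift_br hWU, LocalLiftings.preLift_J hWU] at hg
      have e : v = ![v 0] := by funext l; fin_cases l; rfl
      rw [e]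
      exact (h.hamiltonian y W hWU α f hf (v 0) g hg).trans
        (h'.hamiltonian y W hWU α f hf (v 0) g hg).symm
  · refine complexSections_ext (h.mem₀ y z) (h'.mem₀ y z) fun W hW hWU => ⟨?_, ?_⟩
    · funext v
      rw [vec_two v]
      apply (ht.isThickening (π := π) hW).t_cancel
      exact neg_injective ((h.bivector y z W hWU _ _).symm.trans (h'.bivector y z W hWU _ _))
    · have hs := (h.mem₀ y z).2
      have hs' := (h'.mem₀ y z).2
      refine IsNormalAt.ext (k₀ := const π W)
        ⟨hs.polyderivation W hWU, hs.map_add W hWU, hs.map_smul W hWU⟩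
        ⟨hs'.polyderivation W hWU, hs'.map_add W hWU, hs'.map_smul W hWU⟩
        (fun α => res (hWU.trans inf_le_left) (D.f y α))
        (D.span_res_f y hW (hWU.trans inf_le_left)) fun α f hf => ?_
      funext v
      obtain ⟨g, hg⟩ := ((D.isCong ht hφ hker y z).left W hW hWU).ideal _
        (LocalLiftings.tres_mem_J (hWU.trans inf_le_left) α)
      rw [LocalLiftings.preLift_J (hWU.trans inf_le_right)] at hg
      rw [Subsingleton.elim v ![]]
      exact (h.normal y z W hWU α f hf g hg).trans (h'.normal y z W hWU α f hf g hg).symm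

/-- The obstruction cochain of local liftings consists of their obstructions and differences. -/
theorem IsObstructionCochain.isObs_isDiff {s : CechFamily i D.cover}
    (h : IsObstructionCochain D t s) :
    (∀ y, IsObs (ε.comp φ) t (D.preLift y) (D.cover.U y) (s.1 y)) ∧
    ∀ y z, IsDiff (ε.comp φ) t (D.preLift y) (D.preLift z) (D.cover.U y ⊓ D.cover.U z)
      (s.2 y z) := by
  obtain ⟨s', h1, h2⟩ := D.exists_isObs_isDiff ht hφ hker
  rw [h.unique D ht hφ hker (isObstructionCochain_of_isObs D h1 h2)]
  exact ⟨h1, h2⟩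

end Cochain

/-! ### The Čech class of a family of lifts -/

section Cech

variable {k : Type u} [Field k] {X Y : Scheme.{u}} {π : Y ⟶ Spec (.of k)} {i : X ⟶ Y}
  {Λ₀ : PoissonStructure π} {ΛX : PoissonStructure (i ≫ π)} (hi : IsPoissonHom i ΛX Λ₀)
  {A : Type u} [CommRing A] [Algebra k A] {ε : A →ₐ[k] k} {t : A}

instance : IsDirected (PointCover Y) (· ≤ ·) :=
  ⟨fun 𝒰 𝒱 => ⟨⟨fun y => 𝒰.U y ⊓ 𝒱.U y, fun y => ⟨𝒰.mem y, 𝒱.mem y⟩⟩,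
    fun _ => inf_le_left, fun _ => inf_le_right⟩⟩

instance : DirectedSystem (CechH1 hi) fun 𝒰 𝒱 h => refineH1 hi 𝒰 𝒱 h where
  map_self 𝒰 x := by
    obtain ⟨s, rfl⟩ := QuotientAddGroup.mk_surjective x
    rfl
  map_map 𝒰 𝒱 𝒲 h h' x := by
    obtain ⟨s, rfl⟩ := QuotientAddGroup.mk_surjective x
    rfl

open Classical in
theorem H1.mk_refine {𝒰 𝒱 : PointCover Y} (h : 𝒰 ≤ 𝒱) (s : cocycles hi 𝒰) :
    H1.mk hi (refineCocycles hi h s) = H1.mk hi s :=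
  AddCommGroup.DirectLimit.of_f (G := CechH1 hi) (f := refineH1 hi) (i := 𝒰) (j := 𝒱)
    (hij := h) (x := QuotientAddGroup.mk s)

open Classical in
theorem H1.mk_eq_of_sub_mem {𝒰 : PointCover Y} {s s' : cocycles hi 𝒰}
    (h : (s' : CechFamily i 𝒰) - s ∈ coboundaries hi 𝒰) : H1.mk hi s = H1.mk hi s' := by
  refine congrArg (AddCommGroup.DirectLimit.of (CechH1 hi) (refineH1 hi) 𝒰) ?_
  rw [QuotientAddGroup.eq]
  change -(s : CechFamily i 𝒰) + s' ∈ coboundaries hi 𝒰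
  rwa [neg_add_eq_sub]

open Classical in
theorem H1.exists_refine_mem_of_mk_eq_zero {𝒰 : PointCover Y} {s : cocycles hi 𝒰}
    (h : H1.mk hi s = 0) :
    ∃ 𝒱, ∃ h : 𝒰 ≤ 𝒱, refine i h (s : CechFamily i 𝒰) ∈ coboundaries hi 𝒱 := by
  obtain ⟨𝒱, h𝒱, h0⟩ := AddCommGroup.DirectLimit.of.zero_exact (G := CechH1 hi)
    (f := fun 𝒰 𝒱 h => refineH1 hi 𝒰 𝒱 h) 𝒰 (QuotientAddGroup.mk s) h
  refine ⟨𝒱, h𝒱, ?_⟩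
  have h1 : (QuotientAddGroup.mk (refineCocycles hi h𝒱 s) : CechH1 hi 𝒱) = 0 := h0
  rw [QuotientAddGroup.eq_zero_iff] at h1
  exact h1

open Classical in
theorem H1.mk_zero {𝒰 : PointCover Y} (h : (0 : CechFamily i 𝒰) ∈ cocycles hi 𝒰) :
    H1.mk hi ⟨0, h⟩ = 0 :=
  map_zero (AddCommGroup.DirectLimit.of (CechH1 hi) (refineH1 hi) 𝒰)

/-- A cover with lifts on its members that agree modulo `t`, their obstructions and their
differences. -/
structure IsDatum (Λ₀ : PoissonStructure π) (ε : A →ₐ[k] k) (t : A) (𝒰 : PointCover Y)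
    (L : Y → PreLift π A) (s : CechFamily i 𝒰) : Prop where
  isLift : ∀ y, IsLift Λ₀ i ε t (L y) (𝒰.U y)
  isCong : ∀ y z, IsCong t (L y) (L z) (𝒰.U y ⊓ 𝒰.U z)
  isObs : ∀ y, IsObs ε t (L y) (𝒰.U y) (s.1 y)
  isDiff : ∀ y z, IsDiff ε t (L y) (L z) (𝒰.U y ⊓ 𝒰.U z) (s.2 y z)

variable {hi} {𝒰 𝒱 : PointCover Y} {L L' : Y → PreLift π A} {s : CechFamily i 𝒰}

theorem IsDatum.refine (h : IsDatum Λ₀ ε t 𝒰 L s) (hr : 𝒰 ≤ 𝒱) :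
    IsDatum Λ₀ ε t 𝒱 L (refine i hr s) where
  isLift y := (h.isLift y).mono (hr y)
  isCong y z := (h.isCong y z).mono (inf_le_inf (hr y) (hr z))
  isObs y := (h.isObs y).restrict (hr y)
  isDiff y z := (h.isDiff y z).restrict (inf_le_inf (hr y) (hr z))

variable (ht : IsSmall ε t)
include ht

variable (hi) in
/-- Obstructions are closed, their differences are differentials, and differences are additive. -/
theorem IsDatum.mem_cocycles (h : IsDatum Λ₀ ε t 𝒰 L s) : s ∈ cocycles hi 𝒰 := by
  refine ⟨fun y => (h.isObs y).mem, fun y z => (h.isDiff y z).mem,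
    fun y => (h.isObs y).differential_eq_zero ht (h.isLift y) hi, fun y z => ?_, fun y z w => ?_⟩
  · exact IsDiff.differential_eq ht ((h.isLift y).mono inf_le_left)
      ((h.isLift z).mono inf_le_right) (h.isCong y z) hi ((h.isObs y).restrict inf_le_left)
      ((h.isObs z).restrict inf_le_right) (h.isDiff y z)
  · have e1 : 𝒰.U y ⊓ 𝒰.U z ⊓ 𝒰.U w ≤ 𝒰.U y ⊓ 𝒰.U z := inf_le_left
    have e2 : 𝒰.U y ⊓ 𝒰.U z ⊓ 𝒰.U w ≤ 𝒰.U z ⊓ 𝒰.U w :=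
      le_inf (inf_le_left.trans inf_le_right) inf_le_right
    have e3 : 𝒰.U y ⊓ 𝒰.U z ⊓ 𝒰.U w ≤ 𝒰.U y ⊓ 𝒰.U w :=
      le_inf (inf_le_left.trans inf_le_left) inf_le_right
    have h1 := IsDiff.add ht ((h.isCong y z).mono e1) ((h.isCong z w).mono e2)
      ((h.isLift w).mono (e2.trans inf_le_right)) ((h.isDiff y z).restrict e1)
      ((h.isDiff z w).restrict e2)
    have h2 := h1.unique ht ((h.isLift y).mono (e1.trans inf_le_left)) ((h.isCong y w).mono e3)
      ((h.isDiff y w).restrict e3)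
    rw [← h2]
    abel

/-- The difference of the cocycles of two choices of lifts is the coboundary of their
difference. -/
theorem IsDatum.sub_mem_coboundaries {s' : CechFamily i 𝒰} (h : IsDatum Λ₀ ε t 𝒰 L s)
    (h' : IsDatum Λ₀ ε t 𝒰 L' s') (hc : ∀ y, IsCong t (L y) (L' y) (𝒰.U y)) :
    s' - s ∈ coboundaries hi 𝒰 := by
  choose a ha using fun y => (h.isLift y).exists_isDiff ht (h'.isLift y) (hc y)
  refine ⟨fun y => -a y, fun y _ => neg_mem (ha y).mem, Prod.ext (funext fun y => ?_)
    (funext fun y => funext fun z => ?_)⟩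
  · have h1 := IsDiff.differential_eq ht (h.isLift y) (h'.isLift y) (hc y) hi (h.isObs y)
      (h'.isObs y) (ha y)
    change differential hi (𝒰.U y) 0 (-a y) = s'.1 y - s.1 y
    rw [map_neg]
    exact (eq_neg_of_add_eq_zero_left h1).symm
  · have e1 : 𝒰.U y ⊓ 𝒰.U z ≤ 𝒰.U y := inf_le_left
    have e2 : 𝒰.U y ⊓ 𝒰.U z ≤ 𝒰.U z := inf_le_right
    have h1 := IsDiff.add ht ((hc y).mono e1) (h'.isCong y z) ((h'.isLift z).mono e2)
      ((ha y).restrict e1) (h'.isDiff y z)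
    have h2 := IsDiff.add ht (h.isCong y z) ((hc z).mono e2) ((h'.isLift z).mono e2)
      (h.isDiff y z) ((ha z).restrict e2)
    have h3 := h1.unique ht ((h.isLift y).mono e1) (((hc y).mono e1).trans (h'.isCong y z)) h2
    change -(restrictPair i 0 e2 (-a z) - restrictPair i 0 e1 (-a y)) = s'.2 y z - s.2 y z
    rw [map_neg, map_neg, sub_eq_sub_iff_add_eq_add.2 ((add_comm _ _).trans (h3.trans
      (add_comm _ _)))]
    abel

/-- The class of the cocycle does not depend on the cover and the lifts. -/
theorem IsDatum.mk_eq {s' : CechFamily i 𝒱} (h : IsDatum Λ₀ ε t 𝒰 L s)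
    (h' : IsDatum Λ₀ ε t 𝒱 L' s') (hc : ∀ y, IsCong t (L y) (L' y) (𝒰.U y ⊓ 𝒱.U y)) :
    H1.mk hi ⟨s, h.mem_cocycles hi ht⟩ = H1.mk hi ⟨s', h'.mem_cocycles hi ht⟩ := by
  let 𝒲 : PointCover Y := ⟨fun y => 𝒰.U y ⊓ 𝒱.U y, fun y => ⟨𝒰.mem y, 𝒱.mem y⟩⟩
  have hU : 𝒰 ≤ 𝒲 := fun _ => inf_le_left
  have hV : 𝒱 ≤ 𝒲 := fun _ => inf_le_right
  rw [← H1.mk_refine hi hU, ← H1.mk_refine hi hV]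
  exact H1.mk_eq_of_sub_mem hi ((h.refine hU).sub_mem_coboundaries ht (h'.refine hV) hc)

/-- If the class of the cocycle vanishes, then on a finer cover the lifts can be changed to lifts
without obstruction that agree on the overlaps. -/
theorem IsDatum.exists_zero_of_mk_eq_zero [IsClosedImmersion i] (h : IsDatum Λ₀ ε t 𝒰 L s)
    (h0 : H1.mk hi ⟨s, h.mem_cocycles hi ht⟩ = 0) : ∃ 𝒱 : PointCover Y, 𝒰 ≤ 𝒱 ∧
      ∃ L' : Y → PreLift π A, IsDatum Λ₀ ε t 𝒱 L' (0 : CechFamily i 𝒱) ∧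
        ∀ y, IsCong t (L y) (L' y) (𝒱.U y) := by
  obtain ⟨𝒱, hr, a, ha, has⟩ := H1.exists_refine_mem_of_mk_eq_zero hi h0
  replace h := h.refine hr
  choose L' hL' hc hd using fun y => (h.isLift y).exists_twist ht (ha y trivial)
  have hcc : ∀ y z, IsCong t (L' y) (L' z) (𝒱.U y ⊓ 𝒱.U z) := fun y z =>
    ((hc y).symm.mono inf_le_left).trans ((h.isCong y z).trans ((hc z).mono inf_le_right))
  refine ⟨𝒱, hr, L', ⟨hL', hcc, fun y => ?_, fun y z => ?_⟩, hc⟩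
  · obtain ⟨s', hs'⟩ := (hL' y).exists_isObs ht
    have h1 := IsDiff.differential_eq ht (h.isLift y) (hL' y) (hc y) hi (h.isObs y) hs' (hd y)
    have h2 : differential hi (𝒱.U y) 0 (a y) = (PoissonDef.refine i hr s).1 y :=
      congrFun (congrArg Prod.fst has) y
    rw [h2, sub_add_cancel] at h1
    rwa [h1] at hs'
  · have e1 : 𝒱.U y ⊓ 𝒱.U z ≤ 𝒱.U y := inf_le_left
    have e2 : 𝒱.U y ⊓ 𝒱.U z ≤ 𝒱.U z := inf_le_right
    obtain ⟨d, hd'⟩ := ((hL' y).mono e1).exists_isDiff ht ((hL' z).mono e2) (hcc y z)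
    have h1 := IsDiff.add ht ((hc y).mono e1) (hcc y z) ((hL' z).mono e2)
      ((hd y).restrict e1) hd'
    have h2 := IsDiff.add ht (h.isCong y z) ((hc z).mono e2) ((hL' z).mono e2)
      (h.isDiff y z) ((hd z).restrict e2)
    have h3 := h1.unique ht ((h.isLift y).mono e1) (((hc y).mono e1).trans (hcc y z)) h2
    have h4 : -(restrictPair i 0 e2 (a z) - restrictPair i 0 e1 (a y)) =
        (PoissonDef.refine i hr s).2 y z :=
      congrFun (congrFun (congrArg Prod.snd has) y) z
    have h5 : d = 0 := by
      rw [← h4] at h3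
      have h6 : restrictPair i 0 e1 (a y) + d = restrictPair i 0 e1 (a y) := by rw [h3]; abel
      exact add_eq_left.1 h6
    rwa [h5] at hd'

/-- Lifts without obstruction that agree on the overlaps come from a deformation. -/
theorem IsDatum.exists_deformation [IsLocalRing A] [IsArtinianRing A] [IsSeparated π]
    [QuasiCompact π] [IsClosedImmersion i] (h : IsDatum Λ₀ ε t 𝒰 L (0 : CechFamily i 𝒰)) :
    ∃ η : Deformation i Λ₀ ε, ∀ y W, IsAffineOpen W → W ≤ 𝒰.U y →
      η.preLift.br W = (L y).br W ∧ η.preLift.J W = (L y).J W := by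
  classical
  have heq : ∀ y z W, IsAffineOpen W → W ≤ 𝒰.U y → W ≤ 𝒰.U z →
      (L y).br W = (L z).br W ∧ (L y).J W = (L z).J W := fun y z W hW hy hz =>
    (h.isDiff y z).eq_of_zero ht ((h.isLift y).mono inf_le_left) ((h.isLift z).mono inf_le_right)
      (h.isCong y z) hW (le_inf hy hz)
  -- Lifts with difference zero are equal, so their values do not depend on the chosen member of the
  -- cover.
  let G : PreLift π A :=
    ⟨fun W => if hW : ∃ y, W ≤ 𝒰.U y then (L hW.choose).br W else 0,
      fun W => if hW : ∃ y, W ≤ 𝒰.U y then (L hW.choose).J W else ⊥⟩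
  have hG : ∀ y W, IsAffineOpen W → W ≤ 𝒰.U y → G.br W = (L y).br W ∧ G.J W = (L y).J W := by
    intro y W hW hy
    have hex : ∃ y, W ≤ 𝒰.U y := ⟨y, hy⟩
    have h1 := heq hex.choose y W hW hex.choose_spec hy
    exact ⟨(dif_pos hex).trans h1.1, (dif_pos hex).trans h1.2⟩
  have hS : ∀ V W : Y.Opens, W ≤ V → (∃ y, V ≤ 𝒰.U y) → ∃ y, W ≤ 𝒰.U y :=
    fun V W hWV ⟨y, hy⟩ => ⟨y, hWV.trans hy⟩
  have hL : ∀ W, IsAffineOpen W → (∃ y, W ≤ 𝒰.U y) → IsLift Λ₀ i ε t G W := by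
    rintro W - ⟨y, hy⟩
    refine ⟨fun V hV hVW => ?_, fun V V' hV hV' hVW hVV' => ?_, fun V V' hV hV' hVW hVV' => ?_⟩
    · rw [(hG y V hV (hVW.trans hy)).1, (hG y V hV (hVW.trans hy)).2]
      exact (h.isLift y).modT V hV (hVW.trans hy)
    · rw [(hG y V hV (hVW.trans hy)).1, (hG y V' hV' (hVV'.trans (hVW.trans hy))).1]
      exact (h.isLift y).br_res V V' hV hV' (hVW.trans hy) hVV'
    · rw [(hG y V hV (hVW.trans hy)).2, (hG y V' hV' (hVV'.trans (hVW.trans hy))).2]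
      exact (h.isLift y).J_res V V' hV hV' (hVW.trans hy) hVV'
  have hO : ∀ W, IsAffineOpen W → (∃ y, W ≤ 𝒰.U y) → IsObs ε t G W (0 : PairFamily i W 1) := by
    rintro W - ⟨y, hy⟩
    refine ⟨zero_mem _, fun V hV hVW => ?_⟩
    rw [(hG y V hV (hVW.trans hy)).1, (hG y V hV (hVW.trans hy)).2]
    exact (h.isObs y).at_affine V hV (hVW.trans hy)
  obtain ⟨η, hη⟩ := PoissonDef.exists_deformation ht hS (fun y => by
    obtain ⟨W, hW, hle, hy⟩ := exists_affine_le (𝒰.mem y)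
    exact ⟨W, hW, ⟨y, hle⟩, hy⟩) G hL hO
  exact ⟨η, fun y W hW hy =>
    ⟨(hη W hW ⟨y, hy⟩).1.trans (hG y W hW hy).1, (hη W hW ⟨y, hy⟩).2.trans (hG y W hW hy).2⟩⟩

end Cech

/-! ### Existence of local liftings -/

section Existence

variable {k : Type u} [Field k] {X Y : Scheme.{u}} {π : Y ⟶ Spec (.of k)} {i : X ⟶ Y}
  {Λ₀ : PoissonStructure π} {A : Type u} [CommRing A] [Algebra k A] {ε : A →ₐ[k] k}
  {A' : Type u} [CommRing A'] [Algebra k A'] {φ : A' →ₐ[k] A}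

/-- Compatible biderivations from the functions on affine opens `W` of `Y` to those on
`W × Spec A` extend to a bracket on `Y × Spec A`. -/
theorem exists_bracket_of_affine [IsLocalRing A] [IsArtinianRing A] (ε : A →ₐ[k] k)
    (D : ∀ W : Y.Opens, Γ(Y, W) → Γ(Y, W) → Sec π A W)
    (hadd : ∀ W a b b', D W a (b + b') = D W a b + D W a b')
    (hmul : ∀ W, IsAffineOpen W → ∀ a b b',
      D W a (b * b') = pull π A W b * D W a b' + pull π A W b' * D W a b)
    (hconst : ∀ W a x, D W a (const π W x) = 0) (hself : ∀ W a, D W a a = 0)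
    (hskew : ∀ W a b, D W b a = -D W a b)
    (hres : ∀ V W, IsAffineOpen V → IsAffineOpen W → ∀ (h : W ≤ V) a b,
      tres π h (D V a b) = D W (res h a) (res h b)) :
    ∃ B : ∀ V : (Thick π A).Opens, Γ(Thick π A, V) → Γ(Thick π A, V) → Γ(Thick π A, V),
      (∀ V, IsBiderivation (const (Thick.str π A) V) (B V)) ∧
      (∀ (V V' : (Thick π A).Opens) (h : V' ≤ V) x y,
        res h (B V x y) = B V' (res h x) (res h y)) ∧
      ∀ W, IsAffineOpen W → ∀ a b,
        B (Thick.proj π A ⁻¹ᵁ W) (pull π A W a) (pull π A W b) = D W a b := by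
  have hex : ∀ W : Y.Opens, ∃ br : Sec π A W → Sec π A W → Sec π A W, IsAffineOpen W →
      IsBiderivation (cst π A W) br ∧ ∀ a b, br (pull π A W a) (pull π A W b) = D W a b := by
    intro W
    by_cases hW : IsAffineOpen W
    · let := constAlgebra π W
      obtain ⟨br, h⟩ := (Thick.isTensor π (A := A) hW).exists_isBiderivation (hadd W) (hmul W hW)
        (hconst W) (hself W) (hskew W)
      exact ⟨br, fun _ => h⟩
    · exact ⟨0, fun h => absurd h hW⟩
  choose br hbr using hex
  have hS : ∀ V W : Y.Opens, W ≤ V → True → True := fun _ _ _ _ => trivial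
  obtain ⟨B, hB⟩ := exists_bracket_glue ε hS br fun V W hV hW _ h x y => by
    let := constAlgebra π V
    exact (Thick.isTensor π (A := A) hV).biderivation_ext (g := id) (map_add (tres π h))
      (fun a x => by rw [map_mul, tres_cst]; rfl) (hbr V hV).1 (hbr W hW).1
      (fun a b => by rw [(hbr V hV).2, tres_pull, tres_pull, (hbr W hW).2, hres V W hV hW h]) x y
  have hall : ∀ V : (Thick π A).Opens, IsCoveredBy (fun _ => True) V :=
    fun V z _ => ⟨⊤, trivial, trivial⟩
  replace hB := fun V x y W hW => hB V (hall V) x y W hW trivial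
  have hext := fun V {x y} (H : ∀ W, IsAffineOpen W → ∀ hW : Thick.proj π A ⁻¹ᵁ W ≤ V,
    res hW x = res hW y) => (hall V).eq_of_res_eq ε hS (x := x) (y := y) fun W hW _ => H W hW
  refine ⟨B, fun V => ⟨fun a b c => hext V fun W hW hWV => ?_,
    fun a b c => hext V fun W hW hWV => ?_, fun a c => hext V fun W hW hWV => ?_,
    fun a => hext V fun W hW hWV => ?_, fun a b => hext V fun W hW hWV => ?_⟩,
    fun V V' h x y => hext V' fun W hW hWV => ?_, fun W hW a b => ?_⟩
  · rw [map_add]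
    simp only [hB _ _ _ W hW hWV, map_add]
    exact (hbr W hW).1.add_right _ _ _
  · rw [map_add, map_mul, map_mul]
    simp only [hB _ _ _ W hW hWV, map_mul]
    exact (hbr W hW).1.leibniz _ _ _
  · rw [map_zero, hB _ _ _ W hW hWV, res_const]
    exact (hbr W hW).1.const_right _ _
  · rw [map_zero, hB _ _ _ W hW hWV]
    exact (hbr W hW).1.self _
  · rw [map_neg, hB _ _ _ W hW hWV, hB _ _ _ W hW hWV]
    exact (hbr W hW).1.skew _ _
  · rw [res_res, hB _ _ _ W hW _, hB _ _ _ W hW hWV, res_res, res_res]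
  · have := hB (Thick.proj π A ⁻¹ᵁ W) (pull π A W a) (pull π A W b) W hW le_rfl
    rw [res_self, res_self, res_self] at this
    exact this.trans ((hbr W hW).2 a b)

/-- The bracket of a deformation over `A` lifts to a biderivation over `A'`: a `k`-linear section
of `A' → A` extends to sections of the rings of functions on the affine opens, and these are linear
over the functions on `Y`. -/
theorem Deformation.exists_bracket_lift [IsLocalRing A] [IsArtinianRing A] [IsLocalRing A']
    [IsArtinianRing A'] (hφ : Function.Surjective φ) (η : Deformation i Λ₀ ε) :
    ∃ B : ∀ V : (Thick π A').Opens, Γ(Thick π A', V) → Γ(Thick π A', V) → Γ(Thick π A', V),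
      (∀ V, IsBiderivation (const (Thick.str π A') V) (B V)) ∧
      (∀ (V V' : (Thick π A').Opens) (h : V' ≤ V) x y,
        res h (B V x y) = B V' (res h x) (res h y)) ∧
      ∀ V x y, ((Thick.map π φ).app V).hom (B V x y) = η.Λ.bracket (Thick.map π φ ⁻¹ᵁ V)
        (((Thick.map π φ).app V).hom x) (((Thick.map π φ).app V).hom y) := by
  obtain ⟨σ, hσ⟩ := φ.toLinearMap.exists_rightInverse_of_surjective (LinearMap.range_eq_top.2 hφ)
  have hσ' : ∀ a, φ (σ a) = a := fun a => LinearMap.congr_fun hσ a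
  have hex : ∀ W : Y.Opens, ∃ s : Sec π A W →+ Sec π A' W, IsAffineOpen W →
      ∀ a b, s (cst π A W a * pull π A W b) = cst π A' W (σ a) * pull π A' W b := by
    intro W
    by_cases hW : IsAffineOpen W
    · let := constAlgebra π W
      obtain ⟨s, hs⟩ := (Thick.isTensor π (A := A) hW).exists_section
        (Thick.isTensor π (A := A') hW) σ
      exact ⟨s, fun _ => hs⟩
    · exact ⟨0, fun h => absurd h hW⟩
  choose s hs using hex
  have hb := fun W => η.Λ.isBiderivation (Thick.proj π A ⁻¹ᵁ W)
  have hmul : ∀ W, IsAffineOpen W → ∀ b x,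
      s W (pull π A W b * x) = pull π A' W b * s W x := fun W hW => by
    let := constAlgebra π W
    exact (Thick.isTensor π (A := A) hW).section_mul (hs W hW)
  have hconst : ∀ W x, pull π A W (const π W x) = cst π A W (algebraMap k A x) := by
    intro W x
    have h1 := appLE_const (Thick.proj π A) (algebraMap k A) (π' := Thick.str π A) (π := π)
      Limits.pullback.condition (le_refl (Thick.proj π A ⁻¹ᵁ W)) x
    rwa [← Scheme.Hom.app_eq_appLE] at h1
  obtain ⟨B, hB, hBr, hBp⟩ := exists_bracket_of_affine (ε.comp φ)
    (fun W a b => s W (η.Λ.bracket _ (pull π A W a) (pull π A W b)))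
    (fun W a b b' => by rw [map_add, (hb W).add_right, map_add])
    (fun W hW a b b' => by
      rw [map_mul, (hb W).leibniz, map_add, hmul W hW, hmul W hW])
    (fun W a x => by rw [hconst, (hb W).const_right, map_zero])
    (fun W a => by rw [(hb W).self, map_zero])
    (fun W a b => by rw [(hb W).skew, map_neg])
    (fun V W hV hW h a b => by
      have hnat : ∀ x, tres π h (s V x) = s W (tres π h x) := by
        let := constAlgebra π V
        refine (Thick.isTensor π (A := A) hV).induction (fun a b => ?_) fun x y hx hy => ?_
        · rw [hs V hV, map_mul, map_mul, tres_cst, tres_pull, tres_cst, tres_pull, hs W hW]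
        · rw [map_add, map_add, hx, hy, map_add, map_add]
      rw [hnat, η.Λ.restrict, tres_pull, tres_pull])
  refine ⟨B, hB, hBr, fun V x y => ?_⟩
  refine IsCoveredBy.eq_of_res_eq (S := fun _ => True) ε (fun z _ => ⟨⊤, trivial, trivial⟩)
    (fun _ _ _ _ => trivial) fun W hW _ hWV => ?_
  have hWV' := proj_preimage_le_of_le_map ε φ hWV
  rw [res_map_app hWV hWV', η.Λ.restrict, hBr, res_map_app hWV hWV', res_map_app hWV hWV']
  let := constAlgebra π W
  refine (Thick.isTensor π (A := A') hW).biderivation_ext (g := φ) (map_add (mp π φ W))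
    (fun a x => by rw [map_mul, mp_cst]) (hB _) (hb W) (fun a b => ?_) _ _
  rw [hBp W hW, mp_pull, mp_pull]
  exact (Thick.isTensor π (A := A) hW).map_section (mp_cst π φ W) (mp_pull π φ W) hσ' (hs W hW) _

theorem ker_app_eq_map_res {T Z : Scheme.{u}} (ι : T ⟶ Z) {E E' : Z.Opens} (h : E = E') :
    RingHom.ker (ι.app E').hom = (RingHom.ker (ι.app E).hom).map (res h.ge) := by
  subst h
  rw [show res (le_refl E) = RingHom.id _ from RingHom.ext fun x => res_self _ x, Ideal.map_id]

theorem res_injective_of_eq {Z : Scheme.{u}} {E E' : Z.Opens} (h : E = E') :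
    Function.Injective (res h.ge) := by
  subst h
  intro x y hxy
  rwa [res_self, res_self] at hxy

/-- Generators of the ideal of `X` lift to generators of the ideal of a deformation. -/
theorem Deformation.exists_generators [IsClosedImmersion i] [IsLocalRing A] [IsArtinianRing A]
    (η : Deformation i Λ₀ ε)
    {U : Y.Opens} (hU : IsAffineOpen U) {n : ℕ} {f : Fin n → Γ(Y, U)}
    (hf : Ideal.span (Set.range f) = RingHom.ker (i.app U).hom) :
    ∃ F : Fin n → Sec π A U, (∀ α, red π ε U (F α) = f α) ∧
      Ideal.span (Set.range F) = secIdeal η.ideal U := by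
  have hk := η.ker_eq hU
  have h1 : ∀ α, ∃ x ∈ secIdeal η.ideal U, red π ε U x = f α := fun α => by
    rw [← mem_map_red_iff, ← hk, ← hf]
    exact Ideal.subset_span ⟨α, rfl⟩
  choose F hF hFr using h1
  refine ⟨F, hFr, span_eq_of_tor (r := red π ε U) (c := cst π A U) (isNilpotent_ker ε)
    (Ideal.span_le.2 (by rintro _ ⟨α, rfl⟩; exact hF α)) (fun x hx => ?_) fun x => η.tor hU⟩
  have h2 : red π ε U x ∈ (Ideal.span (Set.range F)).map (red π ε U) := by
    rw [Ideal.map_span, ← Set.range_comp,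
      show (red π ε U : Sec π A U → Γ(Y, U)) ∘ F = f from funext hFr, hf, hk]
    exact Ideal.mem_map_of_mem _ hx
  exact (mem_map_red_iff ε).1 h2

/-- Local liftings exist: the generators lift by the surjectivity of restriction from `A'` to `A` on
affine opens, the bracket even globally. -/
theorem Deformation.nonempty_localLiftings [IsClosedImmersion i] [IsLocalRing A] [IsArtinianRing A]
    [IsLocalRing A'] [IsArtinianRing A'] (hφ : Function.Surjective φ)
    (hreg : IsRegularEmbedding i) (η : Deformation i Λ₀ ε) : Nonempty (LocalLiftings η φ) := by
  choose U hyU hU n f hf hspan using hreg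
  choose G hGr hG using fun y => η.exists_generators (hU y) (hspan y)
  choose F hF using fun y α => mp_surjective (π := π) hφ (hU y) (G y α)
  obtain ⟨B, hB, hBr, hBm⟩ := η.exists_bracket_lift hφ
  refine ⟨⟨⟨U, hyU⟩, hU, n, f, hf, hspan, F, fun y α => ?_, fun y => ?_,
    fun y V v => B V.1 (v 0) (v 1),
    fun y => ⟨fun V _ => (hB V).isPolyderivation, fun V W _ h v => hBr V W h _ _⟩,
    fun y V _ a b => hBm V a b⟩⟩
  · refine res_injective_of_eq (Thick.fibre_preimage π (ε.comp φ) (U y)) ?_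
    change red π (ε.comp φ) (U y) (F y α) = red π (ε.comp φ) (U y) (pull π A' (U y) (f y α))
    rw [red_pull, ← red_mp, hF, hGr]
  · have e := Thick.map_preimage π φ (U y)
    rw [ker_app_eq_map_res η.ideal.subschemeι e.symm]
    change _ = Ideal.map _ (secIdeal η.ideal (U y))
    rw [← hG y, Ideal.map_span, ← Set.range_comp]
    congr 2
    funext α
    change _ = res _ (G y α)
    rw [← hF]
    exact (res_self _ _).symm.trans (res_res _ _ _).symm

end Existence

/-! ### First-order deformations -/

section Trivial

variable {k : Type u} [Field k] {X Y : Scheme.{u}} {π : Y ⟶ Spec (.of k)} {i : X ⟶ Y}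
  {Λ₀ : PoissonStructure π} {ΛX : PoissonStructure (i ≫ π)}
  {A : Type u} [CommRing A] [Algebra k A] {ε : A →ₐ[k] k} {t : A}

/-- The ideal generated by an ideal `I` of `B` in a thickening of `B` meets the kernel of the
reduction in `m I`. -/
theorem IsThickening.mem_of_mem_map {A B O : Type*} [CommRing A] [CommRing B] [CommRing O]
    {c : A →+* O} {p : B →+* O} {r : O →+* B} {m : Ideal A} {t : A}
    (hT : IsThickening c p r m t) {I : Ideal B} {x : O} (hx : x ∈ I.map p) (hx0 : r x = 0) :
    x ∈ m.map c * I.map p := by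
  have key : ∀ x ∈ I.map p, x - p (r x) ∈ m.map c * I.map p := by
    intro x hx
    refine Submodule.span_induction (p := fun x _ => x - p (r x) ∈ m.map c * I.map p)
      ?_ ?_ (fun x y _ _ hx hy => ?_) (fun a x hx ih => ?_) hx
    · rintro _ ⟨f, -, rfl⟩
      rw [hT.r_p, sub_self]
      exact zero_mem _
    · rw [map_zero, map_zero, sub_zero]
      exact zero_mem _
    · rw [map_add, map_add, add_sub_add_comm]
      exact add_mem hx hy
    · have e : a • x - p (r (a • x)) = (a - p (r a)) * x + p (r a) * (x - p (r x)) := by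
        rw [smul_eq_mul, map_mul, map_mul]; ring
      rw [e]
      exact add_mem (Ideal.mul_mem_mul (hT.mem_map _ (by rw [map_sub, hT.r_p, sub_self])) hx)
        (Ideal.mul_mem_left _ _ ih)
  simpa [hx0] using key x hx

/-- The trivial deformation of `X` in `(Y, Λ₀)`: the bracket is the `A`-bilinear extension of `Λ₀`, and
the ideal is generated by that of `X`. -/
theorem exists_trivial_lift [IsClosedImmersion i] [IsLocalRing A] [IsArtinianRing A]
    (ht : IsSmall ε t) (hi : IsPoissonHom i ΛX Λ₀) :
    ∃ L : PreLift π A, IsLift Λ₀ i ε t L ⊤ ∧ IsObs ε t L ⊤ (0 : PairFamily i ⊤ 1) ∧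
      ∀ W, IsAffineOpen W → (∀ a b, L.br W (pull π A W a) (pull π A W b) =
          pull π A W (Λ₀.bracket W a b)) ∧
        L.J W = (RingHom.ker (i.app W).hom).map (pull π A W) := by
  have hb := Λ₀.isBiderivation
  obtain ⟨B, hB, hBr, hBp⟩ := exists_bracket_of_affine ε
    (fun W a b => pull π A W (Λ₀.bracket W a b))
    (fun W a b b' => by rw [(hb W).add_right, map_add])
    (fun W hW a b b' => by rw [(hb W).leibniz, map_add, map_mul, map_mul])
    (fun W a x => by rw [(hb W).const_right, map_zero])
    (fun W a => by rw [(hb W).self, map_zero])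
    (fun W a b => by rw [(hb W).skew, map_neg])
    (fun V W hV hW h a b => by rw [tres_pull, Λ₀.restrict])
  have hjac : ∀ W, IsAffineOpen W → ∀ u v w : Sec π A W,
      jacobiSum (B (Thick.proj π A ⁻¹ᵁ W)) u v w = 0 := by
    intro W hW
    let := constAlgebra π W
    have hO := Thick.isTensor π (A := A) hW
    have hb := hB (Thick.proj π A ⁻¹ᵁ W)
    -- By `A`-linearity and rotation it suffices to check the Jacobi identity on functions on `Y`.
    have key : ∀ v w, (∀ b, jacobiSum (B (Thick.proj π A ⁻¹ᵁ W)) (pull π A W b) v w = 0) →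
        ∀ u, jacobiSum (B (Thick.proj π A ⁻¹ᵁ W)) u v w = 0 := by
      intro v w h
      refine hO.induction (fun a b => ?_) fun x y hx hy => ?_
      · rw [hb.jacobi_const_mul, h, mul_zero]
      · rw [hb.jacobi_add, hx, hy, add_zero]
    refine fun u v w => key v w (fun b => ?_) u
    rw [jacobiSum_rotate]
    refine key _ _ (fun b' => ?_) v
    rw [jacobiSum_rotate]
    refine key _ _ (fun b'' => ?_) w
    simp only [jacobiSum, hBp W hW]
    rw [← map_add, ← map_add, ← map_zero (pull π A W)]
    exact congrArg _ (Λ₀.jacobi W b'' b b')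
  have hpois : ∀ W, IsAffineOpen W → ∀ x ∈ (RingHom.ker (i.app W).hom).map (pull π A W),
      ∀ u, B (Thick.proj π A ⁻¹ᵁ W) x u ∈ (RingHom.ker (i.app W).hom).map (pull π A W) := by
    intro W hW x hx u
    let := constAlgebra π W
    have hb' := hB (Thick.proj π A ⁻¹ᵁ W)
    refine Submodule.span_induction (p := fun x _ => B (Thick.proj π A ⁻¹ᵁ W) x u ∈
      (RingHom.ker (i.app W).hom).map (pull π A W)) ?_ ?_ (fun x y _ _ hx hy => ?_)
      (fun a x hx ih => ?_) hx
    · rintro _ ⟨f, hf, rfl⟩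
      revert u
      refine (Thick.isTensor π (A := A) hW).induction (fun a b => ?_) fun x y hx hy => ?_
      · rw [hb'.const_mul_right, hBp W hW]
        refine Ideal.mul_mem_left _ _ (Ideal.mem_map_of_mem _ ?_)
        rw [(hb W).skew]
        exact neg_mem (bracket_mem_ker hi W b f hf)
      · rw [hb'.add_right]
        exact add_mem hx hy
    · rw [hb'.zero_left]
      exact zero_mem _
    · rw [hb'.add_left]
      exact add_mem hx hy
    · rw [smul_eq_mul, hb'.leibniz_left]
      exact add_mem (Ideal.mul_mem_left _ _ ih) (Ideal.mul_mem_right _ _ hx)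
  have hL : IsLift Λ₀ i ε t ⟨fun W => B (Thick.proj π A ⁻¹ᵁ W),
      fun W => (RingHom.ker (i.app W).hom).map (pull π A W)⟩ ⊤ := by
    refine ⟨fun W hW _ => ⟨hB _, ?_, ?_, fun u v w => ⟨0, ?_⟩, fun x hx u => ⟨0, ?_⟩⟩,
      fun V W _ _ _ h x y => hBr _ _ _ x y, fun V W _ _ _ h x hx => ?_⟩
    · let := constAlgebra π W
      exact (Thick.isTensor π (A := A) hW).biderivation_ext (g := ε) (map_add (red π ε W))
        (fun a x => by rw [map_mul, red_cst]) (hB _) (hb W)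
        (fun a b => by
          rw [red_pull, red_pull]
          exact (congrArg _ (hBp W hW a b)).trans (red_pull π ε W _))
    · let := constAlgebra π W
      have hT := ht.isThickening (π := π) hW
      refine (Thick.isTensor π hW).isFlatIdeal ε ht.nilpotent (red_cst π ε W) hT ht.ne_zero
        (fun x hx => ?_) (fun f hf => ⟨pull π A W f, Ideal.mem_map_of_mem _ hf, red_pull π ε W f⟩)
        fun x hx => hT.mem_of_mem_map hx
      have h1 := Ideal.mem_map_of_mem (red π ε W) hx
      rwa [Ideal.map_map, show (red π ε W).comp (pull π A W) = RingHom.id _ from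
        RingHom.ext (red_pull π ε W), Ideal.map_id] at h1
    · rw [map_zero, mul_zero]
      exact hjac W hW u v w
    · rw [map_zero, mul_zero, sub_zero]
      exact hpois W hW x hx u
    · have h1 := Ideal.mem_map_of_mem (tres π h) hx
      rw [Ideal.map_map] at h1
      refine Ideal.map_le_iff_le_comap.2 (fun f hf => ?_) h1
      rw [Ideal.mem_comap, RingHom.comp_apply, tres_pull]
      exact Ideal.mem_map_of_mem _ (kres i h ⟨f, hf⟩).2
  exact ⟨_, hL, hL.isObs_zero (fun W hW _ => hjac W hW) fun W hW _ => hpois W hW,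
    fun W hW => ⟨hBp W hW, rfl⟩⟩

/-- If `t` spans the maximal ideal, then all lifts agree modulo `t`. -/
theorem IsLift.isCong (ht : IsSmall ε t) (hker : RingHom.ker ε = Ideal.span {t})
    {L L' : PreLift π A} {U : Y.Opens} (hL : IsLift Λ₀ i ε t L U) (hL' : IsLift Λ₀ i ε t L' U) :
    IsCong t L L' U := by
  have hex : ∀ W, IsAffineOpen W → ∀ x : Sec π A W, red π ε W x = 0 →
      ∃ g, x = cst π A W t * pull π A W g := by
    intro W hW x hx
    have h1 := mem_map_of_red_eq_zero π hW ε hx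
    rw [hker, Ideal.map_span, Set.image_singleton, Ideal.mem_span_singleton'] at h1
    obtain ⟨y, rfl⟩ := h1
    exact ⟨_, (mul_comm _ _).trans ((ht.isThickening hW).t_mul y)⟩
  have key : ∀ {L L' : PreLift π A}, IsLift Λ₀ i ε t L U → IsLift Λ₀ i ε t L' U →
      ∀ W, IsAffineOpen W → W ≤ U →
        IsCongruentAt (cst π A W) (pull π A W) t (L.br W) (L.J W) (L'.br W) (L'.J W) := by
    intro L L' h h' W hW hWU
    refine ⟨fun u v => hex W hW _ ?_, fun x hx => ?_⟩
    · rw [map_sub, (h.modT W hW hWU).r_br, (h'.modT W hW hWU).r_br, sub_self]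
    · obtain ⟨y, hy, hyx⟩ := (h'.modT W hW hWU).flat.exists_lift _
        ((h.modT W hW hWU).flat.ρ_r x hx)
      obtain ⟨g, hg⟩ := hex W hW (x - y) (by rw [map_sub, hyx, sub_self])
      exact ⟨g, by rwa [← hg, sub_sub_cancel]⟩
  exact ⟨key hL hL', key hL' hL⟩

theorem PoissonStructure.ext_bracket {R : Type u} [CommRing R] {Z : Scheme.{u}}
    {ρ : Z ⟶ Spec (.of R)} {Λ Λ' : PoissonStructure ρ} (h : Λ.bracket = Λ'.bracket) : Λ = Λ' := by
  cases Λ; cases Λ'; cases h; rfl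

theorem Deformation.ext_of_affine [IsLocalRing A] [IsArtinianRing A] {η η' : Deformation i Λ₀ ε}
    (h : ∀ W, IsAffineOpen W → η.preLift.br W = η'.preLift.br W ∧
      η.preLift.J W = η'.preLift.J W) : η = η' := by
  refine Deformation.ext (PoissonStructure.ext_bracket ?_) ?_
  · funext V x y
    refine IsCoveredBy.eq_of_res_eq (S := fun _ => True) ε (fun z _ => ⟨⊤, trivial, trivial⟩)
      (fun _ _ _ _ => trivial) fun W hW _ hWV => ?_
    rw [η.Λ.restrict, η'.Λ.restrict]
    exact congrFun (congrFun (h W hW).1 _) _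
  · refine Scheme.IdealSheafData.ext_of_iSup_eq_top
      (fun W : {W : Y.affineOpens // True} => ⟨_, isAffineOpen_proj π W.1.2⟩)
      (exists_affine_cover_proj π A (fun _ => True) fun y => ?_) fun W => ?_
    · obtain ⟨W, hW, -, hy⟩ := exists_affine_le (T := Y) (V := ⊤) (x := y) trivial
      exact ⟨W, hW, trivial, hy⟩
    · rw [← secIdeal_eq _ W.1.2, ← secIdeal_eq _ W.1.2]
      exact (h W.1 W.1.2).2

theorem IsDiff.congr_left {L L' L'' : PreLift π A} {U : Y.Opens} {a : PairFamily i U 0}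
    (h : IsDiff ε t L L' U a)
    (he : ∀ W, IsAffineOpen W → L''.br W = L.br W ∧ L''.J W = L.J W) : IsDiff ε t L'' L' U a :=
  ⟨h.mem, fun W hW hWU => by
    rw [(he W hW).1, (he W hW).2]
    exact h.at_affine W hW hWU⟩

/-- If `t` spans the maximal ideal of `A`, then the deformations over `A` correspond to the
elements of `ℍ⁰`: a deformation is sent to its difference from the trivial one. -/
theorem exists_deformation_equiv [IsClosedImmersion i] [IsLocalRing A] [IsArtinianRing A]
    [IsSeparated π] [QuasiCompact π] (ht : IsSmall ε t) (hker : RingHom.ker ε = Ideal.span {t})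
    (hi : IsPoissonHom i ΛX Λ₀) :
    ∃ e : Deformation i Λ₀ ε ≃ H0 hi, ∀ η,
      (∀ (V : Y.Opens) (a b : Γ(Y, V)),
        η.Λ.bracket _ (pull π A V a) (pull π A V b) =
          pull π A V (Λ₀.bracket V a b) - tmul π t ((e η).1.1 ⟨V, (le_top : V ≤ ⊤)⟩ ![a, b])) ∧
      (∀ (V : Y.Opens) (f : RingHom.ker (i.app V).hom) (g : Γ(Y, V)),
        (η.ideal.subschemeι.app _).hom (pull π A V f + tmul π t g) = 0 →
          (e η).1.2 ⟨V, (le_top : V ≤ ⊤)⟩ f ![] = (i.app V).hom g) := by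
  obtain ⟨L, hL, hO, hLp⟩ := exists_trivial_lift ht hi
  have hc : ∀ {L₁ L₂ : PreLift π A}, IsLift Λ₀ i ε t L₁ ⊤ → IsLift Λ₀ i ε t L₂ ⊤ →
    IsCong t L₁ L₂ ⊤ := fun h₁ h₂ => h₁.isCong ht hker h₂
  choose a ha using fun η : Deformation i Λ₀ ε =>
    (η.isLift ht).exists_isDiff ht hL (hc (η.isLift ht) hL)
  have hH0 : ∀ η, a η ∈ H0 hi := fun η => by
    have h1 := IsDiff.differential_eq ht (η.isLift ht) hL (hc (η.isLift ht) hL) hi (η.isObs ht)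
      hO (ha η)
    rw [sub_zero, zero_add] at h1
    exact ⟨(ha η).mem, h1⟩
  have hinj : ∀ η η', a η = a η' → η = η' := by
    intro η η' h
    have h₁ := η.isLift ht
    have h₂ := η'.isLift ht
    obtain ⟨d, hd⟩ := h₁.exists_isDiff ht h₂ (hc h₁ h₂)
    have h3 := (IsDiff.add ht (hc h₁ h₂) (hc h₂ hL) hL hd (ha η')).unique ht h₁ (hc h₁ hL) (ha η)
    rw [h, add_eq_right] at h3
    rw [h3] at hd
    exact Deformation.ext_of_affine fun W hW => hd.eq_of_zero ht h₁ h₂ (hc h₁ h₂) hW le_top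
  have hsurj : ∀ b ∈ H0 hi, ∃ η, a η = b := by
    intro b hb
    have hb1 : b ∈ complexSections π i ⊤ 0 := hb.1
    have hb2 : differential hi ⊤ 0 b = 0 := hb.2
    -- The elements of `ℍ⁰` are differences *from* a deformation *to* the trivial one, so the
    -- trivial one is twisted by `-b`.
    obtain ⟨L', hL', hc', hd'⟩ := hL.exists_twist ht (neg_mem hb1)
    obtain ⟨s, hs⟩ := hL'.exists_isObs ht
    have h1 := IsDiff.differential_eq ht hL hL' hc' hi hO hs hd'
    rw [map_neg, hb2, sub_zero, neg_zero, add_zero] at h1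
    rw [h1] at hs
    obtain ⟨η, hη⟩ := exists_deformation (S := fun _ => True) ht (fun _ _ _ _ => trivial)
      (fun y => by
        obtain ⟨W, hW, -, hy⟩ := exists_affine_le (T := Y) (V := ⊤) (x := y) trivial
        exact ⟨W, hW, trivial, hy⟩) L' (fun W _ _ => hL'.mono le_top)
      fun W _ _ => hs.restrict le_top
    obtain ⟨d, hd⟩ := hL'.exists_isDiff ht hL (hc hL' hL)
    have h2 := (IsDiff.add ht hc' (hc hL' hL) hL hd' hd).unique ht hL (hc hL hL) hL.isDiff_refl
    rw [neg_add_eq_zero] at h2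
    rw [← h2] at hd
    exact ⟨η, (ha η).unique ht (η.isLift ht) (hc (η.isLift ht) hL)
      (hd.congr_left fun W hW => hη W hW trivial)⟩
  refine ⟨Equiv.ofBijective (fun η => ⟨a η, hH0 η⟩)
    ⟨fun η η' h => hinj η η' (congrArg Subtype.val h), fun b => ?_⟩, fun η =>
    ⟨fun V x y => ?_, fun V f g hfg => ?_⟩⟩
  · obtain ⟨η, hη⟩ := hsurj b.1 b.2
    exact ⟨η, Subtype.ext hη⟩
  · change _ = pull π A V (Λ₀.bracket V x y) - tmul π t ((a η).1 ⟨V, (le_top : V ≤ ⊤)⟩ ![x, y])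
    refine eq_of_tres_affine fun W hW hWV => ?_
    have h1 := ((ha η).at_affine W hW le_top).bivector (res hWV x) (res hWV y)
    rw [(hLp W hW).1, sub_eq_iff_eq_add, neg_add_eq_sub] at h1
    rw [η.Λ.restrict, tres_pull, tres_pull, map_sub, tmul, map_mul, tres_cst, tres_pull, tres_pull,
      Λ₀.restrict, (ha η).mem.1.restrict V W le_top hWV, vec_two fun l => res hWV _]
    exact h1
  · change (a η).2 ⟨V, (le_top : V ≤ ⊤)⟩ f ![] = _
    refine eq_of_res_preimage_affine fun W hW hWV => ?_
    have h0 : tres π hWV (pull π A V f + tmul π t g) ∈ secIdeal η.ideal W :=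
      tres_mem_secIdeal η.ideal hWV hfg
    rw [tmul, map_add, map_mul, tres_cst, tres_pull, tres_pull] at h0
    have h1 := ((ha η).at_affine W hW le_top).normal _ h0 (kres i hWV f) (by
      rw [map_add, (ht.isThickening hW).r_t, add_zero, red_pull]; rfl) (res hWV g) (by
      rw [add_sub_cancel_right, (hLp W hW).2]
      exact Ideal.mem_map_of_mem _ (kres i hWV f).2)
    rw [(ha η).mem.2.restrict V W le_top hWV f (kres i hWV f) rfl, ← app_res i hWV, ← h1]
    exact congrArg ((a η).2 ⟨W, (le_top : W ≤ ⊤)⟩ (kres i hWV f)) (Subsingleton.elim _ _)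

end Trivial

/-! ### Small extensions and the class of an obstruction cochain -/

section DualNumber

variable (k : Type u) [Field k]

instance : IsArtinianRing (DualNumber k) :=
  have : Module.Finite k (DualNumber k) := inferInstanceAs (Module.Finite k (k × k))
  IsArtinianRing.of_finite k (DualNumber k)

theorem ker_fstHom :
    RingHom.ker (TrivSqZeroExt.fstHom k k k : DualNumber k →ₐ[k] k) =
      Ideal.span {(DualNumber.eps : DualNumber k)} := by
  ext x
  rw [Ideal.mem_span_singleton, ← DualNumber.fst_eq_zero_iff_eps_dvd]
  rfl

end DualNumber

theorem isSmall_of_ker_eq {k A A' : Type u} [Field k] [CommRing A] [Algebra k A] [CommRing A']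
    [Algebra k A'] [IsLocalRing A'] [IsArtinianRing A'] (ε : A →ₐ[k] k) {φ : A' →ₐ[k] A} {t : A'}
    (hker : RingHom.ker φ = Ideal.span {t}) (h0 : t ≠ 0)
    (h : ∀ m ∈ IsLocalRing.maximalIdeal A', m * t = 0) : IsSmall (ε.comp φ) t where
  ne_zero := h0
  mem := by
    have h1 : t ∈ RingHom.ker φ := hker ▸ Ideal.mem_span_singleton_self t
    have h2 : φ t = 0 := h1
    exact (congrArg ε h2).trans (map_zero ε)
  mul a ha := h a (ker_eq_maximalIdeal (ε.comp φ) ▸ ha)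
  nilpotent := isNilpotent_ker (ε.comp φ)

theorem isSmall_eps (k : Type u) [Field k] :
    IsSmall (TrivSqZeroExt.fstHom k k k : DualNumber k →ₐ[k] k) (DualNumber.eps : DualNumber k) where
  ne_zero h := one_ne_zero (α := k) (congrArg TrivSqZeroExt.snd h)
  mem := TrivSqZeroExt.fst_inr k 1
  mul a ha := by
    rw [ker_fstHom, Ideal.mem_span_singleton'] at ha
    obtain ⟨b, rfl⟩ := ha
    rw [mul_assoc, DualNumber.eps_mul_eps, mul_zero]
  nilpotent := isNilpotent_ker _

section Obstruction

variable {k : Type u} [Field k] {X Y : Scheme.{u}} {π : Y ⟶ Spec (.of k)} {i : X ⟶ Y}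
  {Λ₀ : PoissonStructure π} {ΛX : PoissonStructure (i ≫ π)}
  {A : Type u} [CommRing A] [Algebra k A] [IsLocalRing A] [IsArtinianRing A] {ε : A →ₐ[k] k}
  {A' : Type u} [CommRing A'] [Algebra k A'] [IsLocalRing A'] [IsArtinianRing A']
  {φ : A' →ₐ[k] A} {t : A'}

omit [IsLocalRing A] [IsArtinianRing A] [IsLocalRing A'] [IsArtinianRing A'] in
theorem IsObstructionCochain.isDatum [IsClosedImmersion i] (ht : IsSmall (ε.comp φ) t)
    (hφ : Function.Surjective φ) (hker : RingHom.ker φ = Ideal.span {t})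
    {η : Deformation i Λ₀ ε} {D : LocalLiftings η φ} {s : CechFamily i D.cover}
    (hs : IsObstructionCochain D t s) :
    IsDatum Λ₀ (ε.comp φ) t D.cover D.preLift s where
  isLift := D.isLift ht hφ hker
  isCong := D.isCong ht hφ hker
  isObs := (hs.isObs_isDiff D ht hφ hker).1
  isDiff := (hs.isObs_isDiff D ht hφ hker).2

/-- The obstruction class vanishes if and only if there is a lifting. -/
theorem IsObstructionCochain.mk_eq_zero_iff [IsClosedImmersion i] [IsSeparated π] [QuasiCompact π]
    (hi : IsPoissonHom i ΛX Λ₀) (ht : IsSmall (ε.comp φ) t)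
    (hφ : Function.Surjective φ) (hker : RingHom.ker φ = Ideal.span {t})
    {η : Deformation i Λ₀ ε} {D : LocalLiftings η φ} {s : CechFamily i D.cover}
    (hs : IsObstructionCochain D t s) :
    H1.mk hi ⟨s, (hs.isDatum ht hφ hker).mem_cocycles hi ht⟩ = 0 ↔
      ∃ η' : Deformation i Λ₀ (ε.comp φ), η'.Lifts η := by
  have hd := hs.isDatum ht hφ hker
  constructor
  · intro h0
    obtain ⟨𝒱, hr, L', hL', hc⟩ := hd.exists_zero_of_mk_eq_zero ht h0
    obtain ⟨η', hη'⟩ := hL'.exists_deformation ht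
    refine ⟨η', (Deformation.lifts_iff (fun W => ∃ y, W ≤ 𝒱.U y)
      (fun V W hWV ⟨y, hy⟩ => ⟨y, hWV.trans hy⟩) fun y => ?_).2 ?_⟩
    · obtain ⟨W, hW, hle, hy⟩ := exists_affine_le (𝒱.mem y)
      exact ⟨W, hW, ⟨y, hle⟩, hy⟩
    · rintro W - ⟨y, hy⟩
      have h1 := ((D.isOver y).mono (hr y)).of_isCong hker (hc y)
      refine ⟨fun V hV hVW => ?_, fun V hV hVW => ?_⟩
      · rw [(hη' y V hV (hVW.trans hy)).1]
        exact h1.br V hV (hVW.trans hy)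
      · rw [(hη' y V hV (hVW.trans hy)).2]
        exact h1.J V hV (hVW.trans hy)
  · rintro ⟨η', hη'⟩
    have h1 := (Deformation.lifts_iff (fun _ => True) (fun _ _ _ _ => trivial) fun y => by
      obtain ⟨W, hW, -, hy⟩ := exists_affine_le (T := Y) (V := ⊤) (x := y) trivial
      exact ⟨W, hW, trivial, hy⟩).1 hη'
    have h2 : IsOver φ η η'.preLift ⊤ := ⟨fun W hW _ => (h1 W hW trivial).br W hW le_rfl,
      fun W hW _ => (h1 W hW trivial).J W hW le_rfl⟩
    let 𝒱 : PointCover Y := ⟨fun _ => ⊤, fun _ => trivial⟩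
    have h3 : IsDatum Λ₀ (ε.comp φ) t 𝒱 (fun _ => η'.preLift) (0 : CechFamily i 𝒱) :=
      ⟨fun _ => η'.isLift ht, fun _ _ => (h2.isCong ht hφ hker h2).mono le_top,
        fun _ => η'.isObs ht, fun _ _ => ((η'.isLift ht).mono le_top).isDiff_refl⟩
    rw [hd.mk_eq ht h3 fun y => ((D.isOver y).isCong ht hφ hker (h2.mono le_top)).mono inf_le_left]
    exact H1.mk_zero hi _

end Obstruction

end PoissonDef

end

theorem propositionC {k : Type u} [Field k] [IsAlgClosed k] [CharZero k]
    {Y X : Scheme.{u}} (π : Y ⟶ Spec (.of k)) (i : X ⟶ Y)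
    [Smooth π] [IsSeparated π] [QuasiCompact π] [IsClosedImmersion i]
    (Λ₀ : PoissonDef.PoissonStructure π) (ΛX : PoissonDef.PoissonStructure (i ≫ π))
    (hi : PoissonDef.IsPoissonHom i ΛX Λ₀) (hreg : PoissonDef.IsRegularEmbedding i) :
    -- first-order deformations
    (∃ e : PoissonDef.Deformation i Λ₀ (TrivSqZeroExt.fstHom k k k : DualNumber k →ₐ[k] k) ≃
        PoissonDef.H0 hi,
      ∀ η,
        (∀ (V : Y.Opens) (a b : Γ(Y, V)),
          η.Λ.bracket _ (PoissonDef.pull π (DualNumber k) V a)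
              (PoissonDef.pull π (DualNumber k) V b) =
            PoissonDef.pull π (DualNumber k) V (Λ₀.bracket V a b) -
              PoissonDef.tmul π (DualNumber.eps : DualNumber k)
                ((e η).1.1 ⟨V, (le_top : V ≤ ⊤)⟩ ![a, b])) ∧
        (∀ (V : Y.Opens) (f : RingHom.ker (i.app V).hom) (g : Γ(Y, V)),
          (η.ideal.subschemeι.app _).hom (PoissonDef.pull π (DualNumber k) V f +
              PoissonDef.tmul π (DualNumber.eps : DualNumber k) g) = 0 →
            (e η).1.2 ⟨V, (le_top : V ≤ ⊤)⟩ f ![] = (i.app V).hom g)) ∧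
    -- obstructions
    (∀ (A A' : Type u) [CommRing A] [Algebra k A] [IsLocalRing A] [IsArtinianRing A]
      [CommRing A'] [Algebra k A'] [IsLocalRing A'] [IsArtinianRing A']
      (ε : A →ₐ[k] k) (φ : A' →ₐ[k] A) (t : A'),
      Function.Surjective φ → RingHom.ker φ = Ideal.span {t} → t ≠ 0 →
      (∀ m ∈ IsLocalRing.maximalIdeal A', m * t = 0) →
      ∀ η : PoissonDef.Deformation i Λ₀ ε,
        ∃ o : PoissonDef.H1 hi,
          (∃ (D : PoissonDef.LocalLiftings η φ) (s : PoissonDef.CechFamily i D.cover),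
            PoissonDef.IsObstructionCochain D t s) ∧
          (∀ (D : PoissonDef.LocalLiftings η φ) (s : PoissonDef.CechFamily i D.cover),
            PoissonDef.IsObstructionCochain D t s →
              ∃ hs : s ∈ PoissonDef.cocycles hi D.cover,
                PoissonDef.H1.mk hi ⟨s, hs⟩ = o) ∧
          (o = 0 ↔ ∃ η' : PoissonDef.Deformation i Λ₀ (ε.comp φ), η'.Lifts η)) := by
  refine ⟨PoissonDef.exists_deformation_equiv (PoissonDef.isSmall_eps k) (PoissonDef.ker_fstHom k)
    hi, fun A A' _ _ _ _ _ _ _ _ ε φ t hφ hker h0 hmul η => ?_⟩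
  have ht := PoissonDef.isSmall_of_ker_eq ε hker h0 hmul
  obtain ⟨D⟩ := η.nonempty_localLiftings hφ hreg
  obtain ⟨s, hs1, hs2⟩ := D.exists_isObs_isDiff ht hφ hker
  have hs := PoissonDef.isObstructionCochain_of_isObs D hs1 hs2
  refine ⟨_, ⟨D, s, hs⟩, fun D' s' hs' => ⟨(hs'.isDatum ht hφ hker).mem_cocycles hi ht, ?_⟩,
    hs.mk_eq_zero_iff hi ht hφ hker⟩
  exact (hs'.isDatum ht hφ hker).mk_eq ht (hs.isDatum ht hφ hker) fun y =>
    ((D'.isOver y).mono inf_le_left).isCong ht hφ hker ((D.isOver y).mono inf_le_right)
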